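/- A \emph{short forest} is a finite sequence of nontrivial planar trees of depth 2; a tree is recorded by the list of the positive numbers of leaves on its branches. A \emph{triple} $(F,T,G)$ consists of short forests $F,G$ (possibly empty) and a tree $T$ (possibly the trivial tree $1$ without branches). The dimension of $F$ is the number of branches minus the number of trees; the dimension of $(F,T,G)$ is $\dim F+\dim G$ plus the number of branches of $T$. Write $\circ$ for concatenation of forests. \emph{Leaf multiplication} by positive integers $n_1,\dots,n_k$ replaces the $i$-th of $k$ leaves by $n_i$ leaves on the same branch. The freehedron $\mathcal F_n$ is the following subdivision of $[0,1]^n$: $\mathcal F_0$ is a point, $\mathcal F_1=[0,1]$ with distinguished hyperface $X_1=\{1\}$, and for $n\ge 1$, $\mathcal F_{n+1}$ is $\mathcal F_n\times[0,1]$ with the hyperface $X_n\times[0,1]$ split into $X_n\times[0,\frac12]$ and $X_{n+1}=X_n\times[\frac12,1]$. \textbf{Proposition.} (1) The faces of $\mathcal F_n$ are labelled by the triples with $n$ leaves: each triple $(F,T,G)$ determines a face, namely the box whose coordinates $x_n,x_{n-1},\dots,x_1$ correspond to the leaves of $F,T,G$ from left to right. If the next leaf is on the same branch, the coordinate is $1$;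 if it is on another branch of the same tree, the coordinate ranges over $[0,1]$ in $F$ and $T$ and over $[\frac12,1]$ in $G$; at the last leaf of a tree, it is $0$ in $F$, ranges over $[0,1]$ in $T$ (over $[0,\frac12]$ if $G\neq\emptyset$), and is $\frac12$ in $G$, except for the last tree of $G$, where it is $1$. These boxes are exactly the faces of $\mathcal F_n$, and one face is contained in another if and only if its label arises from the label of the other by a sequence of the following steps: unite two neighbouring branches of a tree; separate a tree of $F$ or of $G$ into two trees between two neighbouring branches; replace $(F,T_l T_r,G)$ by $(F\circ T_l,T_r,G)$ with $T_l\ne 1$, or by $(F,T_l,T_r\circ G)$ with $T_r\neq 1$, where $T_lT_r$ is the tree with the branches of $T_l$ followed by those of $T_r$. (2) There are an $(\mathbf a,\mathbf m)$-coloured CW-operad $I$ (a non-symmetric coloured operad in finite CW-complexes, with continuous cellular structure maps) and a CW-operadic bimodule $\mathcal F$ over $I$ (in the same sense, with strictly unital, associative and commuting left and right actions) such that: (a) $I(\mathbf a^n;\mathbf a)$ and $\mathcal F(\mathbf a^n;\mathbf a)$ are points for $n\ge 1$; $I(\mathbf a^n,\mathbf m;\mathbf m)$ is the cube $[0,1]^{n-1}$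 (a point for $n=0$) and $\mathcal F(\mathbf a^n,\mathbf m;\mathbf m)$ is the freehedron $\mathcal F_n$, for $n\ge 0$; all other components are empty. (b) The cells of the cube $I(\mathbf a^n,\mathbf m;\mathbf m)$ are its usual faces, labelled by the short forests with $n$ leaves: the $i$-th coordinate is $0$, ranges over $[0,1]$, or is $1$, according to whether the leaves $i$ and $i+1$ are on the same branch, on different branches of the same tree, or in different trees. The cells of $\mathcal F(\mathbf a^n,\mathbf m;\mathbf m)$ are the faces of $\mathcal F_n$, labelled by triples as in (1). Dimensions of cells are those of the labels. (c) Composition in $I$ and both actions are given on labels by leaf multiplication and forest concatenation: plugging operations of profiles $(\mathbf a^{n_i};\mathbf a)$ into the $\mathbf a$-inputs of the first operation multiplies its leaves by $n_1,\dots,n_k$, and then plugging the last argument into the $\mathbf m$-input yields $F\circ F'$ for composition in $I$, $(F'\circ F,T,G)$ for the left action of $F'$ on $(F,T,G)$, and $(F,T,G\circ G')$ for the right action of $G'$ on $(F,T,G)$. In each case the structure map carries the product of the two open cells bijectively onto the open cell with the resulting label. In coordinates, the composition of $I$ is the corresponding inclusion of faces: append the coordinate $1$ to the coordinates of every point of a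 cube with at least one leaf; then the composite of $x$ with the operations of arities $n_1,\dots,n_k$ and with $y$ arises by inserting $n_i-1$ zeros before the $i$-th coordinate of $x$ for each $i$, and then appending the coordinates of $y$. -/

import Mathlib

open Set Topology

/-! ## Coloured operads and operadic bimodules in CW-complexes -/

/-- A coloured sequence in (finite) CW-complexes: one complex `obj L c` for every list `L` of input
colours and every output colour `c`.  The complexes are finite, so that products of them carry
the product topology. -/
structure CWSeq (C : Type) where
  obj : List C → C → Type
  [top : ∀ L c, TopologicalSpace (obj L c)]
  [t2 : ∀ L c, T2Space (obj L c)]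
  [cw : ∀ L c, CWComplex (univ : Set (obj L c))]
  [fin : ∀ L c, RelCWComplex.Finite (univ : Set (obj L c))]

attribute [instance] CWSeq.top CWSeq.t2 CWSeq.cw CWSeq.fin

namespace CWSeq

variable {C : Type}

/-- All operations of all profiles: the disjoint union of the spaces `obj L c`, with the topology
of a disjoint union. -/
abbrev Op (S : CWSeq C) : Type := Σ p : List C × C, S.obj p.1 p.2

variable {S R : CWSeq C}

def Op.inputs (x : S.Op) : List C := x.1.1

def Op.output (x : S.Op) : C := x.1.2

def Op.arity (x : S.Op) : ℕ := x.inputs.length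

/-- `x` seen as an operation. -/
def op {L : List C} {c : C} (x : S.obj L c) : S.Op := ⟨(L, c), x⟩

/-- The operations that lie in the `d`-skeleton of their component. -/
def skel (S : CWSeq C) (d : ℕ) : Set S.Op :=
  {x | x.2 ∈ (RelCWComplex.skeleton (univ : Set (S.obj x.1.1 x.1.2)) (d : ℕ∞) :
    Set (S.obj x.1.1 x.1.2))}

/-- The arguments `ys` can be plugged into the inputs of `x`. -/
def Fits (x : S.Op) (ys : List R.Op) : Prop := ys.map Op.output = x.inputs

/-- A two-level tree of operations: an operation with arguments for all of its inputs.  Such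
trees, over all profiles, are the points of the composition product of `S` and `R`. -/
structure Composite (S R : CWSeq C) where
  head : S.Op
  args : List R.Op
  fits : Fits head args

/-- A structure map from the composition product of `S` and `R` to `T`, that is, a family
of maps `S(c₁…cₖ;c) × R(L₁;c₁) × ⋯ × R(Lₖ;cₖ) → T(L₁⋯Lₖ;c)`, all of which are continuous and cellular
for the product cell structure. -/
structure CompMap (S R T : CWSeq C) where
  toFun : ∀ (x : S.Op) (ys : List R.Op), Fits x ys → T.Op
  inputs_eq : ∀ x ys h, (toFun x ys h).inputs = ys.flatMap Op.inputs
  output_eq : ∀ x ys h, (toFun x ys h).output = x.output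
  continuous : ∀ k : ℕ, Continuous
    fun p : {p : S.Op × (Fin k → R.Op) // Fits p.1 (List.ofFn p.2)} =>
      toFun p.1.1 (List.ofFn p.1.2) p.2
  cellular : ∀ (x : S.Op) (ys : List R.Op) (h : Fits x ys) (d : ℕ) (ds : List ℕ),
    x ∈ S.skel d → List.Forall₂ (fun y e => y ∈ R.skel e) ys ds →
      toFun x ys h ∈ T.skel (d + ds.sum)

/-- The result of composing the two-level tree `t`. -/
def CompMap.app {S R T : CWSeq C} (γ : CompMap S R T) (t : Composite S R) : T.Op :=
  γ.toFun t.head t.args t.fits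

end CWSeq

open CWSeq

/-- A (non-symmetric) coloured CW-operad.  In the associativity axiom, the hypotheses
`h₂` and `h₃` follow from `h₁`; they are there only to make the two sides well-formed. -/
structure CWOperad (C : Type) extends CWSeq C where
  unit : ∀ c, toCWSeq.obj [c] c
  comp : CompMap toCWSeq toCWSeq toCWSeq
  unit_comp : ∀ (x : toCWSeq.Op) (h : Fits (op (unit x.output)) [x]),
    comp.toFun (op (unit x.output)) [x] h = x
  comp_unit : ∀ (x : toCWSeq.Op) (h : Fits x (x.inputs.map fun c => op (unit c))),
    comp.toFun x (x.inputs.map fun c => op (unit c)) h = x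
  assoc : ∀ (x : toCWSeq.Op) (l : List (Composite toCWSeq toCWSeq))
    (h₁ : Fits x (l.map Composite.head))
    (h₂ : Fits (comp.toFun x (l.map Composite.head) h₁) (l.flatMap Composite.args))
    (h₃ : Fits x (l.map comp.app)),
    comp.toFun (comp.toFun x (l.map Composite.head) h₁) (l.flatMap Composite.args) h₂ =
      comp.toFun x (l.map comp.app) h₃

/-- An operadic bimodule in CW-complexes over a coloured CW-operad `P`: a coloured sequence with
commuting unital associative actions of `P` from the left and from the right. -/
structure CWBimodule {C : Type} (P : CWOperad C) extends CWSeq C where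
  left : CompMap P.toCWSeq toCWSeq toCWSeq
  right : CompMap toCWSeq P.toCWSeq toCWSeq
  unit_left : ∀ (x : toCWSeq.Op) (h : Fits (op (P.unit x.output)) [x]),
    left.toFun (op (P.unit x.output)) [x] h = x
  right_unit : ∀ (x : toCWSeq.Op) (h : Fits x (x.inputs.map fun c => op (P.unit c))),
    right.toFun x (x.inputs.map fun c => op (P.unit c)) h = x
  left_assoc : ∀ (x : P.toCWSeq.Op) (l : List (Composite P.toCWSeq toCWSeq))
    (h₁ : Fits x (l.map Composite.head))
    (h₂ : Fits (P.comp.toFun x (l.map Composite.head) h₁) (l.flatMap Composite.args))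
    (h₃ : Fits x (l.map left.app)),
    left.toFun (P.comp.toFun x (l.map Composite.head) h₁) (l.flatMap Composite.args) h₂ =
      left.toFun x (l.map left.app) h₃
  right_assoc : ∀ (x : toCWSeq.Op) (l : List (Composite P.toCWSeq P.toCWSeq))
    (h₁ : Fits x (l.map Composite.head))
    (h₂ : Fits (right.toFun x (l.map Composite.head) h₁) (l.flatMap Composite.args))
    (h₃ : Fits x (l.map P.comp.app)),
    right.toFun (right.toFun x (l.map Composite.head) h₁) (l.flatMap Composite.args) h₂ =
      right.toFun x (l.map P.comp.app) h₃
  left_right : ∀ (x : P.toCWSeq.Op) (l : List (Composite toCWSeq P.toCWSeq))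
    (h₁ : Fits x (l.map Composite.head))
    (h₂ : Fits (left.toFun x (l.map Composite.head) h₁) (l.flatMap Composite.args))
    (h₃ : Fits x (l.map right.app)),
    right.toFun (left.toFun x (l.map Composite.head) h₁) (l.flatMap Composite.args) h₂ =
      left.toFun x (l.map right.app) h₃

/-! ## Short forests and forest–tree–forest triples -/

/-- A planar tree of depth two: the list of the numbers of leaves on its branches. The
empty list is the trivial tree `1`, without branches. -/
abbrev ShortTree := List ℕ+

def ShortTree.leaves (t : ShortTree) : ℕ := (t.map fun k => (k : ℕ)).sum

/-- Leaf multiplication: the `i`-th leaf is replaced by `ns[i]` leaves on the same branch. It is used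
only with as many positive numbers `ns[i]` as there are leaves. -/
def ShortTree.mult : ShortTree → List ℕ → ShortTree
  | [], _ => []
  | k :: t, ns => (ns.take k).sum.toPNat' :: ShortTree.mult t (ns.drop k)

theorem ShortTree.mult_ne_nil {t : ShortTree} (h : t ≠ []) (ns : List ℕ) : t.mult ns ≠ [] := by
  cases t with
  | nil => exact absurd rfl h
  | cons k t => simp [ShortTree.mult]

/-- A short forest: a sequence of nontrivial trees of depth two. -/
@[ext]
structure ShortForest where
  trees : List ShortTree
  ne_nil : ∀ t ∈ trees, t ≠ []

namespace ShortForest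

def leaves (F : ShortForest) : ℕ := (F.trees.map ShortTree.leaves).sum

/-- The number of branches minus the number of trees. -/
def dim (F : ShortForest) : ℕ := (F.trees.map fun t => t.length - 1).sum

/-- Forest concatenation. -/
def concat (F G : ShortForest) : ShortForest where
  trees := F.trees ++ G.trees
  ne_nil t ht := (List.mem_append.1 ht).elim (F.ne_nil t) (G.ne_nil t)

/-- The forest that consists of one tree. -/
def single (t : ShortTree) (h : t ≠ []) : ShortForest where
  trees := [t]
  ne_nil s hs := by rw [List.mem_singleton.1 hs]; exact h

def multTrees : List ShortTree → List ℕ → List ShortTree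
  | [], _ => []
  | t :: F, ns => t.mult ns :: multTrees F (ns.drop t.leaves)

theorem multTrees_ne_nil (F : List ShortTree) (hF : ∀ t ∈ F, t ≠ []) (ns : List ℕ) :
    ∀ t ∈ multTrees F ns, t ≠ [] := by
  induction F generalizing ns with
  | nil => simp [multTrees]
  | cons s F ih =>
    intro t ht
    rcases List.mem_cons.1 ht with rfl | ht
    · exact ShortTree.mult_ne_nil (hF s (by simp)) ns
    · exact ih (fun u hu => hF u (by simp [hu])) _ t ht

/-- Leaf multiplication in a forest. -/
def mult (F : ShortForest) (ns : List ℕ) : ShortForest where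
  trees := multTrees F.trees ns
  ne_nil := multTrees_ne_nil F.trees F.ne_nil ns

/-- `Step F F₁`: the forest `F₁` arises from `F` by uniting two neighbouring branches of a tree, or by
separating a tree into two trees between two neighbouring branches. -/
inductive Step : ShortForest → ShortForest → Prop
  | unite {F F₁ : ShortForest} (A B : List ShortTree) (u v : ShortTree) (k l : ℕ+)
      (h : F.trees = A ++ (u ++ k :: l :: v) :: B)
      (h₁ : F₁.trees = A ++ (u ++ (k + l) :: v) :: B) : Step F F₁
  | separate {F F₁ : ShortForest} (A B : List ShortTree) (u v : ShortTree)
      (h : F.trees = A ++ (u ++ v) :: B)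
      (h₁ : F₁.trees = A ++ u :: v :: B) : Step F F₁

end ShortForest

/-- A forest–tree–forest triple `(F, T, G)`; the middle tree may be trivial. -/
@[ext]
structure Triple where
  fst : ShortForest
  mid : ShortTree
  lst : ShortForest

namespace Triple

def leaves (τ : Triple) : ℕ := τ.fst.leaves + τ.mid.leaves + τ.lst.leaves

/-- The dimension of the face labelled by a triple. -/
def dim (τ : Triple) : ℕ := τ.fst.dim + τ.mid.length + τ.lst.dim

/-- Leaf multiplication in a triple. -/
def mult (τ : Triple) (ns : List ℕ) : Triple where
  fst := τ.fst.mult ns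
  mid := τ.mid.mult (ns.drop τ.fst.leaves)
  lst := τ.lst.mult (ns.drop (τ.fst.leaves + τ.mid.leaves))

/-- `(F, T, G) ↦ (F' ∘ F, T, G)`. -/
def concatLeft (F' : ShortForest) (τ : Triple) : Triple := ⟨F'.concat τ.fst, τ.mid, τ.lst⟩

/-- `(F, T, G) ↦ (F, T, G ∘ G')`. -/
def concatRight (τ : Triple) (G' : ShortForest) : Triple := ⟨τ.fst, τ.mid, τ.lst.concat G'⟩

/-- `Step τ τ₁`: the triple `τ₁` labels a facet of the face labelled by `τ`.  Either a step is made in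
one of the two forests, or two neighbouring branches of the middle tree are united, or the middle
tree is cut in two, one part of which (nontrivial, while the other may be trivial) goes to the
adjacent forest. -/
inductive Step : Triple → Triple → Prop
  | fst {F F₁ : ShortForest} (T : ShortTree) (G : ShortForest) (h : F.Step F₁) :
      Step ⟨F, T, G⟩ ⟨F₁, T, G⟩
  | lst {G G₁ : ShortForest} (F : ShortForest) (T : ShortTree) (h : G.Step G₁) :
      Step ⟨F, T, G⟩ ⟨F, T, G₁⟩
  | unite (F G : ShortForest) (u v : ShortTree) (k l : ℕ+) :
      Step ⟨F, u ++ k :: l :: v, G⟩ ⟨F, u ++ (k + l) :: v, G⟩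
  | cutLeft (F G : ShortForest) (u v : ShortTree) (hu : u ≠ []) :
      Step ⟨F, u ++ v, G⟩ ⟨F.concat (ShortForest.single u hu), v, G⟩
  | cutRight (F G : ShortForest) (u v : ShortTree) (hv : v ≠ []) :
      Step ⟨F, u ++ v, G⟩ ⟨F, u, (ShortForest.single v hv).concat G⟩

end Triple

/-! ## Cubes and freehedra as polytopal complexes -/

/-- One set of reals for each leaf of a tree: `same` if the next leaf is on the same branch, `inner`
if it is on another branch of the tree, and `outer` if there is no next leaf in the tree. -/
def treeSides (same inner outer : Set ℝ) : ShortTree → List (Set ℝ)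
  | [] => []
  | [k] => List.replicate (k - 1) same ++ [outer]
  | k :: l :: t => List.replicate (k - 1) same ++ inner :: treeSides same inner outer (l :: t)

/-- The closed face of the cube `[0,1]^(n-1)` labelled by a short forest with `n` leaves.  The
`i`-th coordinate is `0`, lies in `[0,1]`, or is `1`, according to whether the leaves `i` and `i+1`
belong to the same branch, to different branches of the same tree, or to different trees. -/
def ShortForest.face (F : ShortForest) (n : ℕ) : Set (Fin (n - 1) → ℝ) :=
  {x | ∀ i : Fin (n - 1),
    x i ∈ (F.trees.flatMap (treeSides {0} (Icc 0 1) {1})).getD i univ}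

/-- `σ × I`, with the new coordinate in the last place. -/
def timesSide {n : ℕ} (σ : Set (Fin n → ℝ)) (I : Set ℝ) : Set (Fin (n + 1) → ℝ) :=
  {x | (fun i : Fin n => x i.castSucc) ∈ σ ∧ x (Fin.last n) ∈ I}

/-- The distinguished hyperface `X_n` of the freehedron: `X_1 = {1}` and `X_(n+1) = X_n × [1/2,1]`
for `n ≥ 1`.  The point has none. -/
def distinguishedFace : (n : ℕ) → Set (Fin n → ℝ)
  | 0 => ∅
  | 1 => {x | x 0 = 1}
  | n + 2 => timesSide (distinguishedFace (n + 1)) (Icc (1 / 2) 1)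

/-- The closed faces of the freehedron `F_n`, as a subdivision of `[0,1]^n`: `F_0` is a point, and
`F_(n+1)` is `F_n × [0,1]` with `X_n × [0,1]` split into `X_n × [0,1/2]` and `X_n × [1/2,1]`. -/
inductive IsFreehedronFace : (n : ℕ) → Set (Fin n → ℝ) → Prop
  | point : IsFreehedronFace 0 univ
  | bottom {n : ℕ} {σ : Set (Fin n → ℝ)} (h : IsFreehedronFace n σ) :
      IsFreehedronFace (n + 1) (timesSide σ {0})
  | top {n : ℕ} {σ : Set (Fin n → ℝ)} (h : IsFreehedronFace n σ) :
      IsFreehedronFace (n + 1) (timesSide σ {1})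
  | side {n : ℕ} {σ : Set (Fin n → ℝ)} (h : IsFreehedronFace n σ)
      (hσ : ¬ σ ⊆ distinguishedFace n) : IsFreehedronFace (n + 1) (timesSide σ (Icc 0 1))
  | lower {n : ℕ} {σ : Set (Fin n → ℝ)} (h : IsFreehedronFace n σ)
      (hσ : σ ⊆ distinguishedFace n) : IsFreehedronFace (n + 1) (timesSide σ (Icc 0 (1 / 2)))
  | middle {n : ℕ} {σ : Set (Fin n → ℝ)} (h : IsFreehedronFace n σ)
      (hσ : σ ⊆ distinguishedFace n) : IsFreehedronFace (n + 1) (timesSide σ {1 / 2})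
  | upper {n : ℕ} {σ : Set (Fin n → ℝ)} (h : IsFreehedronFace n σ)
      (hσ : σ ⊆ distinguishedFace n) : IsFreehedronFace (n + 1) (timesSide σ (Icc (1 / 2) 1))

/-- The sides contributed by the last forest of a triple. -/
noncomputable def lastSides : List ShortTree → List (Set ℝ)
  | [] => []
  | [t] => treeSides {1} (Icc (1 / 2) 1) {1} t
  | t :: s :: G => treeSides {1} (Icc (1 / 2) 1) {1 / 2} t ++ lastSides (s :: G)

open Classical in
/-- The sides of the face labelled by `(F, T, G)`, from the last coordinate to the first. -/
noncomputable def Triple.sides (τ : Triple) : List (Set ℝ) :=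
  τ.fst.trees.flatMap (treeSides {1} (Icc 0 1) {0}) ++
    treeSides {1} (Icc 0 1) (if τ.lst.trees = [] then Icc 0 1 else Icc 0 (1 / 2)) τ.mid ++
    lastSides τ.lst.trees

/-- The closed face of the freehedron `F_n` labelled by a triple with `n` leaves. -/
noncomputable def Triple.face (τ : Triple) (n : ℕ) : Set (Fin n → ℝ) :=
  {x | ∀ i : Fin n, x i.rev ∈ τ.sides.getD i univ}

/-- A cellular homeomorphism from a CW-complex `X` to the cell complex with underlying space
`K ⊆ ℝ^N` whose closed cells are the sets `face i`, of dimensions `dim i`. -/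
structure CellModel (X : Type) [TopologicalSpace X] [CWComplex (univ : Set X)] {ι : Type} {N : ℕ}
    (K : Set (Fin N → ℝ)) (face : ι → Set (Fin N → ℝ)) (dim : ι → ℕ) where
  coord : X → Fin N → ℝ
  isEmbedding : IsEmbedding coord
  range_eq : range coord = K
  label : ι ≃ Σ d, RelCWComplex.cell (univ : Set X) d
  label_dim : ∀ i, (label i).1 = dim i
  image_closedCell : ∀ i, coord '' RelCWComplex.closedCell (label i).1 (label i).2 = face i

/-- The open cell with label `i`. -/
def CellModel.openCell {X : Type} [TopologicalSpace X] [CWComplex (univ : Set X)] {ι : Type} {N : ℕ}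
    {K : Set (Fin N → ℝ)} {face : ι → Set (Fin N → ℝ)} {dim : ι → ℕ} (μ : CellModel X K face dim)
    (i : ι) : Set X :=
  RelCWComplex.openCell (μ.label i).1 (μ.label i).2

/-! ## The operad of cubes and the bimodule of freehedra -/

/-- `a` for algebra, `m` for module. -/
inductive Color
  | a
  | m

/-- The input colours `aⁿ`. -/
def colA (n : ℕ) : List Color := List.replicate n Color.a

/-- The input colours `aⁿ, m`. -/
def colM (n : ℕ) : List Color := colA n ++ [Color.m]

/-- The partial operation `f` (as a ternary relation) restricts to a bijection `A × B → D`. -/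
def BijectiveOnProduct {α β δ : Type} (f : α → β → δ → Prop) (A : Set α) (B : Set β)
    (D : Set δ) : Prop :=
  (∀ x ∈ A, ∀ y ∈ B, ∃ z ∈ D, f x y z) ∧
    ∀ z ∈ D, ∃! p : α × β, p.1 ∈ A ∧ p.2 ∈ B ∧ f p.1 p.2 z

/-- `z` is the composite of `x` with the arguments `as` followed by `y`. -/
def CWSeq.CompMap.Rel {C : Type} {S R T : CWSeq C} (γ : CompMap S R T) {L L' L'' : List C}
    {c c' c'' : C} (as : List R.Op) (x : S.obj L c) (y : R.obj L' c') (z : T.obj L'' c'') : Prop :=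
  ∃ h : Fits (op x) (as ++ [op y]), γ.toFun (op x) (as ++ [op y]) h = op z

/-- Outside of the output colour `m` and the inputs `aⁿ, m`, the sequence has only the one-point
spaces `S(aⁿ; a)` for `n ≥ 1`. -/
structure CWSeq.IsStrictAlgebra (S : CWSeq Color) : Prop where
  nonempty : ∀ n, 1 ≤ n → Nonempty (S.obj (colA n) Color.a)
  subsingleton : ∀ n, 1 ≤ n → Subsingleton (S.obj (colA n) Color.a)
  isEmpty_a : ∀ L, (∀ n, 1 ≤ n → L ≠ colA n) → IsEmpty (S.obj L Color.a)
  isEmpty_m : ∀ L, (∀ n, L ≠ colM n) → IsEmpty (S.obj L Color.m)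

/-- The coordinates of a point of the cube `[0,1]^(n-1)`, followed by a `1` if `n ≥ 1`. -/
def cubeCoords : (n : ℕ) → (Fin (n - 1) → ℝ) → List ℝ
  | 0, _ => []
  | _ + 1, x => List.ofFn x ++ [1]

/-- `P` is the coloured CW-operad of cubes: `P(aⁿ, m; m)` is the cube `[0,1]^(n-1)` (a point for
`n = 0`) with its usual cells, labelled by the short forests with `n` leaves. Composition
is given on labels by leaf multiplication and forest concatenation, and in coordinates by the
corresponding inclusions of faces. -/
structure CubeOperad (P : CWOperad Color) where
  strict : P.toCWSeq.IsStrictAlgebra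
  model : ∀ n, CellModel (P.obj (colM n) Color.m) (Icc 0 1)
    (fun F : {F : ShortForest // F.leaves = n} => F.1.face n) (fun F => F.1.dim)
  comp_label : ∀ (k q N : ℕ) (F : {F : ShortForest // F.leaves = k})
    (F' : {F : ShortForest // F.leaves = q}) (H : {F : ShortForest // F.leaves = N})
    (as : List P.toCWSeq.Op), as.length = k → (∀ x ∈ as, x.output = Color.a) →
    H.1 = (F.1.mult (as.map Op.arity)).concat F'.1 →
    BijectiveOnProduct (P.comp.Rel as) ((model k).openCell F) ((model q).openCell F')
      ((model N).openCell H)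
  comp_coord : ∀ (k q N : ℕ) (x : P.obj (colM k) Color.m) (y : P.obj (colM q) Color.m)
    (z : P.obj (colM N) Color.m) (as : List P.toCWSeq.Op), P.comp.Rel as x y z →
    cubeCoords N ((model N).coord z) =
      (List.zipWith (fun n t => List.replicate (n - 1) 0 ++ [t]) (as.map Op.arity)
        (cubeCoords k ((model k).coord x))).flatten ++ cubeCoords q ((model q).coord y)

/-- The bimodule `M` over the operad of cubes consists of freehedra: `M(aⁿ, m; m)` is the freehedron
`F_n` with its cells labelled by the triples with `n` leaves, and both actions are given on labels
by leaf multiplication (for operations with output colour `a`) and forest concatenation. -/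
structure FreehedralBimodule {P : CWOperad Color} (κ : CubeOperad P) (M : CWBimodule P) where
  strict : M.toCWSeq.IsStrictAlgebra
  model : ∀ n, CellModel (M.obj (colM n) Color.m) (Icc 0 1)
    (fun τ : {τ : Triple // τ.leaves = n} => τ.1.face n) (fun τ => τ.1.dim)
  left_label : ∀ (k q N : ℕ) (F : {F : ShortForest // F.leaves = k})
    (τ : {τ : Triple // τ.leaves = q}) (ρ : {τ : Triple // τ.leaves = N})
    (as : List M.toCWSeq.Op), as.length = k → (∀ x ∈ as, x.output = Color.a) →
    ρ.1 = Triple.concatLeft (F.1.mult (as.map Op.arity)) τ.1 →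
    BijectiveOnProduct (M.left.Rel as) ((κ.model k).openCell F) ((model q).openCell τ)
      ((model N).openCell ρ)
  right_label : ∀ (k q N : ℕ) (τ : {τ : Triple // τ.leaves = k})
    (G : {F : ShortForest // F.leaves = q}) (ρ : {τ : Triple // τ.leaves = N})
    (as : List P.toCWSeq.Op), as.length = k → (∀ x ∈ as, x.output = Color.a) →
    ρ.1 = Triple.concatRight (τ.1.mult (as.map Op.arity)) G.1 →
    BijectiveOnProduct (M.right.Rel as) ((model k).openCell τ) ((κ.model q).openCell G)
      ((model N).openCell ρ)

/-!
All three parts rest on one change of coordinates, after which every structure map becomes the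
same elementary operation on lists of real numbers.

**The operad of words.** The words of length `k` in the multiplicative monoid `ℝ` are the
operations of arity `k` of a non-symmetric operad: in the composite `wordComp x ys` the letter
`x[i]` is replaced by the word `ys[i]` multiplied by `x[i]`. Its unit is the word `1`, and
associativity (`wordComp_assoc`) is that of the multiplication. The cube is the space of the words
`(t₁, …, tₙ₋₁, 1, 1)` for `n ≥ 1` and of the word `1` for `n = 0`, the point of profile `(aⁿ; a)`
is the word `(0, …, 0, 1)`, and the freehedron is a space of words `(v₁, …, vₙ, 1/2)` with `vᵢ ∈
[0,1]` and `vₙ ∈ [1/2,1]`. The last letter is the one of the input `m`; it is `1` for the cubes,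
so that concatenation in the cubes and the left action do not rescale, and `1/2` for the
freehedra, so that the right action shrinks the cube that is appended. Plugging in `(0, …, 0, 1)`
inserts zeros before a letter, which is leaf multiplication. Hence the composition of cubes and
both actions are `wordComp`, and their axioms, continuity and coordinate formula come for free
once the words that arise lie in the right spaces.

**Cells.** In these coordinates the cell of a forest or of a triple is a box that is read off leaf
by leaf (`forestBox`, `Triple.box`): the side is `{0}` if the next leaf is on the same branch; at
the other leaves it is `[0,1]` and `{1}` in the first forest, `[0,1]` and `[1/2,1]` in the middle
tree, and `[0,1/2]` and `{1/2}` in the last forest, according to whether the tree goes on or ends.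
Leaf multiplication and concatenation act on boxes exactly as `wordComp` acts on their points
(`CellData.Comp`), which gives cellularity and the bijections of open cells. The points of the
freehedron in its own coordinates `x` correspond to words by `vᵢ = 1 - x`, except that the last
leaf, which belongs to the coordinate `x₁`, has `vₙ = 1 - x₁ / 2` (`freehedronWord`).

**Induction on the leaves.** A triple is built from the empty one by adding leaves on the left
(`Triple.prepend`, `Triple.prepend_induction`). There are five ways to do this, and the new side
depends only on the way and on the part of the triple that contains its first leaf (`Move.side`,
`Triple.box_prepend`). By this induction, the relatively open boxes are disjoint and cover the
closed ones (`Triple.dim_lt_or_eq_of_mem_interior`, `Triple.exists_mem_interior_box`), which makes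
the boxes the cells of a finite CW-complex (`BoxFamily`). In the coordinates `x` it matches the
inductive definition of the faces of `F_(n+1)`: the faces in the distinguished hyperface are those
of the triples `(∅, 1, G)` with `G ≠ ∅` (`Triple.face_subset_distinguishedFace_iff`). Finally, it
shows that containment of boxes is generated by steps: a sequence of steps for the remaining
leaves is lifted step by step (`Triple.Step.prepend`, `Triple.Step.prepend_inner_newMid`), after
which the side of the first leaf shrinks by at most one more step (`Triple.reflTransGen_prepend`).
-/

/-! ### Boxes and their characteristic maps -/

/-- The number of parameters of a side `[s.1, s.2]` of a box: `0` for a point, `1` otherwise. -/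
noncomputable def sideDim (s : ℝ × ℝ) : ℕ := open Classical in if s.1 = s.2 then 0 else 1

/-- The relative interior of the interval `[s.1, s.2]`. -/
def sideInterior (s : ℝ × ℝ) : Set ℝ := {t | s.1 = s.2 ∧ t = s.1 ∨ s.1 < t ∧ t < s.2}

/-- A box: the product of the intervals `[s.1, s.2]` for the members `s` of a list.  Its points are
lists of real numbers. -/
abbrev Box := List (ℝ × ℝ)

namespace Box

/-- The points of a box. -/
def closed (b : Box) : Set (List ℝ) := {l | List.Forall₂ (fun s t => t ∈ Icc s.1 s.2) b l}

/-- The relative interior of a box. -/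
def interior (b : Box) : Set (List ℝ) := {l | List.Forall₂ (fun s t => t ∈ sideInterior s) b l}

/-- No side of the box is empty. -/
def Proper (b : Box) : Prop := ∀ s ∈ b, s.1 ≤ s.2

/-- The number of nondegenerate sides of a box. -/
noncomputable def dim (b : Box) : ℕ := (b.map sideDim).sum

/-- The affine parametrization of a box by a cube `[-1,1]^d`.  The parameters are read off from
an infinite sequence, of which only the first `dim b` members matter. -/
noncomputable def param : Box → (ℕ → ℝ) → List ℝ
  | [], _ => []
  | s :: b, u => ((s.1 + s.2) / 2 + (s.2 - s.1) / 2 * u 0) :: param b fun k => u (k + sideDim s)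

@[simp] theorem closed_nil (l : List ℝ) : l ∈ closed [] ↔ l = [] := by
  simp [closed]

@[simp] theorem interior_nil (l : List ℝ) : l ∈ interior [] ↔ l = [] := by
  simp [interior]

@[simp] theorem cons_mem_closed (s : ℝ × ℝ) (b : Box) (t : ℝ) (l : List ℝ) :
    t :: l ∈ closed (s :: b) ↔ t ∈ Icc s.1 s.2 ∧ l ∈ closed b := by
  simp [closed]

@[simp] theorem cons_mem_interior (s : ℝ × ℝ) (b : Box) (t : ℝ) (l : List ℝ) :
    t :: l ∈ interior (s :: b) ↔ t ∈ sideInterior s ∧ l ∈ interior b := by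
  simp [interior]

theorem mem_closed_cons {s : ℝ × ℝ} {b : Box} {l : List ℝ} :
    l ∈ closed (s :: b) ↔ ∃ t l', l = t :: l' ∧ t ∈ Icc s.1 s.2 ∧ l' ∈ closed b := by
  simp only [closed, mem_ofPred_eq, List.forall₂_cons_left_iff]
  exact ⟨fun ⟨t, l', h, h', e⟩ => ⟨t, l', e, h, h'⟩, fun ⟨t, l', e, h, h'⟩ => ⟨t, l', h, h', e⟩⟩

theorem mem_interior_cons {s : ℝ × ℝ} {b : Box} {l : List ℝ} :
    l ∈ interior (s :: b) ↔ ∃ t l', l = t :: l' ∧ t ∈ sideInterior s ∧ l' ∈ interior b := by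
  simp only [interior, mem_ofPred_eq, List.forall₂_cons_left_iff]
  exact ⟨fun ⟨t, l', h, h', e⟩ => ⟨t, l', e, h, h'⟩, fun ⟨t, l', e, h, h'⟩ => ⟨t, l', h, h', e⟩⟩

theorem length_eq_of_mem_closed {b : Box} {l : List ℝ} (h : l ∈ b.closed) : l.length = b.length :=
  (List.Forall₂.length_eq h).symm

theorem length_eq_of_mem_interior {b : Box} {l : List ℝ} (h : l ∈ b.interior) :
    l.length = b.length :=
  (List.Forall₂.length_eq h).symm

theorem sideInterior_subset (s : ℝ × ℝ) : sideInterior s ⊆ Icc s.1 s.2 := by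
  rintro t (⟨h, rfl⟩ | ⟨h, h'⟩)
  · exact ⟨le_rfl, h.le⟩
  · exact ⟨h.le, h'.le⟩

theorem interior_subset_closed (b : Box) : b.interior ⊆ b.closed :=
  fun _ h => List.Forall₂.imp (fun _ _ h => sideInterior_subset _ h) h

@[simp] theorem dim_nil : dim [] = 0 := rfl

@[simp] theorem dim_cons (s : ℝ × ℝ) (b : Box) : dim (s :: b) = sideDim s + dim b := by
  simp [dim]

@[simp] theorem dim_append (b b' : Box) : dim (b ++ b') = dim b + dim b' := by
  simp [dim]

theorem append_mem_interior {b b' : Box} {l l' : List ℝ} (h : l ∈ b.interior)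
    (h' : l' ∈ b'.interior) : l ++ l' ∈ interior (b ++ b') :=
  List.rel_append h h'

theorem append_mem_closed {b b' : Box} {l l' : List ℝ} (h : l ∈ b.closed)
    (h' : l' ∈ b'.closed) : l ++ l' ∈ closed (b ++ b') :=
  List.rel_append h h'

theorem mem_interior_append {b b' : Box} {l : List ℝ} (h : l ∈ interior (b ++ b')) :
    ∃ l₁ l₂, l = l₁ ++ l₂ ∧ l₁ ∈ b.interior ∧ l₂ ∈ b'.interior :=
  ⟨l.take b.length, l.drop b.length, (List.take_append_drop _ _).symm,
    List.forall₂_take_append _ _ _ (List.Forall₂.flip h) |>.flip,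
    List.forall₂_drop_append _ _ _ (List.Forall₂.flip h) |>.flip⟩

theorem mem_closed_append {b b' : Box} {l : List ℝ} (h : l ∈ closed (b ++ b')) :
    ∃ l₁ l₂, l = l₁ ++ l₂ ∧ l₁ ∈ b.closed ∧ l₂ ∈ b'.closed :=
  ⟨l.take b.length, l.drop b.length, (List.take_append_drop _ _).symm,
    List.forall₂_take_append _ _ _ (List.Forall₂.flip h) |>.flip,
    List.forall₂_drop_append _ _ _ (List.Forall₂.flip h) |>.flip⟩

theorem sideDim_of_eq {s : ℝ × ℝ} (h : s.1 = s.2) : sideDim s = 0 := if_pos h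

theorem sideDim_of_ne {s : ℝ × ℝ} (h : s.1 ≠ s.2) : sideDim s = 1 := if_neg h

theorem Proper.of_cons {s : ℝ × ℝ} {b : Box} (h : Proper (s :: b)) : s.1 ≤ s.2 ∧ Proper b :=
  ⟨h s (by simp), fun t ht => h t (by simp [ht])⟩

theorem param_congr (b : Box) {u v : ℕ → ℝ} (h : ∀ k < b.dim, u k = v k) :
    param b u = param b v := by
  induction b generalizing u v with
  | nil => rfl
  | cons s b ih =>
    rw [dim_cons] at h
    simp only [param, List.cons.injEq]
    refine ⟨?_, ih fun k hk => h _ (by omega)⟩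
    by_cases hs : s.1 = s.2
    · simp [hs]
    · rw [h 0 (by rw [sideDim_of_ne hs]; omega)]

theorem param_injective (b : Box) {u v : ℕ → ℝ} (h : param b u = param b v) :
    ∀ k < b.dim, u k = v k := by
  induction b generalizing u v with
  | nil => simp
  | cons s b ih =>
    simp only [param, List.cons.injEq] at h
    have h₂ := ih h.2
    intro k hk
    rw [dim_cons] at hk
    by_cases hs : s.1 = s.2
    · rw [sideDim_of_eq hs] at h₂ hk
      exact h₂ k (by omega)
    · rw [sideDim_of_ne hs] at h₂ hk
      cases k with
      | zero =>
        have : (s.2 - s.1) / 2 ≠ 0 := div_ne_zero (sub_ne_zero.2 (Ne.symm hs)) two_ne_zero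
        exact mul_left_cancel₀ this (add_left_cancel h.1)
      | succ k => exact h₂ k (by omega)

theorem param_mem_closed {b : Box} (hb : b.Proper) {u : ℕ → ℝ}
    (h : ∀ k < b.dim, u k ∈ Icc (-1) 1) : param b u ∈ b.closed := by
  induction b generalizing u with
  | nil => simp [param]
  | cons s b ih =>
    rw [dim_cons] at h
    obtain ⟨hs, hb⟩ := hb.of_cons
    simp only [param, cons_mem_closed]
    refine ⟨?_, ih hb fun k hk => h _ (by omega)⟩
    by_cases hs' : s.1 = s.2
    · simp [hs']
    · have := h 0 (by rw [sideDim_of_ne hs']; omega)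
      constructor <;> nlinarith [this.1, this.2]

theorem param_mem_interior {b : Box} (hb : b.Proper) {u : ℕ → ℝ}
    (h : ∀ k < b.dim, u k ∈ Ioo (-1) 1) : param b u ∈ b.interior := by
  induction b generalizing u with
  | nil => simp [param]
  | cons s b ih =>
    rw [dim_cons] at h
    obtain ⟨hs, hb⟩ := hb.of_cons
    simp only [param, cons_mem_interior]
    refine ⟨?_, ih hb fun k hk => h _ (by omega)⟩
    by_cases hs' : s.1 = s.2
    · exact Or.inl ⟨hs', by simp [hs']⟩
    · have := h 0 (by rw [sideDim_of_ne hs']; omega)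
      have hlt := lt_of_le_of_ne hs hs'
      exact Or.inr (by constructor <;> nlinarith [this.1, this.2])

theorem side_eq_param {s : ℝ × ℝ} {t : ℝ} (hs : s.1 ≠ s.2) :
    t = (s.1 + s.2) / 2 + (s.2 - s.1) / 2 * ((2 * t - s.1 - s.2) / (s.2 - s.1)) := by
  have := sub_ne_zero.2 (Ne.symm hs)
  field_simp
  ring

theorem exists_param_of_mem_closed {b : Box} {l : List ℝ} (h : l ∈ b.closed) :
    ∃ u : ℕ → ℝ, (∀ k, u k ∈ Icc (-1) 1) ∧ param b u = l := by
  induction b generalizing l with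
  | nil => exact ⟨0, by simp, by simp_all [param]⟩
  | cons s b ih =>
    obtain ⟨t, l, rfl, ht, hl⟩ := mem_closed_cons.1 h
    obtain ⟨u, hu, rfl⟩ := ih hl
    by_cases hs : s.1 = s.2
    · refine ⟨u, hu, ?_⟩
      simp only [param, sideDim_of_eq hs, add_zero, List.cons.injEq, and_true]
      rw [← hs] at ht ⊢
      simp [le_antisymm ht.2 ht.1]
    · have hlt : 0 < s.2 - s.1 := sub_pos.2 (lt_of_le_of_ne (ht.1.trans ht.2) hs)
      refine ⟨fun k => k.casesOn ((2 * t - s.1 - s.2) / (s.2 - s.1)) u, ?_, ?_⟩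
      · rintro (_ | k)
        · exact ⟨(le_div_iff₀ hlt).2 (by linarith [ht.1]),
            (div_le_iff₀ hlt).2 (by linarith [ht.2])⟩
        · exact hu k
      · simp only [param, sideDim_of_ne hs, List.cons.injEq, and_true]
        exact (side_eq_param hs).symm

theorem exists_param_of_mem_interior {b : Box} {l : List ℝ} (h : l ∈ b.interior) :
    ∃ u : ℕ → ℝ, (∀ k, u k ∈ Ioo (-1) 1) ∧ param b u = l := by
  induction b generalizing l with
  | nil => exact ⟨0, by simp, by simp_all [param]⟩
  | cons s b ih =>
    obtain ⟨t, l, rfl, ht, hl⟩ := mem_interior_cons.1 h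
    obtain ⟨u, hu, rfl⟩ := ih hl
    rcases ht with ⟨hs, rfl⟩ | ht
    · refine ⟨u, hu, ?_⟩
      simp [param, sideDim_of_eq hs, ← hs]
    · have hlt : 0 < s.2 - s.1 := sub_pos.2 (ht.1.trans ht.2)
      have hs := (ht.1.trans ht.2).ne
      refine ⟨fun k => k.casesOn ((2 * t - s.1 - s.2) / (s.2 - s.1)) u, ?_, ?_⟩
      · rintro (_ | k)
        · exact ⟨(lt_div_iff₀ hlt).2 (by linarith [ht.1]),
            (div_lt_iff₀ hlt).2 (by linarith [ht.2])⟩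
        · exact hu k
      · simp only [param, sideDim_of_ne hs, List.cons.injEq, and_true]
        exact (side_eq_param hs).symm

theorem continuous_param_getD (b : Box) (j : ℕ) {Z : Type*} [TopologicalSpace Z] {u : Z → ℕ → ℝ}
    (hu : ∀ k, Continuous fun z => u z k) : Continuous fun z => (param b (u z)).getD j 0 := by
  induction b generalizing u j with
  | nil => simpa [param] using continuous_const
  | cons s b ih =>
    cases j with
    | zero =>
      simp only [param, List.getD_cons_zero]
      have := hu 0
      fun_prop
    | succ j =>
      simp only [param, List.getD_cons_succ]
      exact ih j fun k => hu _

end Box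

/-! ### CW-complexes glued from boxes -/

/-- A finite family of boxes with `N` sides that are the closed cells of a complex: a point of the
box `i` that lies in the relative interior of the box `j` forces `j` to be `i` or of smaller
dimension, and the relative interiors cover all boxes. -/
structure BoxFamily (N : ℕ) where
  ι : Type
  finite : Finite ι
  box : ι → Box
  length_eq : ∀ i, (box i).length = N
  proper : ∀ i, (box i).Proper
  sep : ∀ i j, ∀ l ∈ (box i).closed, l ∈ (box j).interior → (box j).dim < (box i).dim ∨ j = i
  cover : ∀ i, ∀ l ∈ (box i).closed, ∃ j, l ∈ (box j).interior

namespace BoxFamily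

variable {N : ℕ} (B : BoxFamily N)

/-- The union of the boxes of the family. -/
@[ext]
structure Space where
  val : List ℝ
  mem : ∃ i, val ∈ (B.box i).closed

/-- The coordinates of a point, continued by zeros. -/
def coords (x : B.Space) (j : ℕ) : ℝ := x.1.getD j 0

instance : TopologicalSpace B.Space := TopologicalSpace.induced B.coords inferInstance

theorem isInducing_coords : IsInducing B.coords := ⟨rfl⟩

variable {B}

theorem Space.length_eq (x : B.Space) : x.1.length = N := by
  obtain ⟨i, hi⟩ := x.2
  rw [Box.length_eq_of_mem_closed hi, B.length_eq]

variable (B)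

theorem coords_injective : Function.Injective B.coords := by
  intro x y h
  apply Space.ext
  apply List.ext_getElem (by rw [x.length_eq, y.length_eq])
  intro j h₁ h₂
  have := congrFun h j
  rwa [coords, coords, List.getD_eq_getElem _ _ h₁, List.getD_eq_getElem _ _ h₂] at this

instance : T2Space B.Space :=
  T2Space.of_injective_continuous B.coords_injective B.isInducing_coords.continuous

/-- A vector as a sequence, continued by zeros. -/
def extendZero {d : ℕ} (u : Fin d → ℝ) (k : ℕ) : ℝ := if h : k < d then u ⟨k, h⟩ else 0

theorem continuous_extendZero (d k : ℕ) : Continuous fun u : Fin d → ℝ => extendZero u k := by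
  unfold extendZero
  split_ifs <;> fun_prop

theorem mem_closedBall_iff {d : ℕ} {u : Fin d → ℝ} :
    u ∈ Metric.closedBall (0 : Fin d → ℝ) 1 ↔ ∀ k, u k ∈ Icc (-1) 1 := by
  rw [mem_closedBall_zero_iff, pi_norm_le_iff_of_nonneg zero_le_one]
  simp [abs_le]

theorem mem_ball_iff {d : ℕ} {u : Fin d → ℝ} :
    u ∈ Metric.ball (0 : Fin d → ℝ) 1 ↔ ∀ k, u k ∈ Ioo (-1) 1 := by
  rw [mem_ball_zero_iff, pi_norm_lt_iff zero_lt_one]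
  simp [abs_lt]

theorem extendZero_mem {d : ℕ} {s : Set ℝ} {u : Fin d → ℝ} (h : ∀ k, u k ∈ s) :
    ∀ k < d, extendZero u k ∈ s := by
  intro k hk
  simpa [extendZero, hk] using h ⟨k, hk⟩

/-- The clamping of a real number to `[-1,1]`; it makes the parametrization of a box a total map. -/
noncomputable def clamp (t : ℝ) : ℝ := max (-1) (min 1 t)

theorem clamp_mem (t : ℝ) : clamp t ∈ Icc (-1) 1 :=
  ⟨le_max_left _ _, max_le (by norm_num) (min_le_left _ _)⟩

theorem clamp_of_mem {t : ℝ} (h : t ∈ Icc (-1) 1) : clamp t = t := by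
  rw [clamp, min_eq_right h.2, max_eq_right h.1]

theorem continuous_clamp : Continuous clamp := by unfold clamp; fun_prop

/-- The characteristic map of the cell with label `i`. -/
noncomputable def charMap (i : B.ι) (u : Fin (B.box i).dim → ℝ) : B.Space :=
  ⟨(B.box i).param (extendZero fun k => clamp (u k)), i,
    Box.param_mem_closed (B.proper i) (extendZero_mem fun _ => clamp_mem _)⟩

theorem continuous_charMap (i : B.ι) : Continuous (B.charMap i) := by
  rw [B.isInducing_coords.continuous_iff]
  refine continuous_pi fun j => Box.continuous_param_getD (B.box i) j fun k => ?_
  have : Continuous fun u : Fin (B.box i).dim → ℝ => fun k => clamp (u k) :=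
    continuous_pi fun k => continuous_clamp.comp (continuous_apply k)
  exact (continuous_extendZero _ k).comp this

theorem charMap_val {i : B.ι} {u : Fin (B.box i).dim → ℝ} (hu : ∀ k, u k ∈ Icc (-1) 1) :
    (B.charMap i u).1 = (B.box i).param (extendZero u) := by
  simp only [charMap]
  congr 2
  exact funext fun k => clamp_of_mem (hu k)

theorem injOn_charMap (i : B.ι) : InjOn (B.charMap i) (Metric.closedBall 0 1) := by
  intro u hu v hv h
  rw [mem_closedBall_iff] at hu hv
  have h := congrArg Space.val h
  rw [B.charMap_val hu, B.charMap_val hv] at h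
  funext k
  simpa [extendZero] using Box.param_injective _ h k k.2

theorem charMap_mem_interior {i : B.ι} {u : Fin (B.box i).dim → ℝ}
    (hu : u ∈ Metric.ball (0 : Fin (B.box i).dim → ℝ) 1) :
    (B.charMap i u).1 ∈ (B.box i).interior := by
  rw [mem_ball_iff] at hu
  rw [B.charMap_val fun k => Ioo_subset_Icc_self (hu k)]
  exact Box.param_mem_interior (B.proper i) (extendZero_mem hu)

theorem image_charMap_ball (i : B.ι) :
    B.charMap i '' Metric.ball 0 1 = {x | x.1 ∈ (B.box i).interior} := by
  ext x
  constructor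
  · rintro ⟨u, hu, rfl⟩
    exact B.charMap_mem_interior hu
  · intro hx
    obtain ⟨u, hu, h⟩ := Box.exists_param_of_mem_interior hx
    refine ⟨fun k => u k, mem_ball_iff.2 fun k => hu k, Space.ext ?_⟩
    rw [B.charMap_val fun k => Ioo_subset_Icc_self (hu k), ← h]
    exact Box.param_congr _ fun k hk => by simp [extendZero, hk]

theorem image_charMap_closedBall (i : B.ι) :
    B.charMap i '' Metric.closedBall 0 1 = {x | x.1 ∈ (B.box i).closed} := by
  ext x
  constructor
  · rintro ⟨u, hu, rfl⟩
    exact Box.param_mem_closed (B.proper i) (extendZero_mem fun _ => clamp_mem _)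
  · intro hx
    obtain ⟨u, hu, h⟩ := Box.exists_param_of_mem_closed hx
    refine ⟨fun k => u k, mem_closedBall_iff.2 fun k => hu k, Space.ext ?_⟩
    rw [B.charMap_val fun k => hu k, ← h]
    exact Box.param_congr _ fun k hk => by simp [extendZero, hk]

/-- The characteristic map as a partial equivalence defined on the open cube. -/
noncomputable def charEquiv (i : B.ι) : PartialEquiv (Fin (B.box i).dim → ℝ) B.Space :=
  ((B.injOn_charMap i).mono Metric.ball_subset_closedBall).toPartialEquiv _ _

theorem continuousOn_charEquiv_symm (i : B.ι) :
    ContinuousOn (B.charEquiv i).symm (B.charEquiv i).target := by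
  have h := B.injOn_charMap i
  -- on the compact closed cube the characteristic map is an embedding
  have hemb : IsClosedEmbedding ((Metric.closedBall 0 1).domRestrict (B.charMap i)) :=
    ((B.continuous_charMap i).comp continuous_subtype_val).isClosedEmbedding
      (injOn_iff_injective.1 h)
  rw [continuousOn_iff_continuous_domRestrict]
  have hmem : ∀ x : (B.charEquiv i).target,
      (B.charEquiv i).symm x ∈ Metric.closedBall (0 : Fin (B.box i).dim → ℝ) 1 := fun x =>
    Metric.ball_subset_closedBall ((B.charEquiv i).map_target x.2)
  have : Continuous fun x : (B.charEquiv i).target =>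
      (⟨(B.charEquiv i).symm x, hmem x⟩ : Metric.closedBall (0 : Fin (B.box i).dim → ℝ) 1) := by
    rw [hemb.isInducing.continuous_iff]
    have : ((Metric.closedBall 0 1).domRestrict (B.charMap i) ∘ fun x : (B.charEquiv i).target =>
        (⟨(B.charEquiv i).symm x, hmem x⟩ : Metric.closedBall (0 : Fin (B.box i).dim → ℝ) 1)) =
        Subtype.val := funext fun x => (B.charEquiv i).right_inv x.2
    rw [this]
    exact continuous_subtype_val
  exact continuous_subtype_val.comp this

theorem eq_of_mem_interior {i j : B.ι} {l : List ℝ} (hi : l ∈ (B.box i).interior)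
    (hj : l ∈ (B.box j).interior) : i = j := by
  rcases B.sep i j l (Box.interior_subset_closed _ hi) hj with h | h
  · rcases B.sep j i l (Box.interior_subset_closed _ hj) hi with h' | h'
    · omega
    · exact h'
  · exact h.symm

/-- The cells of dimension `d` are the labels of the boxes of dimension `d`. -/
abbrev Cell (d : ℕ) : Type := {i : B.ι // (B.box i).dim = d}

/-- The characteristic map of a cell of dimension `d`, with the parameters indexed by `Fin d`. -/
noncomputable def cellMap : (d : ℕ) → B.Cell d → PartialEquiv (Fin d → ℝ) B.Space
  | _, ⟨i, rfl⟩ => B.charEquiv i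

theorem image_cellMap_ball {d : ℕ} (c : B.Cell d) :
    B.cellMap d c '' Metric.ball 0 1 = {x | x.1 ∈ (B.box c.1).interior} := by
  obtain ⟨i, rfl⟩ := c
  exact B.image_charMap_ball i

theorem image_cellMap_closedBall {d : ℕ} (c : B.Cell d) :
    B.cellMap d c '' Metric.closedBall 0 1 = {x | x.1 ∈ (B.box c.1).closed} := by
  obtain ⟨i, rfl⟩ := c
  exact B.image_charMap_closedBall i

instance : Finite B.ι := B.finite

noncomputable instance : CWComplex (univ : Set B.Space) :=
  CWComplex.mkFinite univ B.Cell B.cellMap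
    (by
      obtain ⟨M, hM⟩ := (finite_range fun i => (B.box i).dim).bddAbove
      filter_upwards [Filter.eventually_gt_atTop M] with d hd
      exact ⟨fun c => (hd.trans_le (c.2.symm.le.trans (hM ⟨c.1, rfl⟩))).false⟩)
    (fun _ => inferInstance)
    (by rintro _ ⟨i, rfl⟩; rfl)
    (by rintro _ ⟨i, rfl⟩; exact (B.continuous_charMap i).continuousOn)
    (by rintro _ ⟨i, rfl⟩; exact B.continuousOn_charEquiv_symm i)
    (by
      rintro ⟨d, c⟩ - ⟨e, c'⟩ - hne
      rw [Function.onFun, image_cellMap_ball, image_cellMap_ball, disjoint_left]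
      intro x hx hx'
      apply hne
      obtain ⟨i, rfl⟩ := c
      obtain ⟨j, rfl⟩ := c'
      obtain rfl := B.eq_of_mem_interior hx hx'
      rfl)
    (by
      rintro _ ⟨i, rfl⟩ u hu
      have hc := Metric.sphere_subset_closedBall hu
      have hx : (B.charMap i u).1 ∈ (B.box i).closed :=
        (B.image_charMap_closedBall i).subset ⟨u, hc, rfl⟩
      obtain ⟨j, hj⟩ := B.cover i _ hx
      simp only [mem_iUnion]
      refine ⟨(B.box j).dim, (B.sep i j _ hx hj).resolve_right ?_, ⟨j, rfl⟩, ?_⟩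
      · rintro rfl
        obtain ⟨v, hv, h⟩ := (B.image_charMap_ball j).superset hj
        have := B.injOn_charMap j (Metric.ball_subset_closedBall hv) hc h
        rw [this] at hv
        exact Metric.sphere_disjoint_ball.le_bot ⟨hu, hv⟩
      · rw [image_cellMap_closedBall]
        exact Box.interior_subset_closed _ hj)
    (by
      refine eq_univ_of_forall fun x => ?_
      obtain ⟨i, hi⟩ := x.2
      simp only [mem_iUnion]
      exact ⟨_, ⟨i, rfl⟩, (B.image_cellMap_closedBall ⟨i, rfl⟩).superset hi⟩)

theorem openCell_eq {d : ℕ} (c : B.Cell d) :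
    RelCWComplex.openCell (C := (univ : Set B.Space)) d c = {x | x.1 ∈ (B.box c.1).interior} :=
  B.image_cellMap_ball c

theorem closedCell_eq {d : ℕ} (c : B.Cell d) :
    RelCWComplex.closedCell (C := (univ : Set B.Space)) d c = {x | x.1 ∈ (B.box c.1).closed} :=
  B.image_cellMap_closedBall c

/-- The labels of all cells. -/
noncomputable def labelEquiv : B.ι ≃ Σ d, RelCWComplex.cell (univ : Set B.Space) d :=
  (Equiv.sigmaFiberEquiv fun i => (B.box i).dim).symm

instance : RelCWComplex.Finite (univ : Set B.Space) :=
  RelCWComplex.finite_of_finite_cells (Finite.of_equiv _ B.labelEquiv)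

theorem mem_skeleton_iff {x : B.Space} {d : ℕ} :
    x ∈ (RelCWComplex.skeleton (univ : Set B.Space) (d : ℕ∞) : Set B.Space) ↔
      ∃ i, x.1 ∈ (B.box i).interior ∧ (B.box i).dim ≤ d := by
  refine CWComplex.mem_skeleton_iff.trans ?_
  constructor
  · rintro ⟨m, hm, ⟨i, rfl⟩, h⟩
    rw [openCell_eq] at h
    exact ⟨i, h, by exact_mod_cast hm⟩
  · rintro ⟨i, h, hd⟩
    exact ⟨_, by exact_mod_cast hd, ⟨i, rfl⟩, (B.openCell_eq ⟨i, rfl⟩).superset h⟩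

theorem exists_mem_interior (x : B.Space) : ∃ i, x.1 ∈ (B.box i).interior := by
  obtain ⟨i, hi⟩ := x.2
  exact B.cover i _ hi

instance : CompactSpace B.Space := by
  refine ⟨?_⟩
  have : (univ : Set B.Space) = ⋃ i, B.charMap i '' Metric.closedBall 0 1 := by
    refine (eq_univ_of_forall fun x => ?_).symm
    obtain ⟨i, hi⟩ := x.2
    exact mem_iUnion.2 ⟨i, (B.image_charMap_closedBall i).superset hi⟩
  rw [this]
  exact isCompact_iUnion fun i => (isCompact_closedBall _ _).image (B.continuous_charMap i)

end BoxFamily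

/-! ### Composition of words of real numbers -/

/-- The composite of the word `x` with the words `ys`: the `i`-th letter of `x` is replaced by its
product with the word `ys[i]`.  This is the composition of the non-symmetric operad whose
operations of arity `k` are the words of length `k` in the multiplicative monoid `ℝ`. -/
def wordComp (x : List ℝ) (ys : List (List ℝ)) : List ℝ :=
  (List.zipWith (fun t y => y.map (t * ·)) x ys).flatten

@[simp] theorem wordComp_nil_left (ys : List (List ℝ)) : wordComp [] ys = [] := by
  simp [wordComp]

@[simp] theorem wordComp_nil_right (x : List ℝ) : wordComp x [] = [] := by
  simp [wordComp]

@[simp] theorem wordComp_cons (t : ℝ) (x y : List ℝ) (ys : List (List ℝ)) :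
    wordComp (t :: x) (y :: ys) = y.map (t * ·) ++ wordComp x ys := by
  simp [wordComp]

theorem wordComp_append {x x' : List ℝ} {ys ys' : List (List ℝ)} (h : x.length = ys.length) :
    wordComp (x ++ x') (ys ++ ys') = wordComp x ys ++ wordComp x' ys' := by
  simp [wordComp, List.zipWith_append h]

theorem wordComp_map_mul (t : ℝ) (x : List ℝ) (ys : List (List ℝ)) :
    wordComp (x.map (t * ·)) ys = (wordComp x ys).map (t * ·) := by
  induction x generalizing ys with
  | nil => simp
  | cons s x ih =>
    cases ys with
    | nil => simp
    | cons y ys => simp [ih, mul_assoc]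

theorem wordComp_singleton_one (x : List ℝ) : wordComp [1] [x] = x := by
  simp

theorem wordComp_map_const_one {α : Type*} (x : List ℝ) (L : List α) (h : x.length = L.length) :
    wordComp x (L.map fun _ => [1]) = x := by
  induction x generalizing L with
  | nil => simp
  | cons t x ih =>
    cases L with
    | nil => simp at h
    | cons c L =>
      rw [List.map_cons, wordComp_cons, ih L (by simpa using h)]
      simp

theorem wordComp_assoc {α : Type*} (x : List ℝ) (l : List α) (head : α → List ℝ)
    (args : α → List (List ℝ)) (hx : x.length = l.length)
    (hl : ∀ a ∈ l, (head a).length = (args a).length) :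
    wordComp (wordComp x (l.map head)) (l.flatMap args) =
      wordComp x (l.map fun a => wordComp (head a) (args a)) := by
  induction l generalizing x with
  | nil => simp
  | cons a l ih =>
    cases x with
    | nil => simp
    | cons t x =>
      rw [List.map_cons, wordComp_cons, List.flatMap_cons, List.map_cons, wordComp_cons,
        wordComp_append (by simpa using hl a (by simp)), wordComp_map_mul,
        ih x (by simpa using hx) fun b hb => hl b (by simp [hb])]

/-- A family of lists of real numbers depends continuously on the parameter near `z`: the length is
locally constant, and the members vary continuously. -/
def ListContinuousAt {Z : Type*} [TopologicalSpace Z] (f : Z → List ℝ) (z : Z) : Prop :=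
  (∀ᶠ w in 𝓝 z, (f w).length = (f z).length) ∧ ∀ j, ContinuousAt (fun w => (f w).getD j 0) z

namespace ListContinuousAt

variable {Z : Type*} [TopologicalSpace Z] {f g : Z → List ℝ} {z : Z}

theorem congr (hf : ListContinuousAt f z) (h : f =ᶠ[𝓝 z] g) : ListContinuousAt g z := by
  refine ⟨?_, fun j => (hf.2 j).congr ?_⟩
  · filter_upwards [hf.1, h] with w h₁ h₂
    rw [← h₂, h₁, h.eq_of_nhds]
  · filter_upwards [h] with w hw
    rw [hw]

theorem const (l : List ℝ) : ListContinuousAt (fun _ : Z => l) z :=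
  ⟨Filter.Eventually.of_forall fun _ => rfl, fun _ => continuousAt_const⟩

theorem tail (hf : ListContinuousAt f z) : ListContinuousAt (fun w => (f w).tail) z := by
  refine ⟨?_, fun j => ?_⟩
  · filter_upwards [hf.1] with w hw
    simp [hw]
  · have := hf.2 (j + 1)
    simpa [List.getD_eq_getElem?_getD] using this

theorem append (hf : ListContinuousAt f z) (hg : ListContinuousAt g z) :
    ListContinuousAt (fun w => f w ++ g w) z := by
  refine ⟨?_, fun j => ?_⟩
  · filter_upwards [hf.1, hg.1] with w h₁ h₂
    simp [h₁, h₂]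
  · rcases lt_or_ge j (f z).length with hj | hj
    · refine (hf.2 j).congr ?_
      filter_upwards [hf.1] with w hw
      rw [List.getD_append _ _ _ _ (hw ▸ hj)]
    · refine (hg.2 (j - (f z).length)).congr ?_
      filter_upwards [hf.1] with w hw
      rw [List.getD_append_right _ _ _ _ (hw ▸ hj), hw]

theorem map_mul {c : Z → ℝ} (hc : ContinuousAt c z) (hf : ListContinuousAt f z) :
    ListContinuousAt (fun w => (f w).map (c w * ·)) z := by
  refine ⟨?_, fun j => ?_⟩
  · filter_upwards [hf.1] with w hw
    simp [hw]
  · refine (hc.mul (hf.2 j)).congr (Filter.Eventually.of_forall fun w => ?_)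
    have := List.getD_map (l := f w) (n := j) (d := 0) (c w * ·)
    simp only [mul_zero] at this
    exact this.symm

theorem wordComp {k : ℕ} {g : Z → Fin k → List ℝ} (hf : ListContinuousAt f z)
    (hk : (f z).length = k) (hg : ∀ i, ListContinuousAt (fun w => g w i) z) :
    ListContinuousAt (fun w => wordComp (f w) (List.ofFn (g w))) z := by
  induction k generalizing f with
  | zero => simpa using const []
  | succ k ih =>
    refine (((hg 0).map_mul (hf.2 0)).append
      (ih hf.tail (by simp [hk]) fun i => hg i.succ)).congr ?_
    filter_upwards [hf.1] with w hw
    cases hfw : f w with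
    | nil => simp [hfw, hk] at hw
    | cons t x => simp [List.ofFn_succ]

end ListContinuousAt

/-! ### Structure maps given by composition of words -/

section BoxSeq

variable {C : Type}

/-- The coloured sequence of the complexes that are glued from given families of boxes. -/
noncomputable abbrev boxSeq (B : ∀ (L : List C) (_ : C), BoxFamily L.length) : CWSeq C where
  obj L c := (B L c).Space

variable {S R T : ∀ (L : List C) (_ : C), BoxFamily L.length}

/-- The coordinates of an operation. -/
def opWord (x : (boxSeq S).Op) : List ℝ := x.2.val

theorem opWord_length (x : (boxSeq S).Op) : (opWord x).length = x.inputs.length :=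
  BoxFamily.Space.length_eq x.2

theorem op_ext {x y : (boxSeq S).Op} (h₁ : x.inputs = y.inputs) (h₂ : x.output = y.output)
    (h₃ : opWord x = opWord y) : x = y := by
  obtain ⟨⟨L, c⟩, x⟩ := x
  obtain ⟨⟨L', c'⟩, y⟩ := y
  obtain rfl : L = L' := h₁
  obtain rfl : c = c' := h₂
  obtain rfl : x = y := BoxFamily.Space.ext h₃
  rfl

/-- The operation `x` lies in an open cell of dimension at most `d`. -/
def HasRank (x : (boxSeq S).Op) (d : ℕ) : Prop :=
  ∃ i, opWord x ∈ ((S x.inputs x.output).box i).interior ∧ ((S x.inputs x.output).box i).dim ≤ d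

theorem exists_hasRank (x : (boxSeq S).Op) : ∃ d, HasRank x d := by
  obtain ⟨i, hi⟩ := BoxFamily.exists_mem_interior _ x.2
  exact ⟨_, i, hi, le_rfl⟩

theorem exists_hasRank_list (ys : List (boxSeq S).Op) : ∃ ds, List.Forall₂ HasRank ys ds := by
  induction ys with
  | nil => exact ⟨[], .nil⟩
  | cons y ys ih =>
    obtain ⟨d, hd⟩ := exists_hasRank y
    obtain ⟨ds, hds⟩ := ih
    exact ⟨d :: ds, .cons hd hds⟩

theorem mem_skel_iff {x : (boxSeq S).Op} {d : ℕ} : x ∈ (boxSeq S).skel d ↔ HasRank x d :=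
  BoxFamily.mem_skeleton_iff _

theorem eventually_fst_eq (x : (boxSeq S).Op) : ∀ᶠ y in 𝓝 x, y.1 = x.1 := by
  have : range (Sigma.mk x.1 : _ → (boxSeq S).Op) ∈ 𝓝 x :=
    isOpen_range_sigmaMk.mem_nhds ⟨x.2, rfl⟩
  filter_upwards [this]
  rintro _ ⟨y, rfl⟩
  rfl

/-- The coordinates of an operation depend continuously on the operation. -/
theorem listContinuousAt_opWord (x : (boxSeq S).Op) : ListContinuousAt opWord x := by
  refine ⟨?_, fun j => ?_⟩
  · filter_upwards [eventually_fst_eq x] with y hy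
    rw [opWord_length, opWord_length, Op.inputs, Op.inputs, hy]
  · refine Continuous.continuousAt ?_
    rw [continuous_sigma_iff]
    exact fun i => (continuous_apply j).comp (BoxFamily.isInducing_coords _).continuous

/-- A map into the space of operations is continuous if the profile is locally constant and the
coordinates are continuous. -/
theorem continuous_of_opWord {Z : Type*} [TopologicalSpace Z] {f : Z → (boxSeq T).Op}
    (h₁ : ∀ z, ∀ᶠ w in 𝓝 z, (f w).1 = (f z).1)
    (h₂ : ∀ z, ListContinuousAt (fun w => opWord (f w)) z) : Continuous f := by
  rw [continuous_iff_continuousAt]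
  intro z
  obtain ⟨U, hU, hUo, hz⟩ := eventually_nhds_iff.1 (h₁ z)
  refine ContinuousOn.continuousAt ?_ (hUo.mem_nhds hz)
  rw [continuousOn_iff_continuous_domRestrict]
  let g : U → (boxSeq T).obj (f z).1.1 (f z).1.2 := fun w =>
    ⟨opWord (f w), hU w w.2 ▸ (f w).2.mem⟩
  have hg : Continuous g := by
    refine (BoxFamily.isInducing_coords _).continuous_iff.2 (continuous_pi fun j => ?_)
    exact continuous_iff_continuousAt.2 fun w =>
      ContinuousAt.comp (f := Subtype.val) (g := fun w => (opWord (f w)).getD j 0)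
        ((h₂ w).2 j) continuous_subtype_val.continuousAt
  have : U.domRestrict f = Sigma.mk (f z).1 ∘ g := by
    funext w
    exact op_ext (congrArg Prod.fst (hU w w.2)) (congrArg Prod.snd (hU w w.2)) rfl
  rw [this]
  exact continuous_sigmaMk.comp hg

/-- The composites of words in open cells of `S` and `R` lie in open cells of `T` whose
dimension is at most the sum of the dimensions. -/
def WordClosed (S R T : ∀ (L : List C) (_ : C), BoxFamily L.length) : Prop :=
  ∀ (x : (boxSeq S).Op) (ys : List (boxSeq R).Op), Fits x ys → ∀ (d : ℕ) (ds : List ℕ),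
    HasRank x d → List.Forall₂ HasRank ys ds →
    ∃ k, wordComp (opWord x) (ys.map opWord) ∈
        ((T (ys.flatMap Op.inputs) x.output).box k).interior ∧
      ((T (ys.flatMap Op.inputs) x.output).box k).dim ≤ d + ds.sum

theorem Fits.length_eq {S R : CWSeq C} {x : S.Op} {ys : List R.Op} (h : Fits x ys) :
    ys.length = x.inputs.length := by
  rw [← h, List.length_map]

/-- The operation whose coordinates are the composite of the coordinates of `x` and `ys`. -/
noncomputable def wordOp (H : WordClosed S R T) (x : (boxSeq S).Op) (ys : List (boxSeq R).Op)
    (h : Fits x ys) : (boxSeq T).Op :=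
  ⟨(ys.flatMap Op.inputs, x.output), wordComp (opWord x) (ys.map opWord), by
    obtain ⟨d, hd⟩ := exists_hasRank x
    obtain ⟨ds, hds⟩ := exists_hasRank_list ys
    obtain ⟨k, hk, -⟩ := H x ys h d ds hd hds
    exact ⟨k, Box.interior_subset_closed _ hk⟩⟩

/-- The structure map given by composition of words. -/
noncomputable def wordMap (H : WordClosed S R T) : CompMap (boxSeq S) (boxSeq R) (boxSeq T) where
  toFun := wordOp H
  inputs_eq _ _ _ := rfl
  output_eq _ _ _ := rfl
  continuous k := by
    have hhead : Continuous fun p : {p : (boxSeq S).Op × (Fin k → (boxSeq R).Op) //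
        Fits p.1 (List.ofFn p.2)} => p.1.1 := continuous_fst.comp continuous_subtype_val
    have hargs : ∀ i, Continuous fun p : {p : (boxSeq S).Op × (Fin k → (boxSeq R).Op) //
        Fits p.1 (List.ofFn p.2)} => p.1.2 i := fun i =>
      (continuous_apply i).comp (continuous_snd.comp continuous_subtype_val)
    refine continuous_of_opWord (fun p => ?_) fun p => ?_
    · filter_upwards [hhead.continuousAt.eventually (eventually_fst_eq _),
        Filter.eventually_all.2 fun i =>
          (hargs i).continuousAt.eventually (eventually_fst_eq (p.1.2 i))] with q h₁ h₂
      have h₃ : (List.ofFn q.1.2).map Sigma.fst = (List.ofFn p.1.2).map Sigma.fst := by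
        rw [List.map_ofFn, List.map_ofFn]
        exact congrArg List.ofFn (funext h₂)
      have h₄ := congrArg (List.flatMap Prod.fst) h₃
      rw [List.flatMap_map, List.flatMap_map] at h₄
      exact Prod.ext h₄ (show q.1.1.1.2 = p.1.1.1.2 by rw [h₁])
    · have hx : ListContinuousAt (fun q : {p : (boxSeq S).Op × (Fin k → (boxSeq R).Op) //
          Fits p.1 (List.ofFn p.2)} => opWord q.1.1) p :=
        ⟨hhead.continuousAt.eventually (listContinuousAt_opWord _).1, fun j =>
          ContinuousAt.comp (f := fun q : {p : (boxSeq S).Op × (Fin k → (boxSeq R).Op) //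
            Fits p.1 (List.ofFn p.2)} => q.1.1)
            ((listContinuousAt_opWord p.1.1).2 j) hhead.continuousAt⟩
      have hy : ∀ i, ListContinuousAt (fun q : {p : (boxSeq S).Op × (Fin k → (boxSeq R).Op) //
          Fits p.1 (List.ofFn p.2)} => opWord (q.1.2 i)) p := fun i =>
        ⟨(hargs i).continuousAt.eventually (listContinuousAt_opWord _).1, fun j =>
          ContinuousAt.comp (f := fun q : {p : (boxSeq S).Op × (Fin k → (boxSeq R).Op) //
            Fits p.1 (List.ofFn p.2)} => q.1.2 i)
            ((listContinuousAt_opWord (p.1.2 i)).2 j) (hargs i).continuousAt⟩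
      refine (hx.wordComp ?_ hy).congr (Filter.Eventually.of_forall fun q => ?_)
      · rw [opWord_length, ← Fits.length_eq p.2, List.length_ofFn]
      · change _ = wordComp _ _
        rw [List.map_ofFn]
        rfl
  cellular x ys h d ds hx hys := by
    rw [mem_skel_iff] at hx ⊢
    simp only [mem_skel_iff] at hys
    exact H x ys h d ds hx hys

@[simp] theorem opWord_wordMap (H : WordClosed S R T) (x : (boxSeq S).Op)
    (ys : List (boxSeq R).Op) (h : Fits x ys) :
    opWord ((wordMap H).toFun x ys h) = wordComp (opWord x) (ys.map opWord) := rfl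

/-- Word composition is associative, whichever structure maps it represents. -/
theorem wordMap_assoc {A B D AB BD E : ∀ (L : List C) (_ : C), BoxFamily L.length}
    (H₁ : WordClosed A B AB) (H₂ : WordClosed AB D E) (H₃ : WordClosed B D BD)
    (H₄ : WordClosed A BD E) (x : (boxSeq A).Op) (l : List (Composite (boxSeq B) (boxSeq D)))
    (h₁ : Fits x (l.map Composite.head))
    (h₂ : Fits ((wordMap H₁).toFun x (l.map Composite.head) h₁) (l.flatMap Composite.args))
    (h₃ : Fits x (l.map (wordMap H₃).app)) :
    (wordMap H₂).toFun ((wordMap H₁).toFun x (l.map Composite.head) h₁)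
        (l.flatMap Composite.args) h₂ =
      (wordMap H₄).toFun x (l.map (wordMap H₃).app) h₃ := by
  refine op_ext ?_ rfl ?_
  · rw [CompMap.inputs_eq, CompMap.inputs_eq, List.flatMap_assoc, List.flatMap_map]
    rfl
  · rw [opWord_wordMap, opWord_wordMap, opWord_wordMap, List.map_map, List.map_flatMap,
      List.map_map]
    refine wordComp_assoc _ _ _ _ ?_ fun t _ => ?_
    · rw [opWord_length, ← Fits.length_eq h₁, List.length_map]
    · rw [Function.comp_apply, opWord_length, ← Fits.length_eq t.fits, List.length_map]

end BoxSeq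

/-! ### Words of trees, forests and triples -/

namespace ShortTree

/-- One letter for each leaf of a tree: `s` if the next leaf is on the same branch, `i` if it is on
another branch of the tree, and `o` if there is no next leaf in the tree. -/
def word {α : Type*} (s i o : α) : ShortTree → List α
  | [] => []
  | [k] => List.replicate (k - 1) s ++ [o]
  | k :: l :: t => List.replicate (k - 1) s ++ i :: word s i o (l :: t)

@[simp] theorem word_nil {α : Type*} (s i o : α) : word s i o [] = [] := rfl

@[simp] theorem leaves_nil : leaves [] = 0 := rfl

@[simp] theorem leaves_cons (k : ℕ+) (t : ShortTree) : leaves (k :: t) = k + leaves t := by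
  simp [leaves]

theorem treeSides_eq_word (s i o : Set ℝ) (t : ShortTree) : treeSides s i o t = word s i o t := by
  induction t with
  | nil => rfl
  | cons k t ih =>
    cases t with
    | nil => rfl
    | cons l t => simp [treeSides, word, ih]

theorem map_word {α β : Type*} (f : α → β) (s i o : α) (t : ShortTree) :
    (word s i o t).map f = word (f s) (f i) (f o) t := by
  induction t with
  | nil => rfl
  | cons k t ih =>
    cases t with
    | nil => simp [word]
    | cons l t => simp [word, ih]

theorem length_word {α : Type*} (s i o : α) (t : ShortTree) : (word s i o t).length = t.leaves := by
  induction t with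
  | nil => rfl
  | cons k t ih =>
    have hk := k.pos
    cases t with
    | nil => simp [word]; omega
    | cons l t =>
      rw [leaves_cons, ← ih]
      simp only [word, List.length_append, List.length_replicate, List.length_cons]
      omega

theorem word_append {α : Type*} (s i o : α) (u : ShortTree) {v : ShortTree} (hv : v ≠ []) :
    word s i o (u ++ v) = word s i i u ++ word s i o v := by
  induction u with
  | nil => rfl
  | cons k u ih =>
    cases u with
    | nil =>
      cases v with
      | nil => exact absurd rfl hv
      | cons l v => simp [word]
    | cons l u =>
      rw [List.cons_append] at ih
      simp [word, ih]

/-- The tree with one more leaf on the first branch. -/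
def inc : ShortTree → ShortTree
  | [] => []
  | k :: t => (k + 1) :: t

/-- The tree with a new first branch that carries one leaf. -/
def grow (t : ShortTree) : ShortTree := 1 :: t

theorem inc_ne_nil {t : ShortTree} (h : t ≠ []) : inc t ≠ [] := by
  cases t with
  | nil => exact h
  | cons k t => simp [inc]

theorem grow_ne_nil (t : ShortTree) : grow t ≠ [] := by simp [grow]

theorem word_inc {α : Type*} (s i o : α) {t : ShortTree} (h : t ≠ []) :
    word s i o (inc t) = s :: word s i o t := by
  obtain ⟨k, t, rfl⟩ := List.exists_cons_of_ne_nil h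
  have : ((k + 1 : ℕ+) : ℕ) - 1 = (k - 1 : ℕ) + 1 := by
    have := k.pos
    rw [PNat.add_coe, PNat.one_coe]
    omega
  cases t <;> simp only [inc, word, List.replicate_succ, this, List.cons_append]

theorem word_grow {α : Type*} (s i o : α) {t : ShortTree} (h : t ≠ []) :
    word s i o (grow t) = i :: word s i o t := by
  obtain ⟨k, t, rfl⟩ := List.exists_cons_of_ne_nil h
  simp [grow, word]

@[simp] theorem word_one {α : Type*} (s i o : α) : word s i o [1] = [o] := by
  simp [word]

theorem leaves_pos {t : ShortTree} (h : t ≠ []) : 0 < leaves t := by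
  obtain ⟨k, t, rfl⟩ := List.exists_cons_of_ne_nil h
  have := k.pos
  rw [leaves_cons]
  omega

@[simp] theorem length_inc (t : ShortTree) : (inc t).length = t.length := by
  cases t <;> simp [inc]

/-- A nontrivial tree is a single leaf, or arises by adding a leaf on the left to a smaller tree. -/
theorem exists_eq_inc_or_grow {t : ShortTree} (h : t ≠ []) :
    t = [1] ∨ (∃ u, u ≠ [] ∧ t = inc u) ∨ ∃ u, u ≠ [] ∧ t = grow u := by
  obtain ⟨k, t, rfl⟩ := List.exists_cons_of_ne_nil h
  by_cases hk : k = 1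
  · subst hk
    cases t with
    | nil => exact Or.inl rfl
    | cons l t => exact Or.inr (Or.inr ⟨l :: t, by simp, rfl⟩)
  · obtain ⟨j, rfl⟩ := PNat.exists_eq_succ_of_ne_one hk
    exact Or.inr (Or.inl ⟨j :: t, by simp, rfl⟩)

end ShortTree

/-- The box of a list of trees with sides `0` at a leaf that is followed by a leaf on the same
branch, `[0,c]` at other leaves that are not the last ones of a tree, and `c` at the last ones. -/
noncomputable def forestBox (c : ℝ) (F : List ShortTree) : Box :=
  F.flatMap (ShortTree.word (0, 0) (0, c) (c, c))

@[simp] theorem forestBox_nil (c : ℝ) : forestBox c [] = [] := rfl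

@[simp] theorem forestBox_cons (c : ℝ) (t : ShortTree) (F : List ShortTree) :
    forestBox c (t :: F) = t.word (0, 0) (0, c) (c, c) ++ forestBox c F := by
  simp [forestBox]

theorem forestBox_append (c : ℝ) (F G : List ShortTree) :
    forestBox c (F ++ G) = forestBox c F ++ forestBox c G := by
  simp [forestBox]

theorem length_forestBox (c : ℝ) (F : List ShortTree) :
    (forestBox c F).length = (F.map ShortTree.leaves).sum := by
  simp [forestBox, List.length_flatMap, ShortTree.length_word]

namespace Triple

/-- The box of a triple, without the side that belongs to the input of colour `m`.  The last forest
is scaled by `1 / 2`, the letter of that input. -/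
noncomputable def box (τ : Triple) : Box :=
  forestBox 1 τ.fst.trees ++ (τ.mid.word (0, 0) (0, 1) (1 / 2, 1) ++ forestBox (1 / 2) τ.lst.trees)

theorem length_box (τ : Triple) : τ.box.length = τ.leaves := by
  simp [box, leaves, length_forestBox, ShortTree.length_word, ShortForest.leaves, add_assoc]

/-- The possible positions of the first leaf of a triple: nowhere, in the last forest, in the middle
tree, or in the first forest. -/
inductive Zone
  | none | last | mid | first

/-- The part of a triple that contains its first leaf; `none` if there is no leaf. -/
def zone : Triple → Zone
  | ⟨⟨_ :: _, _⟩, _, _⟩ => .first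
  | ⟨⟨[], _⟩, _ :: _, _⟩ => .mid
  | ⟨⟨[], _⟩, [], ⟨_ :: _, _⟩⟩ => .last
  | ⟨⟨[], _⟩, [], ⟨[], _⟩⟩ => .none

/-- The ways to add a leaf on the left of a triple: as a new tree of the first forest, as the middle
tree, as a new tree of the last forest, on the first branch, or as a new branch of the first
tree. -/
inductive Move
  | newFirst | newMid | newLast | same | inner

/-- Which moves are possible, depending on the position of the first leaf.  The middle tree or a new
tree of the last forest can be added only if the parts to the left of it are empty. -/
def Move.Legal : Move → Zone → Prop
  | .newFirst, _ => True
  | .newMid, z => z = .none ∨ z = .last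
  | .newLast, z => z = .none ∨ z = .last
  | .same, z => z ≠ .none
  | .inner, z => z ≠ .none

/-- The position of the new leaf. -/
def Move.zone : Move → Zone → Zone
  | .newFirst, _ => .first
  | .newMid, _ => .mid
  | .newLast, _ => .last
  | .same, z => z
  | .inner, z => z

/-- The side of the box that belongs to the new leaf. -/
noncomputable def Move.side : Move → Zone → ℝ × ℝ
  | .newFirst, _ => (1, 1)
  | .newMid, _ => (1 / 2, 1)
  | .newLast, _ => (1 / 2, 1 / 2)
  | .same, _ => (0, 0)
  | .inner, .last => (0, 1 / 2)
  | .inner, _ => (0, 1)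

theorem cons_ne_nil {t : ShortTree} {F : List ShortTree} (ht : t ≠ []) (hF : ∀ s ∈ F, s ≠ []) :
    ∀ s ∈ t :: F, s ≠ [] := by
  rintro s (_ | ⟨_, hs⟩)
  · exact ht
  · exact hF s hs

/-- Change the tree that contains the first leaf. -/
def modify (f : ShortTree → ShortTree) (hf : ∀ t, t ≠ [] → f t ≠ []) : Triple → Triple
  | ⟨⟨t :: F, h⟩, T, G⟩ => ⟨⟨f t :: F, cons_ne_nil (hf t (h t (by simp)))
      fun s hs => h s (by simp [hs])⟩, T, G⟩
  | ⟨⟨[], h⟩, k :: T, G⟩ => ⟨⟨[], h⟩, f (k :: T), G⟩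
  | ⟨⟨[], h⟩, [], ⟨t :: G, h'⟩⟩ => ⟨⟨[], h⟩, [], ⟨f t :: G, cons_ne_nil (hf t (h' t (by simp)))
      fun s hs => h' s (by simp [hs])⟩⟩
  | ⟨⟨[], h⟩, [], ⟨[], h'⟩⟩ => ⟨⟨[], h⟩, [], ⟨[], h'⟩⟩

/-- Add a leaf on the left of a triple. -/
def prepend : Move → Triple → Triple
  | .newFirst, τ => ⟨⟨[1] :: τ.fst.trees, cons_ne_nil (by simp) τ.fst.ne_nil⟩, τ.mid, τ.lst⟩
  | .newMid, τ => ⟨τ.fst, [1], τ.lst⟩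
  | .newLast, τ => ⟨τ.fst, τ.mid, ⟨[1] :: τ.lst.trees, cons_ne_nil (by simp) τ.lst.ne_nil⟩⟩
  | .same, τ => τ.modify ShortTree.inc fun _ => ShortTree.inc_ne_nil
  | .inner, τ => τ.modify ShortTree.grow fun t _ => ShortTree.grow_ne_nil t

theorem zone_modify (f : ShortTree → ShortTree) (hf : ∀ t, t ≠ [] → f t ≠ []) (τ : Triple) :
    (τ.modify f hf).zone = τ.zone := by
  obtain ⟨⟨_ | ⟨t, F⟩, hF⟩, _ | ⟨k, T⟩, ⟨_ | ⟨s, G⟩, hG⟩⟩ := τ <;> try rfl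
  all_goals
    obtain ⟨l, T', h⟩ := List.exists_cons_of_ne_nil (hf (k :: T) (by simp))
    simp [modify, h, zone]

theorem zone_prepend {e : Move} {τ : Triple} (h : e.Legal τ.zone) :
    (prepend e τ).zone = e.zone τ.zone := by
  cases e
  case newFirst => rfl
  case same => exact zone_modify _ (fun _ => ShortTree.inc_ne_nil) τ
  case inner => exact zone_modify _ (fun t _ => ShortTree.grow_ne_nil t) τ
  all_goals
    obtain ⟨⟨_ | ⟨t, F⟩, hF⟩, _ | ⟨k, T⟩, ⟨_ | ⟨s, G⟩, hG⟩⟩ := τ <;>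
      simp_all [zone, Move.Legal, prepend, Move.zone]

theorem box_prepend {e : Move} {τ : Triple} (h : e.Legal τ.zone) :
    (prepend e τ).box = e.side τ.zone :: τ.box := by
  obtain ⟨⟨_ | ⟨t, F⟩, hF⟩, _ | ⟨k, T⟩, ⟨_ | ⟨s, G⟩, hG⟩⟩ := τ <;> cases e <;>
    simp_all [zone, Move.Legal, prepend, Move.side, box, modify, ShortTree.word_inc,
      ShortTree.word_grow]

theorem leaves_prepend {e : Move} {τ : Triple} (h : e.Legal τ.zone) :
    (prepend e τ).leaves = τ.leaves + 1 := by
  rw [← length_box, ← length_box, box_prepend h, List.length_cons]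

theorem dim_prepend {e : Move} {τ : Triple} (h : e.Legal τ.zone) :
    (prepend e τ).dim = sideDim (e.side τ.zone) + τ.dim := by
  have h₂ : (2 : ℝ)⁻¹ ≠ 1 := by norm_num
  have key : ∀ t : ShortTree, t ≠ [] → 0 < t.length := fun t => List.length_pos_of_ne_nil
  obtain ⟨⟨_ | ⟨t, F⟩, hF⟩, _ | ⟨k, T⟩, ⟨_ | ⟨s, G⟩, hG⟩⟩ := τ <;> cases e <;>
    simp_all [zone, Move.Legal, prepend, Move.side, dim, ShortForest.dim, modify, sideDim,
      ShortTree.grow]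
  all_goals
    try have ht := key t (hF t (by simp))
    try have hs := key s (hG s (by simp))
    omega

theorem zone_eq_none_iff {τ : Triple} : τ.zone = .none ↔ τ.leaves = 0 := by
  have key : ∀ t : ShortTree, t ≠ [] → t.leaves ≠ 0 := fun t ht => (ShortTree.leaves_pos ht).ne'
  obtain ⟨⟨_ | ⟨t, F⟩, hF⟩, _ | ⟨k, T⟩, ⟨_ | ⟨s, G⟩, hG⟩⟩ := τ <;>
    simp_all [zone, leaves, ShortForest.leaves, ShortTree.leaves]

theorem eq_of_leaves_eq_zero {τ : Triple} (h : τ.leaves = 0) :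
    τ = ⟨⟨[], by simp⟩, [], ⟨[], by simp⟩⟩ := by
  rw [← zone_eq_none_iff] at h
  obtain ⟨⟨_ | ⟨t, F⟩, hF⟩, _ | ⟨k, T⟩, ⟨_ | ⟨s, G⟩, hG⟩⟩ := τ <;> simp_all [zone]

theorem exists_prepend {τ : Triple} (h : τ.leaves ≠ 0) :
    ∃ (e : Move) (ρ : Triple), e.Legal ρ.zone ∧ prepend e ρ = τ := by
  obtain ⟨⟨_ | ⟨t, F⟩, hF⟩, T, G⟩ := τ
  · by_cases hT : T = []
    · subst hT
      obtain ⟨_ | ⟨t, G⟩, hG⟩ := G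
      · exact absurd rfl h
      · have hG' : ∀ s ∈ G, s ≠ [] := fun s hs => hG s (by simp [hs])
        rcases ShortTree.exists_eq_inc_or_grow (hG t (by simp)) with
          rfl | ⟨u, hu, rfl⟩ | ⟨u, hu, rfl⟩
        · refine ⟨.newLast, ⟨⟨[], hF⟩, [], ⟨G, hG'⟩⟩, ?_, rfl⟩
          cases G <;> simp [zone, Move.Legal]
        · exact ⟨.same, ⟨⟨[], hF⟩, [], ⟨u :: G, cons_ne_nil hu hG'⟩⟩, by simp [zone, Move.Legal],
            rfl⟩
        · exact ⟨.inner, ⟨⟨[], hF⟩, [], ⟨u :: G, cons_ne_nil hu hG'⟩⟩, by simp [zone, Move.Legal],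
            rfl⟩
    · rcases ShortTree.exists_eq_inc_or_grow hT with rfl | ⟨u, hu, rfl⟩ | ⟨u, hu, rfl⟩
      · refine ⟨.newMid, ⟨⟨[], hF⟩, [], G⟩, ?_, rfl⟩
        obtain ⟨_ | ⟨t, G⟩, hG⟩ := G <;> simp [zone, Move.Legal]
      · obtain ⟨k, u, rfl⟩ := List.exists_cons_of_ne_nil hu
        exact ⟨.same, ⟨⟨[], hF⟩, k :: u, G⟩, by simp [zone, Move.Legal], rfl⟩
      · obtain ⟨k, u, rfl⟩ := List.exists_cons_of_ne_nil hu
        exact ⟨.inner, ⟨⟨[], hF⟩, k :: u, G⟩, by simp [zone, Move.Legal], rfl⟩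
  · have hF' : ∀ s ∈ F, s ≠ [] := fun s hs => hF s (by simp [hs])
    rcases ShortTree.exists_eq_inc_or_grow (hF t (by simp)) with rfl | ⟨u, hu, rfl⟩ | ⟨u, hu, rfl⟩
    · exact ⟨.newFirst, ⟨⟨F, hF'⟩, T, G⟩, trivial, rfl⟩
    · exact ⟨.same, ⟨⟨u :: F, cons_ne_nil hu hF'⟩, T, G⟩, by simp [zone, Move.Legal], rfl⟩
    · exact ⟨.inner, ⟨⟨u :: F, cons_ne_nil hu hF'⟩, T, G⟩, by simp [zone, Move.Legal], rfl⟩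

/-- Every triple arises from the empty one by adding leaves on the left. -/
theorem prepend_induction {motive : Triple → Prop}
    (zero : ∀ τ : Triple, τ.leaves = 0 → motive τ)
    (prepend : ∀ (e : Move) (τ : Triple), e.Legal τ.zone → motive τ → motive (prepend e τ))
    (τ : Triple) : motive τ := by
  induction h : τ.leaves generalizing τ with
  | zero => exact zero τ h
  | succ n ih =>
    obtain ⟨e, ρ, he, rfl⟩ := exists_prepend (τ := τ) (by omega)
    rw [leaves_prepend he] at h
    exact prepend e ρ he (ih ρ (by omega))

theorem dim_box (τ : Triple) : τ.box.dim = τ.dim := by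
  induction τ using prepend_induction with
  | zero τ h => rw [eq_of_leaves_eq_zero h]; rfl
  | prepend e τ he ih => rw [box_prepend he, Box.dim_cons, ih, dim_prepend he]

theorem finite_leaves_eq (n : ℕ) : {τ : Triple | τ.leaves = n}.Finite := by
  induction n with
  | zero =>
    exact (finite_singleton _).subset fun τ h => eq_of_leaves_eq_zero h
  | succ n ih =>
    have : {τ : Triple | τ.leaves = n + 1} ⊆
        prepend .newFirst '' {τ | τ.leaves = n} ∪ prepend .newMid '' {τ | τ.leaves = n} ∪
        prepend .newLast '' {τ | τ.leaves = n} ∪ prepend .same '' {τ | τ.leaves = n} ∪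
        prepend .inner '' {τ | τ.leaves = n} := by
      intro τ (h : τ.leaves = n + 1)
      obtain ⟨e, ρ, he, rfl⟩ := exists_prepend (τ := τ) (by omega)
      rw [leaves_prepend he] at h
      have hρ : ρ ∈ {τ : Triple | τ.leaves = n} := by simpa using h
      have := mem_image_of_mem (prepend e) hρ
      cases e <;> simp only [mem_union, this, true_or, or_true]
    exact (((((ih.image _).union (ih.image _)).union (ih.image _)).union (ih.image _)).union
      (ih.image _)).subset this

end Triple

/-! ### The open cells of the freehedra -/

namespace Triple

/-- All leaves of the triple are in the first forest. -/
def OnlyFirst (τ : Triple) : Prop := τ.mid = [] ∧ τ.lst.trees = []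

theorem onlyFirst_prepend {e : Move} {τ : Triple} (h : e.Legal τ.zone) :
    (prepend e τ).OnlyFirst ↔ τ.OnlyFirst ∧ (e = .newFirst ∨ τ.zone = .first) := by
  obtain ⟨⟨_ | ⟨t, F⟩, hF⟩, _ | ⟨k, T⟩, ⟨_ | ⟨s, G⟩, hG⟩⟩ := τ <;> cases e <;>
    simp_all [zone, Move.Legal, prepend, OnlyFirst, modify, ShortTree.inc, ShortTree.grow]

/-- Comparison of a closed side with a relatively open one, for a leaf that is added to a cell
and to a cell in its closure. -/
theorem Move.side_sep {e e' : Move} {z z' : Zone} (h : e.Legal z) (h' : e'.Legal z')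
    (hn : z = .none ↔ z' = .none) (hl : z = .last → z' = .last) {t : ℝ}
    (ht : t ∈ Icc (e.side z).1 (e.side z).2) (ht' : t ∈ sideInterior (e'.side z')) :
    (sideDim (e'.side z') < sideDim (e.side z) ∨
      sideDim (e'.side z') = sideDim (e.side z) ∧ (z = z' → e' = e)) ∧
    (e.zone z = .last → e'.zone z' = .last) ∧ (e = .newFirst → e' = .newFirst) := by
  have h₀ : (2 : ℝ)⁻¹ ≠ 1 := by norm_num
  obtain ⟨h₁, h₂⟩ := ht
  cases e <;> cases z <;> simp only [Move.Legal, reduceCtorEq, or_self, or_true, true_or, ne_eq,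
    not_true_eq_false, not_false_eq_true] at h <;>
  cases z' <;> simp only [reduceCtorEq, iff_true, iff_false, iff_self, not_true_eq_false,
    true_implies, false_implies] at hn hl <;>
  cases e' <;> simp only [Move.Legal, reduceCtorEq, or_self, or_true, true_or, ne_eq,
    not_true_eq_false, not_false_eq_true] at h' <;>
  simp only [Move.side, sideInterior, mem_ofPred_eq] at h₁ h₂ ht' <;>
  first
  | (exfalso; rcases ht' with ⟨ha, hb⟩ | ⟨ha, hb⟩ <;> linarith)
  | simp [sideDim, Move.side, Move.zone, h₀]

/-- If the closed cell of `τ` meets the open cell of `ρ`, then `ρ` is `τ` or has smaller dimension.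
That the position `last` is inherited keeps the induction on the leaves going; that `OnlyFirst` is
inherited makes the triples `(F, 1, ∅)` label subcomplexes, which are the cubes. -/
theorem dim_lt_or_eq_of_mem_interior (τ ρ : Triple) (p : List ℝ)
    (hτ : p ∈ τ.box.closed) (hρ : p ∈ ρ.box.interior) :
    (ρ.dim < τ.dim ∨ ρ = τ) ∧ (τ.zone = .last → ρ.zone = .last) ∧
      (τ.OnlyFirst → ρ.OnlyFirst) := by
  have hlen : ∀ (τ ρ : Triple) (p : List ℝ), p ∈ τ.box.closed → p ∈ ρ.box.interior →
      τ.leaves = ρ.leaves := fun τ ρ p hτ hρ => by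
    rw [← length_box, ← length_box, ← Box.length_eq_of_mem_closed hτ,
      ← Box.length_eq_of_mem_interior hρ]
  induction τ using prepend_induction generalizing ρ p with
  | zero τ h =>
    have hτρ := hlen _ _ _ hτ hρ
    rw [eq_of_leaves_eq_zero h, eq_of_leaves_eq_zero (τ := ρ) (by omega)]
    simp
  | prepend e τ he ih =>
    have h := hlen _ _ _ hτ hρ
    rw [leaves_prepend he] at h
    obtain ⟨e', ρ, he', rfl⟩ := exists_prepend (τ := ρ) (by omega)
    rw [box_prepend he, Box.mem_closed_cons] at hτ
    obtain ⟨t, p, rfl, ht, hp⟩ := hτ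
    rw [box_prepend he', Box.cons_mem_interior] at hρ
    obtain ⟨ih₁, ih₂, ih₃⟩ := ih ρ p hp hρ.2
    have hn : τ.zone = .none ↔ ρ.zone = .none := by
      rw [zone_eq_none_iff, zone_eq_none_iff, hlen _ _ _ hp hρ.2]
    obtain ⟨h₁, h₂, h₃⟩ := Move.side_sep he he' hn ih₂ ht hρ.1
    rw [dim_prepend he, dim_prepend he', zone_prepend he, zone_prepend he', onlyFirst_prepend he,
      onlyFirst_prepend he']
    refine ⟨?_, h₂, fun ⟨h₄, h₅⟩ => ⟨ih₃ h₄, ?_⟩⟩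
    · rcases ih₁ with ih₁ | rfl
      · left; omega
      · rcases h₁ with h₁ | ⟨h₁, h₄⟩
        · left; omega
        · right; rw [h₄ rfl]
    · rcases h₅ with h₅ | h₅
      · exact Or.inl (h₃ h₅)
      · obtain ⟨h₆, h₇⟩ := ih₃ h₄
        have : ρ.zone ≠ .none := fun h => by simp [hn.2 h] at h₅
        refine Or.inr ?_
        obtain ⟨⟨_ | ⟨t, F⟩, hF⟩, T, ⟨G, hG⟩⟩ := ρ
        · obtain rfl : T = [] := h₆
          obtain rfl : G = [] := h₇
          exact absurd rfl this
        · rfl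

/-- A point of a closed side lies in a relatively open side of a new leaf, also after the cell of
the other leaves has been replaced by one in its closure. -/
theorem exists_move {z z' : Zone} (hn : z = .none ↔ z' = .none) (hl : z = .last → z' = .last)
    {e : Move} (h : e.Legal z) {t : ℝ} (ht : t ∈ Icc (e.side z).1 (e.side z).2) :
    ∃ e' : Move, e'.Legal z' ∧ t ∈ sideInterior (e'.side z') := by
  have h₀ : 0 ≤ t := by
    refine le_trans ?_ ht.1
    cases e <;> cases z <;> simp [Move.side]
  have h₁ : t ≤ 1 := by
    refine ht.2.trans ?_
    cases e <;> cases z <;> norm_num [Move.side]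
  rcases h₁.eq_or_lt with rfl | h₁
  · exact ⟨.newFirst, trivial, Or.inl ⟨rfl, rfl⟩⟩
  by_cases hz : z' = .none ∨ z' = .last
  · rcases lt_trichotomy t (1 / 2) with h₂ | rfl | h₂
    · have hz' : z' ≠ .none := by
        rintro rfl
        obtain rfl := hn.2 rfl
        have := ht.1
        cases e <;> simp [Move.Legal, Move.side] at h this <;> linarith
      obtain rfl := hz.resolve_left hz'
      rcases h₀.eq_or_lt with rfl | h₀
      · exact ⟨.same, by simp [Move.Legal], Or.inl ⟨rfl, rfl⟩⟩
      · exact ⟨.inner, by simp [Move.Legal], Or.inr ⟨h₀, h₂⟩⟩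
    · exact ⟨.newLast, hz, Or.inl ⟨rfl, rfl⟩⟩
    · exact ⟨.newMid, hz, Or.inr ⟨h₂, h₁⟩⟩
  · push Not at hz
    rcases h₀.eq_or_lt with rfl | h₀
    · exact ⟨.same, hz.1, Or.inl ⟨rfl, rfl⟩⟩
    · refine ⟨.inner, hz.1, Or.inr ?_⟩
      cases z' <;> first | exact ⟨h₀, h₁⟩ | simp at hz

/-- The open cells of the freehedron cover its closed cells. -/
theorem exists_mem_interior_box (τ : Triple) (p : List ℝ) (hτ : p ∈ τ.box.closed) :
    ∃ ρ : Triple, p ∈ ρ.box.interior := by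
  induction τ using prepend_induction generalizing p with
  | zero τ h =>
    rw [eq_of_leaves_eq_zero h] at hτ
    exact ⟨⟨⟨[], by simp⟩, [], ⟨[], by simp⟩⟩, by simpa [box] using hτ⟩
  | prepend e τ he ih =>
    rw [box_prepend he, Box.mem_closed_cons] at hτ
    obtain ⟨t, p, rfl, ht, hp⟩ := hτ
    obtain ⟨ρ, hρ⟩ := ih p hp
    have hn : τ.zone = .none ↔ ρ.zone = .none := by
      rw [zone_eq_none_iff, zone_eq_none_iff, ← length_box, ← length_box,
        ← Box.length_eq_of_mem_closed hp, ← Box.length_eq_of_mem_interior hρ]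
    obtain ⟨e', he', ht'⟩ := exists_move hn (dim_lt_or_eq_of_mem_interior _ _ _ hp hρ).2.1 he ht
    exact ⟨prepend e' ρ, by rw [box_prepend he', Box.cons_mem_interior]; exact ⟨ht', hρ⟩⟩

theorem proper_box (τ : Triple) : τ.box.Proper := by
  induction τ using prepend_induction with
  | zero τ h => rw [eq_of_leaves_eq_zero h]; simp [box, Box.Proper]
  | prepend e τ he ih =>
    rw [box_prepend he]
    rintro s (_ | ⟨_, hs⟩)
    · cases e <;> cases τ.zone <;> norm_num [Move.side]
    · exact ih s hs

end Triple

/-! ### Leaf multiplication of words and boxes -/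

/-- Leaf multiplication: `ns[i] - 1` copies of `z` are inserted before the `i`-th letter. -/
def dilate {α : Type*} (z : α) (ns : List ℕ) (x : List α) : List α :=
  (List.zipWith (fun n t => List.replicate (n - 1) z ++ [t]) ns x).flatten

/-- The coordinates `(0, …, 0, 1)` of the operation of profile `(aⁿ; a)`. -/
def block (n : ℕ) : List ℝ := List.replicate (n - 1) 0 ++ [1]

section dilate

variable {α : Type*} (z : α)

@[simp] theorem dilate_nil_left (x : List α) : dilate z [] x = [] := by simp [dilate]

@[simp] theorem dilate_nil_right (ns : List ℕ) : dilate z ns [] = [] := by simp [dilate]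

@[simp] theorem dilate_cons (n : ℕ) (ns : List ℕ) (t : α) (x : List α) :
    dilate z (n :: ns) (t :: x) = List.replicate (n - 1) z ++ t :: dilate z ns x := by
  simp [dilate]

theorem dilate_append (ns : List ℕ) (x x' : List α) :
    dilate z ns (x ++ x') = dilate z ns x ++ dilate z (ns.drop x.length) x' := by
  induction x generalizing ns with
  | nil => simp
  | cons t x ih =>
    cases ns with
    | nil => simp
    | cons n ns => simp [ih ns]

theorem dilate_take (ns : List ℕ) (x : List α) :
    dilate z (ns.take x.length) x = dilate z ns x := by
  induction x generalizing ns with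
  | nil => simp
  | cons t x ih =>
    cases ns with
    | nil => simp
    | cons n ns => simp [ih ns]

theorem dilate_replicate_append (t : α) {m : ℕ} {ns : List ℕ} (hns : ∀ n ∈ ns, 1 ≤ n)
    (hm : ns.length = m + 1) :
    dilate z ns (List.replicate m z ++ [t]) = List.replicate (ns.sum - 1) z ++ [t] := by
  induction m generalizing ns with
  | zero =>
    obtain ⟨n, rfl⟩ := List.length_eq_one_iff.1 hm
    simp
  | succ m ih =>
    obtain ⟨n, ns, rfl⟩ := List.exists_cons_of_length_eq_add_one hm
    have hns' : ∀ k ∈ ns, 1 ≤ k := fun k hk => hns k (by simp [hk])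
    have hn := hns n (by simp)
    have hm' : ns.length = m + 1 := by simpa using hm
    have hs : 1 ≤ ns.sum := by
      obtain ⟨k, ns, rfl⟩ := List.exists_cons_of_length_eq_add_one hm'
      have := hns' k (by simp)
      simp only [List.sum_cons]
      omega
    rw [List.replicate_succ, List.cons_append, dilate_cons, ih hns' hm', List.sum_cons,
      show n + ns.sum - 1 = (n - 1) + ((ns.sum - 1) + 1) by omega, List.replicate_add,
      List.replicate_succ]
    simp

theorem length_dilate {ns : List ℕ} {x : List α} (h : ns.length = x.length)
    (hns : ∀ n ∈ ns, 1 ≤ n) : (dilate z ns x).length = ns.sum := by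
  induction x generalizing ns with
  | nil => simp_all
  | cons t x ih =>
    cases ns with
    | nil => simp at h
    | cons n ns =>
      have h₁ := ih (ns := ns) (by simpa using h) fun m hm => hns m (by simp [hm])
      have h₂ := hns n (by simp)
      simp only [dilate_cons, List.length_append, List.length_replicate, List.length_cons, h₁,
        List.sum_cons]
      omega

theorem dilate_injective {ns : List ℕ} {x x' : List α} (h : ns.length = x.length)
    (h' : ns.length = x'.length) (he : dilate z ns x = dilate z ns x') : x = x' := by
  induction ns generalizing x x' with
  | nil => rw [List.length_eq_zero_iff.1 h.symm, List.length_eq_zero_iff.1 h'.symm]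
  | cons n ns ih =>
    obtain ⟨t, x, rfl⟩ := List.exists_cons_of_length_eq_add_one h.symm
    obtain ⟨t', x', rfl⟩ := List.exists_cons_of_length_eq_add_one h'.symm
    simp only [dilate_cons, List.append_cancel_left_eq, List.cons.injEq] at he
    rw [he.1, ih (by simpa using h) (by simpa using h') he.2]

end dilate

theorem wordComp_map_block (ns : List ℕ) (x : List ℝ) :
    wordComp x (ns.map block) = dilate 0 ns x := by
  induction x generalizing ns with
  | nil => simp
  | cons t x ih =>
    cases ns with
    | nil => simp
    | cons n ns => simp [ih, block]

/-- The composite of `x₁ … x_k c` with operations of profiles `(aⁿⁱ; a)` and `y`. -/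
theorem wordComp_block_append (ns : List ℕ) (x y : List ℝ) (c : ℝ) (h : ns.length = x.length) :
    wordComp (x ++ [c]) (ns.map block ++ [y]) = dilate 0 ns x ++ y.map (c * ·) := by
  rw [wordComp_append (by simp [h]), wordComp_map_block]
  simp

namespace Box

/-- The box multiplied by a scalar. -/
def scale (c : ℝ) (b : Box) : Box := b.map fun s => (c * s.1, c * s.2)

theorem sideInterior_self (t : ℝ) : sideInterior (t, t) = {t} := by
  ext u
  simp only [sideInterior, mem_ofPred_eq, true_and, mem_singleton_iff]
  exact ⟨fun h => h.elim id fun h => absurd (h.1.trans h.2) (lt_irrefl _), Or.inl⟩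

theorem sideDim_self (t : ℝ) : sideDim (t, t) = 0 := sideDim_of_eq rfl

theorem mul_mem_sideInterior {c : ℝ} (hc : 0 < c) (s : ℝ × ℝ) (t : ℝ) :
    c * t ∈ sideInterior (c * s.1, c * s.2) ↔ t ∈ sideInterior s := by
  simp [sideInterior, mul_right_inj' hc.ne', mul_lt_mul_iff_right₀ hc, -mul_eq_mul_left_iff]

theorem map_mul_mem_interior_scale {c : ℝ} (hc : 0 < c) {b : Box} {l : List ℝ}
    (h : l ∈ b.interior) : l.map (c * ·) ∈ interior (scale c b) := by
  simp only [interior, scale, mem_ofPred_eq, List.forall₂_map_left_iff, List.forall₂_map_right_iff]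
  exact List.Forall₂.imp (fun s t ht => (mul_mem_sideInterior hc s t).2 ht) h

theorem exists_of_mem_interior_scale {c : ℝ} (hc : 0 < c) {b : Box} {l : List ℝ}
    (h : l ∈ interior (scale c b)) : ∃ l' ∈ b.interior, l = l'.map (c * ·) := by
  have hl : l = (l.map (c⁻¹ * ·)).map (c * ·) := by
    simp [List.map_map, Function.comp_def, mul_inv_cancel_left₀ hc.ne']
  refine ⟨l.map (c⁻¹ * ·), ?_, hl⟩
  rw [hl] at h
  simp only [interior, scale, mem_ofPred_eq, List.forall₂_map_left_iff,
    List.forall₂_map_right_iff] at h ⊢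
  exact List.Forall₂.imp (fun s t ht => (mul_mem_sideInterior hc s _).1 ht) h

theorem dim_scale {c : ℝ} (hc : c ≠ 0) (b : Box) : (scale c b).dim = b.dim := by
  rw [scale, dim, List.map_map, dim]
  congr 2
  funext s
  simp [sideDim, mul_right_inj' hc, -mul_eq_mul_left_iff]

theorem mem_interior_concat {b : Box} {c : ℝ} {l : List ℝ} :
    l ∈ interior (b ++ [(c, c)]) ↔ ∃ l' ∈ b.interior, l = l' ++ [c] := by
  constructor
  · intro h
    obtain ⟨l₁, l₂, rfl, h₁, h₂⟩ := mem_interior_append h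
    obtain ⟨t, l₃, rfl, ht, h₃⟩ := mem_interior_cons.1 h₂
    rw [sideInterior_self] at ht
    obtain rfl : t = c := ht
    rw [interior_nil] at h₃
    exact ⟨l₁, h₁, by rw [h₃]⟩
  · rintro ⟨l', h, rfl⟩
    exact append_mem_interior h (by simp [sideInterior_self])

theorem mem_closed_concat {b : Box} {c : ℝ} {l : List ℝ} :
    l ∈ closed (b ++ [(c, c)]) ↔ ∃ l' ∈ b.closed, l = l' ++ [c] := by
  constructor
  · intro h
    obtain ⟨l₁, l₂, rfl, h₁, h₂⟩ := mem_closed_append h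
    obtain ⟨t, l₃, rfl, ht, h₃⟩ := mem_closed_cons.1 h₂
    obtain rfl : t = c := le_antisymm ht.2 ht.1
    rw [closed_nil] at h₃
    exact ⟨l₁, h₁, by rw [h₃]⟩
  · rintro ⟨l', h, rfl⟩
    exact append_mem_closed h (by simp)

theorem dim_concat (b : Box) (c : ℝ) : dim (b ++ [(c, c)]) = b.dim := by
  simp [sideDim_self]

theorem mem_interior_replicate (t : ℝ) (n : ℕ) (l : List ℝ) :
    l ∈ interior (List.replicate n (t, t)) ↔ l = List.replicate n t := by
  induction n generalizing l with
  | zero => simp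
  | succ n ih =>
    rw [List.replicate_succ, mem_interior_cons, List.replicate_succ]
    simp only [sideInterior_self, ih, mem_singleton_iff]
    exact ⟨fun ⟨_, _, h, h₁, h₂⟩ => by rw [h, h₁, h₂], fun h => ⟨_, _, h, rfl, rfl⟩⟩

theorem mem_interior_dilate {b : Box} {ns : List ℕ} (h : ns.length = b.length) {l : List ℝ} :
    l ∈ interior (dilate (0, 0) ns b) ↔ ∃ x ∈ b.interior, l = dilate 0 ns x := by
  induction b generalizing ns l with
  | nil => simp
  | cons s b ih =>
    obtain ⟨n, ns, rfl⟩ := List.exists_cons_of_length_eq_add_one h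
    rw [dilate_cons]
    constructor
    · intro hl
      obtain ⟨l₁, l₂, rfl, h₁, h₂⟩ := mem_interior_append hl
      rw [mem_interior_replicate] at h₁
      obtain ⟨t, l₃, rfl, ht, h₃⟩ := mem_interior_cons.1 h₂
      obtain ⟨x, hx, rfl⟩ := (ih (by simpa using h)).1 h₃
      exact ⟨t :: x, by simp [ht, hx], by simp [h₁]⟩
    · rintro ⟨_, hx, rfl⟩
      obtain ⟨t, x, rfl, ht, hx⟩ := mem_interior_cons.1 hx
      rw [dilate_cons]
      refine append_mem_interior ((mem_interior_replicate _ _ _).2 rfl) ?_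
      rw [cons_mem_interior]
      exact ⟨ht, (ih (by simpa using h)).2 ⟨x, hx, rfl⟩⟩

theorem dim_dilate {b : Box} {ns : List ℕ} (h : ns.length = b.length) :
    dim (dilate (0, 0) ns b) = b.dim := by
  induction b generalizing ns with
  | nil => simp
  | cons s b ih =>
    obtain ⟨n, ns, rfl⟩ := List.exists_cons_of_length_eq_add_one h
    have : dim (List.replicate (n - 1) ((0 : ℝ), (0 : ℝ))) = 0 := by simp [dim, sideDim_self]
    rw [dilate_cons, dim_append, dim_cons, dim_cons, ih (by simpa using h), this, zero_add]

end Box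

/-! ### Coloured sequences with one-point spaces of algebra operations -/

theorem colA_injective : Function.Injective colA := List.replicate_left_injective Color.a

theorem colM_injective : Function.Injective colM := fun _ _ h =>
  colA_injective (List.append_cancel_right h)

theorem colA_add (m n : ℕ) : colA (m + n) = colA m ++ colA n := by
  simp [colA, List.replicate_append_replicate]

theorem block_mem_closed {n : ℕ} {l : List ℝ} :
    l ∈ Box.closed (List.replicate (n - 1) (0, 0) ++ [(1, 1)]) ↔ l = block n := by
  have h : ∀ (m : ℕ) (l : List ℝ), l ∈ Box.closed (List.replicate m (0, 0)) ↔
      l = List.replicate m 0 := by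
    intro m
    induction m with
    | zero => simp
    | succ m ih =>
      intro l
      rw [List.replicate_succ, Box.mem_closed_cons, List.replicate_succ]
      simp only [ih, Icc_self, mem_singleton_iff]
      exact ⟨fun ⟨_, _, h, h₁, h₂⟩ => by rw [h, h₁, h₂], fun h => ⟨_, _, h, rfl, rfl⟩⟩
  rw [Box.mem_closed_concat]
  simp [h, block]

theorem block_mem_interior {n : ℕ} {l : List ℝ} :
    l ∈ Box.interior (List.replicate (n - 1) (0, 0) ++ [(1, 1)]) ↔ l = block n := by
  rw [Box.mem_interior_concat]
  simp [Box.mem_interior_replicate, block]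

theorem dim_block (n : ℕ) : Box.dim (List.replicate (n - 1) (0, 0) ++ [(1, 1)]) = 0 := by
  rw [Box.dim_concat]
  simp [Box.dim, Box.sideDim_self]

/-- One point for the profiles `(aⁿ; a)` with `n ≥ 1`, and nothing for other lists of inputs. -/
noncomputable def algebraFamily (L : List Color) : BoxFamily L.length where
  ι := {n : ℕ // 1 ≤ n ∧ L = colA n}
  finite := Finite.of_injective (fun _ => ()) fun n m _ =>
    Subtype.ext (colA_injective (n.2.2.symm.trans m.2.2))
  box n := List.replicate (n.1 - 1) (0, 0) ++ [(1, 1)]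
  length_eq := by
    rintro ⟨n, hn, rfl⟩
    simp [colA, Nat.sub_add_cancel hn]
  proper n := by
    intro s hs
    rcases List.mem_append.1 hs with hs | hs
    · rw [List.eq_of_mem_replicate hs]
    · rw [List.mem_singleton.1 hs]
  sep n m _ _ _ := Or.inr (Subtype.ext (colA_injective (m.2.2.symm.trans n.2.2)))
  cover n l h := ⟨n, block_mem_interior.2 (block_mem_closed.1 h)⟩

/-- Data for the cells of the spaces of operations of profiles `(aⁿ, m; m)`: every label `i` has a
number of leaves `n` and a box with `n` sides, and the input of colour `m` has the constant
coordinate `slot`. -/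
structure CellData where
  Label : Type
  leaves : Label → ℕ
  core : Label → Box
  slot : ℝ
  slot_pos : 0 < slot
  finite : ∀ n, {i | leaves i = n}.Finite
  length_core : ∀ i, (core i).length = leaves i
  proper : ∀ i, (core i).Proper
  sep : ∀ i j, ∀ l ∈ (core i).closed, l ∈ (core j).interior → (core j).dim < (core i).dim ∨ j = i
  cover : ∀ i, ∀ l ∈ (core i).closed, ∃ j, l ∈ (core j).interior

namespace CellData

variable (D : CellData)

theorem leaves_eq_of_mem {D : CellData} {i j : D.Label} {l : List ℝ} (hi : l ∈ (D.core i).closed)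
    (hj : l ∈ (D.core j).interior) : D.leaves i = D.leaves j := by
  rw [← D.length_core, ← D.length_core, ← Box.length_eq_of_mem_closed hi,
    ← Box.length_eq_of_mem_interior hj]

/-- The boxes of the profile `(aⁿ, m; m)`; the family is empty for other lists of inputs. -/
noncomputable def moduleFamily (L : List Color) : BoxFamily L.length where
  ι := {i : D.Label // L = colM (D.leaves i)}
  finite := by
    refine ((D.finite (L.length - 1)).subset ?_).to_subtype
    intro i (hi : L = _)
    simp [hi, colM, colA]
  box i := D.core i.1 ++ [(D.slot, D.slot)]
  length_eq := by
    rintro ⟨i, rfl⟩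
    simp [D.length_core, colM, colA]
  proper i := by
    intro s hs
    rcases List.mem_append.1 hs with hs | hs
    · exact D.proper _ s hs
    · rw [List.mem_singleton.1 hs]
  sep i j l hi hj := by
    obtain ⟨l, hl, rfl⟩ := Box.mem_closed_concat.1 hi
    obtain ⟨l', hl', h⟩ := Box.mem_interior_concat.1 hj
    obtain rfl := List.append_cancel_right h
    rw [Box.dim_concat, Box.dim_concat]
    exact (D.sep _ _ l hl hl').imp id Subtype.ext
  cover i l hi := by
    obtain ⟨l, hl, rfl⟩ := Box.mem_closed_concat.1 hi
    obtain ⟨j, hj⟩ := D.cover _ l hl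
    exact ⟨⟨j, by rw [i.2, leaves_eq_of_mem hl hj]⟩, Box.mem_interior_concat.2 ⟨l, hj, rfl⟩⟩

/-- The families of boxes for all profiles. -/
noncomputable def family : ∀ (L : List Color) (_ : Color), BoxFamily L.length
  | L, .a => algebraFamily L
  | L, .m => D.moduleFamily L

/-- The coloured sequence of complexes. -/
noncomputable abbrev seq : CWSeq Color := boxSeq D.family

variable {D}

/-- The profile and the coordinates of an operation with output colour `a`. -/
theorem op_a {x : D.seq.Op} (h : x.output = .a) :
    1 ≤ x.arity ∧ x.inputs = colA x.arity ∧ opWord x = block x.arity := by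
  obtain ⟨⟨L, c⟩, x⟩ := x
  obtain rfl : c = .a := h
  obtain ⟨⟨n, hn, hL⟩, hx⟩ := x.mem
  obtain rfl : L = colA n := hL
  have : (op x : D.seq.Op).arity = n := by simp [op, Op.arity, Op.inputs, colA]
  change 1 ≤ (op x : D.seq.Op).arity ∧ _ = colA (op x : D.seq.Op).arity ∧
    _ = block (op x : D.seq.Op).arity
  rw [this]
  exact ⟨hn, rfl, block_mem_closed.1 hx⟩

/-- The profile and the coordinates of an operation with output colour `m`. -/
theorem op_m {x : D.seq.Op} (h : x.output = .m) {d : ℕ} (hd : HasRank x d) :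
    ∃ i w, x.inputs = colM (D.leaves i) ∧ opWord x = w ++ [D.slot] ∧ w ∈ (D.core i).interior ∧
      (D.core i).dim ≤ d := by
  obtain ⟨⟨L, c⟩, x⟩ := x
  obtain rfl : c = .m := h
  obtain ⟨⟨i, hi⟩, hx, hdim⟩ := hd
  obtain ⟨w, hw, h⟩ := Box.mem_interior_concat.1 hx
  exact ⟨i, w, hi, h, hw, (Box.dim_concat _ _).ge.trans hdim⟩

theorem exists_index_a {L : List Color} {c : Color} (hc : c = .a) {n : ℕ} (hn : 1 ≤ n)
    (hL : L = colA n) :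
    ∃ k, block n ∈ ((D.family L c).box k).interior ∧ ((D.family L c).box k).dim = 0 := by
  subst hc
  exact ⟨⟨n, hn, hL⟩, block_mem_interior.2 rfl, dim_block n⟩

theorem exists_index_m {L : List Color} {c : Color} (hc : c = .m) {i : D.Label}
    (hL : L = colM (D.leaves i)) {w : List ℝ} (hw : w ∈ (D.core i).interior) :
    ∃ k, w ++ [D.slot] ∈ ((D.family L c).box k).interior ∧
      ((D.family L c).box k).dim = (D.core i).dim := by
  subst hc
  exact ⟨⟨i, hL⟩, Box.mem_interior_concat.2 ⟨w, hw, rfl⟩, Box.dim_concat _ _⟩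

/-- The profile and the coordinates of a list of operations with output colour `a`. -/
theorem args_a {as : List D.seq.Op} (h : ∀ y ∈ as, y.output = .a) :
    (∀ n ∈ as.map Op.arity, 1 ≤ n) ∧ as.flatMap Op.inputs = colA (as.map Op.arity).sum ∧
      as.map opWord = (as.map Op.arity).map block := by
  induction as with
  | nil => simp [colA]
  | cons y as ih =>
    obtain ⟨h₁, h₂, h₃⟩ := ih fun z hz => h z (by simp [hz])
    obtain ⟨h₄, h₅, h₆⟩ := op_a (h y (by simp))
    refine ⟨?_, ?_, ?_⟩
    · simpa using ⟨h₄, by simpa using h₁⟩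
    · rw [List.flatMap_cons, h₂, h₅, List.map_cons, List.sum_cons, colA_add]
    · rw [List.map_cons, h₃, h₆, List.map_cons, List.map_cons]

/-- A composition of labels that describes the composition of words: leaf multiplication, followed
by concatenation with the rescaled box of the last argument. -/
structure Comp (D₁ D₂ D₃ : CellData) where
  label : D₁.Label → List ℕ → D₂.Label → D₃.Label
  slot_eq : D₃.slot = D₁.slot * D₂.slot
  core_eq : ∀ i ns j, ns.length = D₁.leaves i → (∀ n ∈ ns, 1 ≤ n) →
    D₃.core (label i ns j) = dilate (0, 0) ns (D₁.core i) ++ (D₂.core j).scale D₁.slot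

variable {D₁ D₂ D₃ : CellData} (K : Comp D₁ D₂ D₃)

namespace Comp

include K

theorem leaves_label {i : D₁.Label} {ns : List ℕ} {j : D₂.Label} (h : ns.length = D₁.leaves i)
    (hns : ∀ n ∈ ns, 1 ≤ n) : D₃.leaves (K.label i ns j) = ns.sum + D₂.leaves j := by
  rw [← D₃.length_core, K.core_eq i ns j h hns, List.length_append,
    length_dilate _ (by rw [h, D₁.length_core]) hns, Box.scale, List.length_map, D₂.length_core]

theorem dim_label {i : D₁.Label} {ns : List ℕ} {j : D₂.Label} (h : ns.length = D₁.leaves i)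
    (hns : ∀ n ∈ ns, 1 ≤ n) :
    (D₃.core (K.label i ns j)).dim = (D₁.core i).dim + (D₂.core j).dim := by
  rw [K.core_eq i ns j h hns, Box.dim_append, Box.dim_dilate (by rw [h, D₁.length_core]),
    Box.dim_scale D₁.slot_pos.ne']

theorem wordComp_eq {ns : List ℕ} {w v : List ℝ} (h : ns.length = w.length) :
    wordComp (w ++ [D₁.slot]) (ns.map block ++ [v ++ [D₂.slot]]) =
      (dilate 0 ns w ++ v.map (D₁.slot * ·)) ++ [D₃.slot] := by
  rw [wordComp_block_append _ _ _ _ h, K.slot_eq]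
  simp

theorem mem_interior {i : D₁.Label} {ns : List ℕ} {j : D₂.Label} {w v : List ℝ}
    (h : ns.length = D₁.leaves i) (hns : ∀ n ∈ ns, 1 ≤ n) (hw : w ∈ (D₁.core i).interior)
    (hv : v ∈ (D₂.core j).interior) :
    dilate 0 ns w ++ v.map (D₁.slot * ·) ∈ (D₃.core (K.label i ns j)).interior := by
  rw [K.core_eq i ns j h hns]
  exact Box.append_mem_interior
    ((Box.mem_interior_dilate (by rw [h, D₁.length_core])).2 ⟨w, hw, rfl⟩)
    (Box.map_mul_mem_interior_scale D₁.slot_pos hv)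

theorem exists_of_mem_interior {i : D₁.Label} {ns : List ℕ} {j : D₂.Label} {l : List ℝ}
    (h : ns.length = D₁.leaves i) (hns : ∀ n ∈ ns, 1 ≤ n)
    (hl : l ∈ (D₃.core (K.label i ns j)).interior) :
    ∃ w ∈ (D₁.core i).interior, ∃ v ∈ (D₂.core j).interior,
      l = dilate 0 ns w ++ v.map (D₁.slot * ·) := by
  rw [K.core_eq i ns j h hns] at hl
  obtain ⟨l₁, l₂, rfl, h₁, h₂⟩ := Box.mem_interior_append hl
  obtain ⟨w, hw, rfl⟩ := (Box.mem_interior_dilate (by rw [h, D₁.length_core])).1 h₁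
  obtain ⟨v, hv, rfl⟩ := Box.exists_of_mem_interior_scale D₁.slot_pos h₂
  exact ⟨w, hw, v, hv, rfl⟩

/-- Words in open cells are composed to words in open cells: the case distinction is on the output
colour, `a` for composites of one-point spaces. -/
theorem wordClosed : WordClosed D₁.family D₂.family D₃.family := by
  intro x ys hfit d ds hd hds
  cases hx : x.output with
  | a =>
    obtain ⟨hn, hi, hw⟩ := op_a hx
    have hys : ∀ y ∈ ys, y.output = .a := fun y hy =>
      List.eq_of_mem_replicate (hi ▸ hfit ▸ List.mem_map_of_mem (f := Op.output) hy)
    obtain ⟨h₁, h₂, h₃⟩ := args_a hys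
    have hlen : (ys.map Op.arity).length = (block x.arity).length := by
      rw [List.length_map, Fits.length_eq hfit, ← hw, opWord_length]
    have hsum : 1 ≤ (ys.map Op.arity).sum := by
      cases ys with
      | nil => simp [block] at hlen
      | cons y ys =>
        have := h₁ y.arity (by simp)
        simp only [List.map_cons, List.sum_cons]
        omega
    have hblock : wordComp (opWord x) (ys.map opWord) = block (ys.map Op.arity).sum := by
      rw [hw, h₃, wordComp_map_block]
      exact dilate_replicate_append 0 1 h₁ (by rw [hlen]; simp [block])
    rw [hblock]
    obtain ⟨k, hk, hdim⟩ := exists_index_a (D := D₃) rfl hsum h₂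
    exact ⟨k, hk, by omega⟩
  | m =>
    obtain ⟨i, w, hi, hw, hmem, hdim⟩ := op_m hx hd
    have hfit' : ys.map Op.output = colA (D₁.leaves i) ++ [Color.m] := by
      rw [show _ = _ from hfit, hi, colM]
    obtain ⟨as, ys', rfl, has, hys'⟩ := List.map_eq_append_iff.1 hfit'
    obtain ⟨y, rfl, hy⟩ := List.map_eq_singleton_iff.1 hys'
    obtain ⟨ds', ds'', rfl, hds', hds''⟩ : ∃ ds' ds'', ds = ds' ++ ds'' ∧
        List.Forall₂ HasRank as ds' ∧ List.Forall₂ HasRank [y] ds'' :=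
      ⟨ds.take as.length, ds.drop as.length, (List.take_append_drop _ _).symm,
        (List.forall₂_take_append _ _ _ hds.flip).flip,
        (List.forall₂_drop_append _ _ _ hds.flip).flip⟩
    obtain ⟨e, hye, rfl⟩ : ∃ e, HasRank y e ∧ ds'' = [e] := by
      cases hds'' with
      | cons h h' => cases h'; exact ⟨_, h, rfl⟩
    obtain ⟨j, v, hj, hv, hvmem, hvdim⟩ := op_m hy hye
    have has' : ∀ y ∈ as, y.output = .a := fun y hy =>
      List.eq_of_mem_replicate (has ▸ List.mem_map_of_mem (f := Op.output) hy)
    obtain ⟨h₁, h₂, h₃⟩ := args_a has'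
    have hlen : (as.map Op.arity).length = D₁.leaves i := by
      have := congrArg List.length has
      rw [List.length_map] at this ⊢
      rw [this]
      simp [colA]
    have hlen' : (as.map Op.arity).length = w.length := by
      rw [hlen, Box.length_eq_of_mem_interior hmem, D₁.length_core]
    rw [hw, List.map_append, List.map_singleton, hv, h₃, K.wordComp_eq hlen']
    obtain ⟨k, hk, hkdim⟩ := exists_index_m (D := D₃) (L := (as ++ [y]).flatMap Op.inputs) rfl
      (i := K.label i (as.map Op.arity) j) (by
        rw [List.flatMap_append, List.flatMap_singleton, h₂, hj, K.leaves_label hlen h₁, colM, colM,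
          colA_add, List.append_assoc]) (K.mem_interior hlen h₁ hmem hvmem)
    refine ⟨k, hk, hkdim.trans_le ?_⟩
    rw [K.dim_label hlen h₁, List.sum_append, List.sum_singleton]
    omega

/-- A word in the cell of a composite label has exactly one decomposition, since leaf multiplication
only inserts zeros and the scaling by a positive number is injective. -/
theorem bijectiveOnProduct {k q N : ℕ} {i : D₁.Label} {j : D₂.Label} (hi : D₁.leaves i = k)
    (hj : D₂.leaves j = q) {as : List D₂.seq.Op} (hk : as.length = k)
    (has : ∀ y ∈ as, y.output = .a) (hN : D₃.leaves (K.label i (as.map Op.arity) j) = N) :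
    BijectiveOnProduct ((wordMap K.wordClosed).Rel as)
      {x : D₁.seq.obj (colM k) .m | x.val ∈ (D₁.core i ++ [(D₁.slot, D₁.slot)]).interior}
      {y : D₂.seq.obj (colM q) .m | y.val ∈ (D₂.core j ++ [(D₂.slot, D₂.slot)]).interior}
      {z : D₃.seq.obj (colM N) .m | z.val ∈ (D₃.core (K.label i (as.map Op.arity) j) ++
        [(D₃.slot, D₃.slot)]).interior} := by
  obtain ⟨h₁, h₂, h₃⟩ := args_a has
  have hlen : (as.map Op.arity).length = D₁.leaves i := by rw [List.length_map, hk, hi]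
  have hword : ∀ (y : D₂.seq.obj (colM q) .m), (as ++ [op y]).map opWord =
      (as.map Op.arity).map block ++ [y.val] := fun y => by
    rw [List.map_append, h₃]; rfl
  have hfits : ∀ (x : D₁.seq.obj (colM k) .m) (y : D₂.seq.obj (colM q) .m),
      Fits (op x) (as ++ [op y]) := fun x y => by
    have : as.map Op.output = colA k :=
      List.eq_replicate_iff.2 ⟨by simp [hk], fun c hc => by
        obtain ⟨y, hy, rfl⟩ := List.mem_map.1 hc
        exact has y hy⟩
    rw [Fits, List.map_append, this]
    rfl
  have hleaves := K.leaves_label (j := j) hlen h₁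
  have hin : ∀ y : D₂.seq.obj (colM q) .m, (as ++ [op y]).flatMap Op.inputs = colM N := fun y => by
    rw [List.flatMap_append, List.flatMap_singleton, h₂, ← hN, hleaves, hj]
    change colA _ ++ colM q = colM _
    simp only [colM, colA_add, List.append_assoc]
  have hRel : ∀ x y (z : D₃.seq.obj (colM N) .m), (wordMap K.wordClosed).Rel as x y z ↔
      wordComp x.val ((as.map Op.arity).map block ++ [y.val]) = z.val := fun x y z => by
    constructor
    · rintro ⟨h, he⟩
      rw [← hword]
      exact congrArg opWord he
    · intro he
      refine ⟨hfits x y, op_ext (hin y) rfl ?_⟩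
      rw [opWord_wordMap, hword]
      exact he
  have hw : ∀ w ∈ (D₁.core i).interior, (as.map Op.arity).length = w.length := fun w hw => by
    rw [hlen, Box.length_eq_of_mem_interior hw, D₁.length_core]
  constructor
  · intro x hx y hy
    obtain ⟨w, hwi, hxw⟩ := Box.mem_interior_concat.1 hx
    obtain ⟨v, hvi, hyv⟩ := Box.mem_interior_concat.1 hy
    have hz := (Box.mem_interior_concat (c := D₃.slot)).2 ⟨_, K.mem_interior hlen h₁ hwi hvi, rfl⟩
    refine ⟨⟨_, ⟨K.label i (as.map Op.arity) j, by rw [hN]⟩, Box.interior_subset_closed _ hz⟩, hz,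
      ?_⟩
    rw [hRel, hxw, hyv, K.wordComp_eq (hw w hwi)]
  · intro z hz
    obtain ⟨l, hl, hzl⟩ := Box.mem_interior_concat.1 hz
    obtain ⟨w, hwi, v, hvi, rfl⟩ := K.exists_of_mem_interior hlen h₁ hl
    have hx := (Box.mem_interior_concat (c := D₁.slot)).2 ⟨w, hwi, rfl⟩
    have hy := (Box.mem_interior_concat (c := D₂.slot)).2 ⟨v, hvi, rfl⟩
    refine ⟨⟨⟨_, ⟨i, by rw [hi]⟩, Box.interior_subset_closed _ hx⟩,
      ⟨_, ⟨j, by rw [hj]⟩, Box.interior_subset_closed _ hy⟩⟩, ⟨hx, hy, ?_⟩, ?_⟩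
    · rw [hRel, hzl, K.wordComp_eq (hw w hwi)]
    · rintro ⟨x, y⟩ ⟨hx, hy, hxy⟩
      obtain ⟨w', hwi', hxw⟩ := Box.mem_interior_concat.1 hx
      obtain ⟨v', hvi', hyv⟩ := Box.mem_interior_concat.1 hy
      rw [hRel, hxw, hyv, K.wordComp_eq (hw w' hwi'), hzl] at hxy
      obtain ⟨h₄, h₅⟩ := List.append_inj (List.append_cancel_right hxy) (by
        rw [length_dilate _ (hw w' hwi') h₁, length_dilate _ (hw w hwi) h₁])
      obtain rfl := dilate_injective _ (hw w' hwi') (hw w hwi) h₄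
      obtain rfl := List.map_injective_iff.2 (mul_right_injective₀ D₁.slot_pos.ne') h₅
      exact Prod.ext (BoxFamily.Space.ext hxw) (BoxFamily.Space.ext hyv)

end Comp

theorem isStrictAlgebra (D : CellData) : D.seq.IsStrictAlgebra where
  nonempty n hn := ⟨⟨block n, ⟨n, hn, rfl⟩, block_mem_closed.2 rfl⟩⟩
  subsingleton n _ := by
    refine ⟨fun x y => BoxFamily.Space.ext ?_⟩
    obtain ⟨⟨i, hi, h⟩, hx⟩ := x.mem
    obtain ⟨⟨j, hj, h'⟩, hy⟩ := y.mem
    obtain rfl := colA_injective (h.symm.trans h')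
    exact (block_mem_closed.1 hx).trans (block_mem_closed.1 hy).symm
  isEmpty_a L hL := ⟨fun x => by
    obtain ⟨⟨n, hn, h⟩, -⟩ := x.mem
    exact hL n hn h⟩
  isEmpty_m L hL := ⟨fun x => by
    obtain ⟨⟨i, h⟩, -⟩ := x.mem
    exact hL _ h⟩

/-! ### Labels and coordinates of cells -/

/-- The labels of the cells of the space of operations of profile `(aⁿ, m; m)`. -/
noncomputable def labelEquiv (D : CellData) (n : ℕ) : {i : D.Label // D.leaves i = n} ≃
    Σ d, RelCWComplex.cell (univ : Set (D.seq.obj (colM n) .m)) d :=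
  (Equiv.subtypeEquivRight fun i =>
    (⟨fun h => by rw [h], fun h => (colM_injective h).symm⟩ :
      D.leaves i = n ↔ colM n = colM (D.leaves i))).trans (D.moduleFamily (colM n)).labelEquiv

theorem openCell_labelEquiv (D : CellData) {n : ℕ} (i : {i : D.Label // D.leaves i = n}) :
    RelCWComplex.openCell (C := (univ : Set (D.seq.obj (colM n) .m))) (D.labelEquiv n i).1
      (D.labelEquiv n i).2 = {x | x.val ∈ (D.core i ++ [(D.slot, D.slot)]).interior} :=
  (D.moduleFamily (colM n)).openCell_eq _

theorem closedCell_labelEquiv (D : CellData) {n : ℕ} (i : {i : D.Label // D.leaves i = n}) :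
    RelCWComplex.closedCell (C := (univ : Set (D.seq.obj (colM n) .m))) (D.labelEquiv n i).1
      (D.labelEquiv n i).2 = {x | x.val ∈ (D.core i ++ [(D.slot, D.slot)]).closed} :=
  (D.moduleFamily (colM n)).closedCell_eq _

theorem labelEquiv_fst (D : CellData) {n : ℕ} (i : {i : D.Label // D.leaves i = n}) :
    (D.labelEquiv n i).1 = (D.core i).dim :=
  Box.dim_concat _ _

theorem exists_core (D : CellData) {n : ℕ} (x : D.seq.obj (colM n) .m) :
    ∃ i w, D.leaves i = n ∧ w ∈ (D.core i).closed ∧ x.val = w ++ [D.slot] := by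
  obtain ⟨⟨i, hi⟩, hx⟩ := x.mem
  obtain ⟨w, hw, h⟩ := Box.mem_closed_concat.1 hx
  exact ⟨i, w, (colM_injective hi).symm, hw, h⟩

theorem Comp.bijectiveOnProduct_openCell {D₁ D₂ D₃ : CellData}
    (K : Comp D₁ D₂ D₃) {k q N : ℕ} {i : {i : D₁.Label // D₁.leaves i = k}}
    {j : {j : D₂.Label // D₂.leaves j = q}} {l : {l : D₃.Label // D₃.leaves l = N}}
    {as : List D₂.seq.Op} (hk : as.length = k) (has : ∀ y ∈ as, y.output = .a)
    (hl : l.1 = K.label i.1 (as.map Op.arity) j.1) :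
    BijectiveOnProduct ((wordMap K.wordClosed).Rel as)
      (RelCWComplex.openCell (D₁.labelEquiv k i).1 (D₁.labelEquiv k i).2)
      (RelCWComplex.openCell (D₂.labelEquiv q j).1 (D₂.labelEquiv q j).2)
      (RelCWComplex.openCell (D₃.labelEquiv N l).1 (D₃.labelEquiv N l).2) := by
  rw [openCell_labelEquiv, openCell_labelEquiv, openCell_labelEquiv, hl]
  exact K.bijectiveOnProduct i.2 j.2 hk has (hl ▸ l.2)

/-- The cell model in which the words `w` have the coordinates `chart n w`. -/
noncomputable def model (D : CellData) {n N : ℕ} {K : Set (Fin N → ℝ)}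
    {face : {i : D.Label // D.leaves i = n} → Set (Fin N → ℝ)}
    {dim : {i : D.Label // D.leaves i = n} → ℕ}
    (coord : D.seq.obj (colM n) .m → Fin N → ℝ) (word : (Fin N → ℝ) → List ℝ)
    (hcont : Continuous coord)
    (hword : ∀ x, x.val = word (coord x) ++ [D.slot])
    (hcoord : ∀ x z, x.val = word z ++ [D.slot] → coord x = z)
    (hface : ∀ i z, z ∈ face i ↔ word z ∈ (D.core i.1).closed)
    (hK : K = ⋃ i, face i) (hdim : ∀ i, (D.core i.1).dim = dim i) : CellModel
      (D.seq.obj (colM n) .m) K face dim where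
  coord := coord
  isEmbedding := (hcont.isClosedEmbedding fun x y h => BoxFamily.Space.ext <| by
    rw [hword x, hword y, h]).isEmbedding
  range_eq := by
    ext z
    simp only [hK, mem_iUnion, hface]
    constructor
    · rintro ⟨x, rfl⟩
      obtain ⟨i, w, hi, hw, hx⟩ := D.exists_core x
      obtain rfl := List.append_cancel_right ((hword x).symm.trans hx)
      exact ⟨⟨i, hi⟩, hw⟩
    · rintro ⟨i, hi⟩
      let x : D.seq.obj (colM n) .m := ⟨word z ++ [D.slot], ⟨i.1, by rw [i.2]⟩,
        Box.mem_closed_concat.2 ⟨_, hi, rfl⟩⟩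
      exact ⟨x, hcoord x z rfl⟩
  label := D.labelEquiv n
  label_dim i := (D.labelEquiv_fst i).trans (hdim i)
  image_closedCell i := by
    rw [closedCell_labelEquiv]
    ext z
    rw [hface]
    constructor
    · rintro ⟨x, hx, rfl⟩
      obtain ⟨w, hw, h⟩ := Box.mem_closed_concat.1 hx
      obtain rfl := List.append_cancel_right ((hword x).symm.trans h)
      exact hw
    · intro hi
      have h := (Box.mem_closed_concat (c := D.slot)).2 ⟨_, hi, rfl⟩
      let x : D.seq.obj (colM n) .m := ⟨word z ++ [D.slot], ⟨i.1, by rw [i.2]⟩, h⟩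
      exact ⟨x, h, hcoord x z rfl⟩

end CellData

/-! ### Leaf multiplication and concatenation of labels -/

/-- The new leaves that replace a leaf are on the same branch, so all but the last of them are
followed by a leaf on that branch. -/
theorem ShortTree.word_mult {α : Type*} (s i o : α) (t : ShortTree) {ns : List ℕ}
    (h : t.leaves ≤ ns.length) (hns : ∀ n ∈ ns, 1 ≤ n) :
    (t.mult ns).word s i o = dilate s ns (t.word s i o) := by
  have branch : ∀ (k : ℕ+) (x : α) (ns : List ℕ), (k : ℕ) ≤ ns.length → (∀ n ∈ ns, 1 ≤ n) →
      List.replicate (((ns.take k).sum.toPNat' : ℕ) - 1) s ++ [x] =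
        dilate s ns (List.replicate (k - 1) s ++ [x]) := by
    intro k x ns hk hns
    have hk₀ := k.pos
    have hlen : (ns.take k).length = ((k : ℕ) - 1) + 1 := by
      rw [List.length_take]
      omega
    have hns' : ∀ n ∈ ns.take k, 1 ≤ n := fun n hn => hns n (List.mem_of_mem_take hn)
    have hsum : 0 < (ns.take k).sum := by
      obtain ⟨n, l, hl⟩ := List.exists_cons_of_length_eq_add_one hlen
      have := hns' n (by simp [hl])
      rw [hl, List.sum_cons]
      omega
    have hword : (List.replicate ((k : ℕ) - 1) s ++ [x]).length = k := by
      simp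
      omega
    rw [Nat.toPNat'_coe, if_pos hsum, ← dilate_replicate_append s x hns' hlen]
    conv_rhs => rw [← dilate_take, hword]
  induction t generalizing ns with
  | nil => simp [mult]
  | cons k t ih =>
    rw [leaves_cons] at h
    have hk := branch k
    cases t with
    | nil =>
      simp only [mult, word]
      exact hk o ns (by omega) hns
    | cons l t =>
      have ih' := ih (ns := ns.drop k) (by rw [List.length_drop]; omega)
        fun n hn => hns n (List.mem_of_mem_drop hn)
      have hlen : (List.replicate ((k : ℕ) - 1) s ++ [i]).length = k := by
        have := k.pos
        simp
        omega
      simp only [mult, word] at ih' ⊢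
      have := hk i ns (by omega) hns
      rw [List.append_cons, this, List.append_cons (List.replicate ((k : ℕ) - 1) s) i
        (word s i o (l :: t)), dilate_append s ns _ (word s i o (l :: t)), hlen, ih']

theorem forestBox_mult (c : ℝ) (F : List ShortTree) {ns : List ℕ}
    (h : (F.map ShortTree.leaves).sum ≤ ns.length) (hns : ∀ n ∈ ns, 1 ≤ n) :
    forestBox c (ShortForest.multTrees F ns) = dilate (0, 0) ns (forestBox c F) := by
  induction F generalizing ns with
  | nil => simp [ShortForest.multTrees]
  | cons t F ih =>
    rw [List.map_cons, List.sum_cons] at h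
    rw [ShortForest.multTrees, forestBox_cons, forestBox_cons, dilate_append,
      ShortTree.length_word, ShortTree.word_mult _ _ _ _ (by omega) hns,
      ih (by rw [List.length_drop]; omega) fun n hn => hns n (List.mem_of_mem_drop hn)]

theorem Triple.box_mult (τ : Triple) {ns : List ℕ} (h : τ.leaves ≤ ns.length)
    (hns : ∀ n ∈ ns, 1 ≤ n) : (τ.mult ns).box = dilate (0, 0) ns τ.box := by
  have hdrop : ∀ m, ∀ n ∈ ns.drop m, 1 ≤ n := fun m n hn => hns n (List.mem_of_mem_drop hn)
  simp only [leaves, ShortForest.leaves] at h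
  simp only [box, mult, ShortForest.mult]
  rw [dilate_append, dilate_append, forestBox_mult _ _ (by omega) hns,
    ShortTree.word_mult _ _ _ _ (by rw [List.length_drop, ShortForest.leaves]; omega) (hdrop _),
    forestBox_mult _ _ (by rw [List.length_drop, ShortForest.leaves]; omega) (hdrop _),
    length_forestBox, ShortTree.length_word, List.drop_drop]
  rfl

theorem scale_forestBox (c d : ℝ) (F : List ShortTree) :
    (forestBox d F).scale c = forestBox (c * d) F := by
  simp [forestBox, Box.scale, List.map_flatMap, ShortTree.map_word]

theorem Box.scale_one (b : Box) : b.scale 1 = b := by simp [Box.scale]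

theorem Triple.box_concatLeft (F : ShortForest) (τ : Triple) :
    (Triple.concatLeft F τ).box = forestBox 1 F.trees ++ τ.box := by
  simp [Triple.box, Triple.concatLeft, ShortForest.concat, forestBox_append]

theorem Triple.box_concatRight (τ : Triple) (G : ShortForest) :
    (τ.concatRight G).box = τ.box ++ forestBox (1 / 2) G.trees := by
  simp [Triple.box, Triple.concatRight, ShortForest.concat, forestBox_append]

/-! ### The operad of cubes and the bimodule of freehedra -/

/-- The triple `(F, 1, ∅)`.  Its face of the freehedron has the same box as the face of the
cube that is labelled by `F`. -/
def ShortForest.toTriple (F : ShortForest) : Triple := ⟨F, [], ⟨[], by simp⟩⟩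

namespace ShortForest

variable (F : ShortForest)

theorem box_toTriple : F.toTriple.box = forestBox 1 F.trees := by
  simp [toTriple, Triple.box]

theorem leaves_toTriple : F.toTriple.leaves = F.leaves := by
  simp [toTriple, Triple.leaves, ShortForest.leaves]

theorem dim_toTriple : F.toTriple.dim = F.dim := by
  simp [toTriple, Triple.dim, dim]

theorem toTriple_injective : Function.Injective toTriple := fun _ _ h => congrArg Triple.fst h

theorem dim_forestBox : (forestBox 1 F.trees).dim = F.dim := by
  rw [← box_toTriple, Triple.dim_box, dim_toTriple]

end ShortForest

/-- The cells of the cubes. -/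
noncomputable def cubeData : CellData where
  Label := ShortForest
  leaves := ShortForest.leaves
  core F := forestBox 1 F.trees
  slot := 1
  slot_pos := one_pos
  finite n := by
    refine ((Triple.finite_leaves_eq n).preimage ShortForest.toTriple_injective.injOn).subset ?_
    intro F hF
    exact F.leaves_toTriple.trans hF
  length_core F := length_forestBox _ _
  proper F := F.box_toTriple ▸ F.toTriple.proper_box
  sep F G l hF hG := by
    rw [← ShortForest.box_toTriple] at hF hG
    rw [F.dim_forestBox, G.dim_forestBox, ← F.dim_toTriple, ← G.dim_toTriple]
    exact (Triple.dim_lt_or_eq_of_mem_interior _ _ l hF hG).1.imp id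
      fun h => ShortForest.toTriple_injective h
  cover F l hF := by
    rw [← ShortForest.box_toTriple] at hF
    obtain ⟨⟨G, T, H⟩, hρ⟩ := Triple.exists_mem_interior_box _ l hF
    obtain ⟨hT, hH⟩ := (Triple.dim_lt_or_eq_of_mem_interior _ _ l hF hρ).2.2 ⟨rfl, rfl⟩
    obtain rfl : T = [] := hT
    refine ⟨G, ?_⟩
    obtain rfl : H = ⟨[], by simp⟩ := ShortForest.ext hH
    rwa [← ShortForest.box_toTriple]

/-- The cells of the freehedra. -/
noncomputable def freehedronData : CellData where
  Label := Triple
  leaves := Triple.leaves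
  core := Triple.box
  slot := 1 / 2
  slot_pos := by norm_num
  finite := Triple.finite_leaves_eq
  length_core := Triple.length_box
  proper := Triple.proper_box
  sep τ ρ l hτ hρ := by
    rw [Triple.dim_box, Triple.dim_box]
    exact (Triple.dim_lt_or_eq_of_mem_interior τ ρ l hτ hρ).1
  cover := Triple.exists_mem_interior_box

/-- Composition of cells in the operad of cubes. -/
noncomputable def cubeComp : CellData.Comp cubeData cubeData cubeData where
  label F ns F' := (F.mult ns).concat F'
  slot_eq := (one_mul _).symm
  core_eq := fun (F : ShortForest) ns (F' : ShortForest) (h : _ = F.leaves) hns => by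
    change forestBox 1 (ShortForest.multTrees F.trees ns ++ F'.trees) =
      dilate (0, 0) ns (forestBox 1 F.trees) ++ (forestBox 1 F'.trees).scale 1
    rw [forestBox_append, forestBox_mult _ _ h.ge hns, Box.scale_one]

/-- The left action on cells of the freehedra. -/
noncomputable def leftComp : CellData.Comp cubeData freehedronData freehedronData where
  label F ns τ := Triple.concatLeft (F.mult ns) τ
  slot_eq := (one_mul _).symm
  core_eq := fun (F : ShortForest) ns (τ : Triple) (h : _ = F.leaves) hns => by
    change (Triple.concatLeft (F.mult ns) τ).box =
      dilate (0, 0) ns (forestBox 1 F.trees) ++ τ.box.scale 1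
    rw [Triple.box_concatLeft, Box.scale_one, ShortForest.mult, forestBox_mult _ _ h.ge hns]

/-- The right action on cells of the freehedra. -/
noncomputable def rightComp : CellData.Comp freehedronData cubeData freehedronData where
  label τ ns G := (τ.mult ns).concatRight G
  slot_eq := (mul_one _).symm
  core_eq := fun (τ : Triple) ns (G : ShortForest) (h : _ = τ.leaves) hns => by
    change ((τ.mult ns).concatRight G).box =
      dilate (0, 0) ns τ.box ++ (forestBox 1 G.trees).scale (1 / 2)
    rw [Triple.box_concatRight, scale_forestBox, mul_one, Triple.box_mult _ h.ge hns]

/-- The unit of colour `c`. -/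
noncomputable def cubeUnit (c : Color) : cubeData.seq.obj [c] c where
  val := [1]
  mem := by
    cases c with
    | a => exact ⟨⟨1, le_rfl, rfl⟩, block_mem_closed.2 rfl⟩
    | m => exact ⟨⟨⟨[], by simp⟩, rfl⟩, Box.mem_closed_concat.2 ⟨[], (Box.closed_nil _).2 rfl, rfl⟩⟩

theorem wordMap_unit_left {D : CellData} (H : WordClosed cubeData.family D.family D.family)
    (x : D.seq.Op) (h : Fits (op (cubeUnit x.output)) [x]) :
    (wordMap H).toFun (op (cubeUnit x.output)) [x] h = x := by
  refine op_ext ?_ rfl ?_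
  · rw [CompMap.inputs_eq, List.flatMap_singleton]
  · rw [opWord_wordMap]
    exact wordComp_singleton_one _

theorem wordMap_unit_right {D : CellData} (H : WordClosed D.family cubeData.family D.family)
    (x : D.seq.Op) (h : Fits x (x.inputs.map fun c => op (cubeUnit c))) :
    (wordMap H).toFun x (x.inputs.map fun c => op (cubeUnit c)) h = x := by
  refine op_ext ?_ rfl ?_
  · rw [CompMap.inputs_eq, List.flatMap_map]
    exact List.flatMap_singleton' _
  · rw [opWord_wordMap, List.map_map]
    exact wordComp_map_const_one _ _ (opWord_length x)

/-- The operad of cubes. -/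
noncomputable def cubeCWOperad : CWOperad Color where
  toCWSeq := cubeData.seq
  unit := cubeUnit
  comp := wordMap cubeComp.wordClosed
  unit_comp := wordMap_unit_left _
  comp_unit := wordMap_unit_right _
  assoc := wordMap_assoc _ _ _ _

/-- The bimodule of freehedra. -/
noncomputable def freehedronBimodule : CWBimodule cubeCWOperad where
  toCWSeq := freehedronData.seq
  left := wordMap leftComp.wordClosed
  right := wordMap rightComp.wordClosed
  unit_left := wordMap_unit_left _
  right_unit := wordMap_unit_right _
  left_assoc := wordMap_assoc _ _ _ _
  right_assoc := wordMap_assoc _ _ _ _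
  left_right := wordMap_assoc _ _ _ _

/-! ### Faces of the freehedra and triples -/

namespace Triple

/-- The side of the face of the freehedron that belongs to the new leaf. -/
noncomputable def Move.faceSide : Move → Zone → Set ℝ
  | .newFirst, _ => {0}
  | .newMid, .none => Icc 0 1
  | .newMid, _ => Icc 0 (1 / 2)
  | .newLast, .none => {1}
  | .newLast, _ => {1 / 2}
  | .same, _ => {1}
  | .inner, .last => Icc (1 / 2) 1
  | .inner, _ => Icc 0 1

theorem sides_prepend {e : Move} {τ : Triple} (h : e.Legal τ.zone) :
    (prepend e τ).sides = e.faceSide τ.zone :: τ.sides := by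
  obtain ⟨⟨_ | ⟨t, F⟩, hF⟩, _ | ⟨k, T⟩, ⟨_ | ⟨s, _ | ⟨r, G⟩⟩, hG⟩⟩ := τ <;> cases e <;>
    simp_all [zone, Move.Legal, prepend, Move.faceSide, sides, modify, ShortTree.word_inc,
      ShortTree.word_grow, ShortTree.treeSides_eq_word, lastSides]

theorem face_prepend {e : Move} {τ : Triple} (h : e.Legal τ.zone) (n : ℕ) :
    (prepend e τ).face (n + 1) = timesSide (τ.face n) (e.faceSide τ.zone) := by
  ext x
  simp only [face, sides_prepend h, timesSide, mem_ofPred_eq, Fin.forall_fin_succ, Fin.rev_zero,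
    Fin.val_zero, List.getD_cons_zero, Fin.rev_succ, Fin.val_succ, List.getD_cons_succ]
  exact and_comm

theorem face_zero (τ : Triple) : τ.face 0 = univ :=
  eq_univ_of_forall fun _ i => i.elim0

/-- The coordinates of a point of the freehedron in the model of words: the leaf that comes from the
coordinate `t` gets the letter `1 - t`, and `1 - t / 2` if it is the last one. -/
noncomputable def freehedronWord : (n : ℕ) → (Fin n → ℝ) → List ℝ
  | 0, _ => []
  | 1, x => [1 - x 0 / 2]
  | n + 2, x => (1 - x (Fin.last (n + 1))) :: freehedronWord (n + 1) fun i => x i.castSucc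

/-- The change of coordinates carries the face of a triple to its box. -/
theorem mem_face_iff {n : ℕ} (τ : Triple) (h : τ.leaves = n) (x : Fin n → ℝ) :
    x ∈ τ.face n ↔ freehedronWord n x ∈ τ.box.closed := by
  induction τ using prepend_induction generalizing n with
  | zero τ h₀ =>
    obtain rfl : n = 0 := by omega
    rw [face_zero, eq_of_leaves_eq_zero h₀]
    simp [freehedronWord, box]
  | prepend e τ he ih =>
    rw [leaves_prepend he] at h
    subst h
    rw [face_prepend he, box_prepend he]
    have hz : τ.zone = .none ↔ τ.leaves = 0 := zone_eq_none_iff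
    have ih' := ih rfl fun i => x i.castSucc
    revert ih'
    generalize τ.leaves = n at *
    intro ih'
    simp only [timesSide, mem_ofPred_eq, ih']
    cases n with
    | zero =>
      rw [hz.2 rfl] at he ⊢
      change [] ∈ τ.box.closed ∧ x 0 ∈ _ ↔ [1 - x 0 / 2] ∈ _
      rw [Box.cons_mem_closed, and_comm]
      refine and_congr ?_ Iff.rfl
      cases e <;> simp only [Move.faceSide, Move.side, mem_Icc, mem_singleton_iff]
      · exact ⟨fun h => by constructor <;> linarith, fun h => by linarith [h.1, h.2]⟩
      · exact ⟨fun h => by constructor <;> linarith [h.1, h.2],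
          fun h => by constructor <;> linarith [h.1, h.2]⟩
      · exact ⟨fun h => by constructor <;> linarith, fun h => by linarith [h.1, h.2]⟩
      · exact absurd rfl he
      · exact absurd rfl he
    | succ n =>
      rw [freehedronWord, Box.cons_mem_closed, and_comm]
      refine and_congr ?_ Iff.rfl
      have hz' : τ.zone ≠ .none := fun h => by simpa using hz.1 h
      generalize τ.zone = z at he hz'
      cases e <;> cases z <;>
        first
        | exact absurd rfl hz'
        | (simp only [Move.faceSide, Move.side, mem_Icc, mem_singleton_iff]
           first
           | exact ⟨fun h => by constructor <;> linarith, fun h => by linarith [h.1, h.2]⟩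
           | exact ⟨fun h => by constructor <;> linarith [h.1, h.2],
              fun h => by constructor <;> linarith [h.1, h.2]⟩)

theorem exists_freehedronWord (l : List ℝ) : ∃ x, freehedronWord l.length x = l := by
  induction l with
  | nil => exact ⟨0, rfl⟩
  | cons t l ih =>
    cases l with
    | nil => exact ⟨fun _ => 2 * (1 - t), by simp [freehedronWord]⟩
    | cons s l =>
      obtain ⟨x, hx⟩ := ih
      refine ⟨Fin.snoc x (1 - t), ?_⟩
      simp only [List.length_cons, freehedronWord, Fin.snoc_last, Fin.snoc_castSucc] at hx ⊢
      rw [hx]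
      simp

theorem box_closed_nonempty (τ : Triple) : τ.box.closed.Nonempty :=
  ⟨_, Box.param_mem_closed τ.proper_box (u := 0) fun _ _ => by simp⟩

theorem face_subset_iff {n : ℕ} {τ ρ : Triple} (hτ : τ.leaves = n) (hρ : ρ.leaves = n) :
    ρ.face n ⊆ τ.face n ↔ ρ.box.closed ⊆ τ.box.closed := by
  constructor
  · intro h l hl
    have hlen : l.length = n := by rw [Box.length_eq_of_mem_closed hl, length_box, hρ]
    obtain ⟨x, rfl⟩ : ∃ x, freehedronWord n x = l := hlen ▸ exists_freehedronWord l
    exact (mem_face_iff τ hτ x).1 (h ((mem_face_iff ρ hρ x).2 hl))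
  · intro h x hx
    exact (mem_face_iff τ hτ x).2 (h ((mem_face_iff ρ hρ x).1 hx))

theorem face_nonempty {n : ℕ} {τ : Triple} (hτ : τ.leaves = n) : (τ.face n).Nonempty := by
  obtain ⟨l, hl⟩ := τ.box_closed_nonempty
  have hlen : l.length = n := by rw [Box.length_eq_of_mem_closed hl, length_box, hτ]
  obtain ⟨x, rfl⟩ : ∃ x, freehedronWord n x = l := hlen ▸ exists_freehedronWord l
  exact ⟨x, (mem_face_iff τ hτ x).2 hl⟩

theorem timesSide_subset_iff {n : ℕ} {σ σ' : Set (Fin n → ℝ)} {I I' : Set ℝ} (hσ : σ.Nonempty)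
    (hI : I.Nonempty) : timesSide σ I ⊆ timesSide σ' I' ↔ σ ⊆ σ' ∧ I ⊆ I' := by
  have key : ∀ {σ : Set (Fin n → ℝ)} {I : Set ℝ} {x : Fin n → ℝ} {t : ℝ},
      (Fin.snoc x t : Fin (n + 1) → ℝ) ∈ timesSide σ I ↔ x ∈ σ ∧ t ∈ I := by
    intro σ I x t
    simp [timesSide]
  constructor
  · intro h
    obtain ⟨x₀, hx₀⟩ := hσ
    obtain ⟨t₀, ht₀⟩ := hI
    exact ⟨fun x hx => (key.1 (h (key.2 ⟨hx, ht₀⟩))).1, fun t ht => (key.1 (h (key.2 ⟨hx₀, ht⟩))).2⟩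
  · rintro ⟨h, h'⟩ x ⟨hx, ht⟩
    exact ⟨h hx, h' ht⟩

theorem faceSide_nonempty (e : Move) (z : Zone) : (e.faceSide z).Nonempty := by
  cases e <;> cases z <;> simp only [Move.faceSide, singleton_nonempty, nonempty_Icc] <;> norm_num

/-- The faces in the distinguished hyperface are those of the triples `(∅, 1, G)` with `G ≠ ∅`. -/
theorem face_subset_distinguishedFace_iff {n : ℕ} {τ : Triple} (h : τ.leaves = n) :
    τ.face n ⊆ distinguishedFace n ↔ τ.zone = .last := by
  induction τ using prepend_induction generalizing n with
  | zero τ h₀ =>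
    obtain rfl : n = 0 := by omega
    rw [zone_eq_none_iff.2 h₀, face_zero, distinguishedFace]
    simp
  | prepend e τ he ih =>
    rw [leaves_prepend he] at h
    subst h
    rw [face_prepend he, zone_prepend he]
    have ih' := ih rfl
    have hne := face_nonempty (τ := τ) rfl
    have hz : τ.zone = .none ↔ τ.leaves = 0 := zone_eq_none_iff
    revert ih' hne
    generalize τ.leaves = n at *
    intro ih' hne
    have h₁ : ¬ (1 : ℝ) ≤ 2⁻¹ := by norm_num
    have h₂ : (2 : ℝ)⁻¹ ≤ 1 := by norm_num
    have h₃ : ¬ (2 : ℝ)⁻¹ ≤ 0 := by norm_num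
    cases n with
    | zero =>
      have : distinguishedFace 1 = timesSide univ {1} := by
        ext x
        simp [distinguishedFace, timesSide]
      rw [this, timesSide_subset_iff hne (faceSide_nonempty _ _)]
      rw [hz.2 rfl] at he ⊢
      cases e <;> simp_all [Move.faceSide, Move.zone, Move.Legal]
      exact ⟨0, by simp⟩
    | succ n =>
      rw [distinguishedFace, timesSide_subset_iff hne (faceSide_nonempty _ _), ih']
      have hz' : τ.zone ≠ .none := fun h => by simpa using hz.1 h
      generalize τ.zone = z at he hz'
      cases e <;> cases z <;>
        simp_all [Move.faceSide, Move.zone, Move.Legal, Icc_subset_Icc_iff]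

theorem isFreehedronFace_face {n : ℕ} {τ : Triple} (h : τ.leaves = n) :
    IsFreehedronFace n (τ.face n) := by
  induction τ using prepend_induction generalizing n with
  | zero τ h₀ =>
    obtain rfl : n = 0 := by omega
    rw [face_zero]
    exact .point
  | prepend e τ he ih =>
    rw [leaves_prepend he] at h
    subst h
    rw [face_prepend he]
    have h := ih rfl
    have hd := face_subset_distinguishedFace_iff (τ := τ) rfl
    generalize τ.zone = z at *
    cases e <;> cases z <;>
      first
      | exact h.bottom
      | exact h.top
      | exact h.side (by simp [hd])
      | exact h.lower (hd.2 rfl)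
      | exact h.middle (hd.2 rfl)
      | exact h.upper (hd.2 rfl)
      | simp [Move.Legal] at he

theorem exists_face_eq {n : ℕ} {σ : Set (Fin n → ℝ)} (h : IsFreehedronFace n σ) :
    ∃ τ : Triple, τ.leaves = n ∧ τ.face n = σ := by
  have step : ∀ {n : ℕ} (e : Move) (τ : Triple) {I : Set ℝ}, τ.leaves = n → e.Legal τ.zone →
      e.faceSide τ.zone = I →
      ∃ ρ : Triple, ρ.leaves = n + 1 ∧ ρ.face (n + 1) = timesSide (τ.face n) I :=
    fun e τ I hn he hI => ⟨prepend e τ, by rw [leaves_prepend he, hn], by rw [face_prepend he, hI]⟩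
  induction h with
  | point => exact ⟨⟨⟨[], by simp⟩, [], ⟨[], by simp⟩⟩, rfl, face_zero _⟩
  | bottom _ ih =>
    obtain ⟨τ, hn, rfl⟩ := ih
    exact step .newFirst τ hn trivial rfl
  | top _ ih =>
    obtain ⟨τ, hn, rfl⟩ := ih
    by_cases hz : τ.zone = .none
    · exact step .newLast τ hn (Or.inl hz) (by rw [hz]; rfl)
    · exact step .same τ hn hz rfl
  | side _ hσ ih =>
    obtain ⟨τ, hn, rfl⟩ := ih
    rw [face_subset_distinguishedFace_iff hn] at hσ
    by_cases hz : τ.zone = .none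
    · exact step .newMid τ hn (Or.inl hz) (by rw [hz]; rfl)
    · refine step .inner τ hn hz ?_
      cases h : τ.zone <;> simp_all [Move.faceSide]
  | lower _ hσ ih =>
    obtain ⟨τ, hn, rfl⟩ := ih
    rw [face_subset_distinguishedFace_iff hn] at hσ
    exact step .newMid τ hn (Or.inr hσ) (by rw [hσ]; rfl)
  | middle _ hσ ih =>
    obtain ⟨τ, hn, rfl⟩ := ih
    rw [face_subset_distinguishedFace_iff hn] at hσ
    exact step .newLast τ hn (Or.inr hσ) (by rw [hσ]; rfl)
  | upper _ hσ ih =>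
    obtain ⟨τ, hn, rfl⟩ := ih
    rw [face_subset_distinguishedFace_iff hn] at hσ
    exact step .inner τ hn (by simp [hσ, Move.Legal]) (by rw [hσ]; rfl)

end Triple

/-! ### Containment of faces and steps between triples -/

/-- Containment of intervals. -/
def SideLE (s s' : ℝ × ℝ) : Prop := s'.1 ≤ s.1 ∧ s.2 ≤ s'.2

theorem SideLE.refl (s : ℝ × ℝ) : SideLE s s := ⟨le_rfl, le_rfl⟩

theorem SideLE.forall₂_refl (b : Box) : List.Forall₂ SideLE b b :=
  List.forall₂_same.2 fun s _ => SideLE.refl s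

theorem SideLE.forall₂_append {a b c d : Box} (h : List.Forall₂ SideLE a b)
    (h' : List.Forall₂ SideLE c d) : List.Forall₂ SideLE (a ++ c) (b ++ d) :=
  List.rel_append h h'

theorem Box.closed_subset_of_forall₂ {b b' : Box} (h : List.Forall₂ SideLE b b') :
    b.closed ⊆ b'.closed := by
  induction h with
  | nil => exact subset_rfl
  | cons h _ ih =>
    intro l hl
    obtain ⟨t, l, rfl, ht, hl⟩ := Box.mem_closed_cons.1 hl
    exact (Box.cons_mem_closed _ _ _ _).2 ⟨⟨h.1.trans ht.1, ht.2.trans h.2⟩, ih hl⟩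

namespace ShortTree

theorem forall₂_word {s i o s' i' o' : ℝ × ℝ} (hs : SideLE s s') (hi : SideLE i i')
    (ho : SideLE o o') (t : ShortTree) :
    List.Forall₂ SideLE (word s i o t) (word s' i' o' t) := by
  have hrep : ∀ n, List.Forall₂ SideLE (List.replicate n s) (List.replicate n s') := fun n => by
    induction n with
    | zero => exact .nil
    | succ n ih => exact .cons hs ih
  induction t with
  | nil => exact .nil
  | cons k t ih =>
    cases t with
    | nil => exact SideLE.forall₂_append (hrep _) (.cons ho .nil)
    | cons l t => exact SideLE.forall₂_append (hrep _) (.cons hi ih)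

theorem word_add {α : Type*} (s i o : α) (k l : ℕ+) (v : ShortTree) :
    word s i o ((k + l) :: v) = List.replicate (k - 1) s ++ s :: word s i o (l :: v) := by
  have hk := k.pos
  have hl := l.pos
  have h : ((k + l : ℕ+) : ℕ) - 1 = ((k : ℕ) - 1) + (((l : ℕ) - 1) + 1) := by
    rw [PNat.add_coe]
    omega
  cases v <;> simp only [word, h, List.replicate_add, List.replicate_succ, List.append_assoc,
    List.cons_append]

theorem forall₂_word_unite {s i o : ℝ × ℝ} (h : SideLE s i) (u v : ShortTree) (k l : ℕ+) :
    List.Forall₂ SideLE (word s i o (u ++ (k + l) :: v)) (word s i o (u ++ k :: l :: v)) := by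
  rw [word_append _ _ _ _ (by simp), word_append _ _ _ _ (by simp), word_add]
  exact SideLE.forall₂_append (SideLE.forall₂_refl _)
    (SideLE.forall₂_append (SideLE.forall₂_refl _) (.cons h (SideLE.forall₂_refl _)))

end ShortTree

theorem forall₂_forestBox {c : ℝ} (hc : 0 ≤ c) {F F₁ : ShortForest} (h : F.Step F₁) :
    List.Forall₂ SideLE (forestBox c F₁.trees) (forestBox c F.trees) := by
  have h₀ : SideLE (0, 0) (0, c) := ⟨le_rfl, hc⟩
  have h₂ : SideLE (c, c) (0, c) := ⟨hc, le_rfl⟩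
  cases h with
  | unite A B u v k l h h₁ =>
    rw [h, h₁, forestBox_append, forestBox_append, forestBox_cons, forestBox_cons]
    exact SideLE.forall₂_append (SideLE.forall₂_refl _) (SideLE.forall₂_append
      (ShortTree.forall₂_word_unite h₀ u v k l) (SideLE.forall₂_refl _))
  | separate A B u v h h₁ =>
    have hv : v ≠ [] := F₁.ne_nil v (by simp [h₁])
    rw [h, h₁, forestBox_append, forestBox_append, forestBox_cons, forestBox_cons, forestBox_cons,
      ShortTree.word_append _ _ _ _ hv, List.append_assoc]
    exact SideLE.forall₂_append (SideLE.forall₂_refl _) (SideLE.forall₂_append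
      (ShortTree.forall₂_word (SideLE.refl _) (SideLE.refl _) h₂ u)
      (SideLE.forall₂_refl _))

namespace Triple

/-- A step shrinks the box of a triple. -/
theorem Step.forall₂_box {τ ρ : Triple} (h : Step τ ρ) : List.Forall₂ SideLE ρ.box τ.box := by
  have h₁ : SideLE ((1 : ℝ), 1) (0, 1) := ⟨zero_le_one, le_rfl⟩
  have h₂ : SideLE ((1 : ℝ), 1) (1 / 2, 1) := ⟨by norm_num, le_rfl⟩
  have h₃ : SideLE ((1 : ℝ) / 2, 1) (0, 1) := ⟨by norm_num, le_rfl⟩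
  have h₄ : SideLE ((0 : ℝ), 1 / 2) (0, 1) := ⟨le_rfl, by norm_num⟩
  have h₅ : SideLE ((1 : ℝ) / 2, 1 / 2) (1 / 2, 1) := ⟨le_rfl, by norm_num⟩
  have h₆ : SideLE ((0 : ℝ), 0) (0, 1) := ⟨le_rfl, zero_le_one⟩
  cases h with
  | fst T G h =>
    exact SideLE.forall₂_append (forall₂_forestBox zero_le_one h) (SideLE.forall₂_refl _)
  | lst F T h =>
    exact SideLE.forall₂_append (SideLE.forall₂_refl _)
      (SideLE.forall₂_append (SideLE.forall₂_refl _) (forall₂_forestBox (by norm_num) h))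
  | unite F G u v k l =>
    exact SideLE.forall₂_append (SideLE.forall₂_refl _) (SideLE.forall₂_append
      (ShortTree.forall₂_word_unite h₆ u v k l) (SideLE.forall₂_refl _))
  | cutLeft F G u v hu =>
    simp only [box, ShortForest.concat, ShortForest.single, forestBox_append, forestBox_cons,
      forestBox_nil, List.append_nil, List.append_assoc]
    refine SideLE.forall₂_append (SideLE.forall₂_refl _) ?_
    rw [← List.append_assoc]
    refine SideLE.forall₂_append ?_ (SideLE.forall₂_refl _)
    by_cases hv : v = []
    · subst hv
      simp only [ShortTree.word_nil, List.append_nil]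
      exact ShortTree.forall₂_word (SideLE.refl _) (SideLE.refl _) h₂ u
    · rw [ShortTree.word_append _ _ _ _ hv]
      exact SideLE.forall₂_append (ShortTree.forall₂_word (SideLE.refl _) (SideLE.refl _) h₁ u)
        (SideLE.forall₂_refl _)
  | cutRight F G u v hv =>
    simp only [box, ShortForest.concat, ShortForest.single, forestBox_append, forestBox_cons,
      forestBox_nil, List.append_nil]
    rw [ShortTree.word_append _ _ _ _ hv, List.append_assoc]
    exact SideLE.forall₂_append (SideLE.forall₂_refl _) (SideLE.forall₂_append
      (ShortTree.forall₂_word (SideLE.refl _) (SideLE.refl _) h₃ u) (SideLE.forall₂_append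
        (ShortTree.forall₂_word (SideLE.refl _) h₄ h₅ v) (SideLE.forall₂_refl _)))

theorem closed_subset_of_reflTransGen {τ ρ : Triple} (h : Relation.ReflTransGen Step τ ρ) :
    ρ.box.closed ⊆ τ.box.closed := by
  induction h with
  | refl => exact subset_rfl
  | tail _ h ih => exact (Box.closed_subset_of_forall₂ h.forall₂_box).trans ih

theorem Step.of_fst {τ ρ : Triple} (h : τ.fst.Step ρ.fst) (hm : τ.mid = ρ.mid)
    (hl : τ.lst = ρ.lst) : Step τ ρ := by
  obtain ⟨F, T, G⟩ := τ
  obtain ⟨F₁, T₁, G₁⟩ := ρ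
  obtain rfl : T = T₁ := hm
  obtain rfl : G = G₁ := hl
  exact .fst T G h

theorem Step.of_lst {τ ρ : Triple} (hf : τ.fst = ρ.fst) (hm : τ.mid = ρ.mid)
    (h : τ.lst.Step ρ.lst) : Step τ ρ := by
  obtain ⟨F, T, G⟩ := τ
  obtain ⟨F₁, T₁, G₁⟩ := ρ
  obtain rfl : T = T₁ := hm
  obtain rfl : F = F₁ := hf
  exact .lst F T h

theorem Step.of_unite {τ ρ : Triple} (hf : τ.fst = ρ.fst) (hl : τ.lst = ρ.lst) (u v : ShortTree)
    (k l : ℕ+) (h : τ.mid = u ++ k :: l :: v) (h' : ρ.mid = u ++ (k + l) :: v) : Step τ ρ := by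
  obtain ⟨F, T, G⟩ := τ
  obtain ⟨F₁, T₁, G₁⟩ := ρ
  obtain rfl : F = F₁ := hf
  obtain rfl : G = G₁ := hl
  obtain rfl : T = _ := h
  obtain rfl : T₁ = _ := h'
  exact .unite F G u v k l

theorem Step.of_cutLeft {τ ρ : Triple} {u : ShortTree} (hu : u ≠ []) (hl : τ.lst = ρ.lst)
    (hm : τ.mid = u ++ ρ.mid) (hf : ρ.fst.trees = τ.fst.trees ++ [u]) : Step τ ρ := by
  obtain ⟨F, T, G⟩ := τ
  obtain ⟨F₁, T₁, G₁⟩ := ρ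
  obtain rfl : G = G₁ := hl
  obtain rfl : T = _ := hm
  obtain rfl : F₁ = F.concat (ShortForest.single u hu) := ShortForest.ext hf
  exact .cutLeft F G u T₁ hu

theorem Step.of_cutRight {τ ρ : Triple} {v : ShortTree} (hv : v ≠ []) (hf : τ.fst = ρ.fst)
    (hm : τ.mid = ρ.mid ++ v) (hl : ρ.lst.trees = v :: τ.lst.trees) : Step τ ρ := by
  obtain ⟨F, T, G⟩ := τ
  obtain ⟨F₁, T₁, G₁⟩ := ρ
  obtain rfl : F = F₁ := hf
  obtain rfl : T = _ := hm
  obtain rfl : G₁ = (ShortForest.single v hv).concat G := ShortForest.ext hl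
  exact .cutRight F G T₁ v hv

/-- Along a step the first leaf may only move outwards, from the middle tree into one of the
forests. -/
theorem Step.zone {τ ρ : Triple} (h : Step τ ρ) : τ.zone ≠ .none ∧ ρ.zone ≠ .none ∧
    (τ.zone = .first → ρ.zone = .first) ∧ (τ.zone = .last → ρ.zone = .last) := by
  have key : ∀ {F F₁ : ShortForest}, F.Step F₁ → F.trees ≠ [] ∧ F₁.trees ≠ [] := by
    intro F F₁ h
    cases h with
    | unite A B u v k l h h₁ => simp [h, h₁]
    | separate A B u v h h₁ => simp [h, h₁]
  cases h with
  | @fst F F₁ T G h =>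
    have := key h
    obtain ⟨_ | ⟨t, F⟩, hF⟩ := F <;> obtain ⟨_ | ⟨t₁, F₁⟩, hF₁⟩ := F₁ <;> simp_all [Triple.zone]
  | @lst G G₁ F T h =>
    have := key h
    obtain ⟨_ | ⟨t, G⟩, hG⟩ := G <;> obtain ⟨_ | ⟨t₁, G₁⟩, hG₁⟩ := G₁ <;>
      obtain ⟨_ | ⟨s, F⟩, hF⟩ := F <;> cases T <;> simp_all [Triple.zone]
  | unite F G u v k l =>
    obtain ⟨_ | ⟨s, F⟩, hF⟩ := F <;> cases u <;> simp [Triple.zone]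
  | cutLeft F G u v hu =>
    obtain ⟨k, u, rfl⟩ := List.exists_cons_of_ne_nil hu
    obtain ⟨_ | ⟨s, F⟩, hF⟩ := F <;> simp [Triple.zone, ShortForest.concat, ShortForest.single]
  | cutRight F G u v hv =>
    obtain ⟨k, v, rfl⟩ := List.exists_cons_of_ne_nil hv
    obtain ⟨_ | ⟨s, F⟩, hF⟩ := F <;> cases u <;>
      simp [Triple.zone, ShortForest.concat, ShortForest.single]

/-- A modification of the first branch of nontrivial trees that commutes with cutting trees and with
uniting branches. -/
structure IsGraft (f : ShortTree → ShortTree) : Prop where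
  ne_nil : ∀ t, t ≠ [] → f t ≠ []
  append : ∀ u v, u ≠ [] → f (u ++ v) = f u ++ v
  unite : ∀ k l v, ∃ u' v' k' l', f (k :: l :: v) = u' ++ k' :: l' :: v' ∧
    f ((k + l) :: v) = u' ++ (k' + l') :: v'

theorem isGraft_inc : IsGraft ShortTree.inc where
  ne_nil _ := ShortTree.inc_ne_nil
  append u v hu := by
    obtain ⟨k, u, rfl⟩ := List.exists_cons_of_ne_nil hu
    rfl
  unite k l v := ⟨[], v, k + 1, l, rfl, by simp [ShortTree.inc, add_right_comm]⟩

theorem isGraft_grow : IsGraft ShortTree.grow where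
  ne_nil t _ := ShortTree.grow_ne_nil t
  append _ _ _ := rfl
  unite k l v := ⟨[1], v, k, l, rfl, rfl⟩

theorem IsGraft.append_unite {f : ShortTree → ShortTree} (hf : IsGraft f) (u v : ShortTree)
    (k l : ℕ+) : ∃ u' v' k' l', f (u ++ k :: l :: v) = u' ++ k' :: l' :: v' ∧
      f (u ++ (k + l) :: v) = u' ++ (k' + l') :: v' := by
  by_cases hu : u = []
  · subst hu
    exact hf.unite k l v
  · exact ⟨f u, v, k, l, hf.append _ _ hu, hf.append _ _ hu⟩

/-- A modification of the first tree of a forest is compatible with steps. -/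
theorem IsGraft.forest_step {f : ShortTree → ShortTree} (hf : IsGraft f) {F F₁ : ShortForest}
    (h : F.Step F₁) : ∃ t B t₁ B₁, F.trees = t :: B ∧ F₁.trees = t₁ :: B₁ ∧
      ∀ F' F₁' : ShortForest, F'.trees = f t :: B → F₁'.trees = f t₁ :: B₁ → F'.Step F₁' := by
  cases h with
  | unite A B u v k l h h₁ =>
    cases A with
    | nil =>
      obtain ⟨u', v', k', l', h₂, h₃⟩ := hf.append_unite u v k l
      refine ⟨_, _, _, _, h, h₁, fun F' F₁' hF hF₁ => .unite [] B u' v' k' l' ?_ ?_⟩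
      · rw [hF, h₂]; rfl
      · rw [hF₁, h₃]; rfl
    | cons a A =>
      exact ⟨_, _, _, _, h, h₁, fun F' F₁' hF hF₁ => .unite (f a :: A) B u v k l hF hF₁⟩
  | separate A B u v h h₁ =>
    cases A with
    | nil =>
      have hu : u ≠ [] := F₁.ne_nil u (by simp [h₁])
      refine ⟨_, _, _, _, h, h₁, fun F' F₁' hF hF₁ => .separate [] B (f u) v ?_ hF₁⟩
      rw [hF, hf.append _ _ hu]; rfl
    | cons a A =>
      exact ⟨_, _, _, _, h, h₁, fun F' F₁' hF hF₁ => .separate (f a :: A) B u v hF hF₁⟩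

theorem IsGraft.step_modify {f : ShortTree → ShortTree} (hf : IsGraft f) {τ ρ : Triple}
    (h : Step τ ρ) : Step (τ.modify f hf.ne_nil) (ρ.modify f hf.ne_nil) := by
  cases h with
  | @fst F F₁ T G h =>
    obtain ⟨t, B, t₁, B₁, h₁, h₂, h₃⟩ := hf.forest_step h
    obtain ⟨F, hF⟩ := F
    obtain ⟨F₁, hF₁⟩ := F₁
    obtain rfl : F = _ := h₁
    obtain rfl : F₁ = _ := h₂
    exact Step.of_fst (h₃ _ _ rfl rfl) rfl rfl
  | @lst G G₁ F T h =>
    obtain ⟨_ | ⟨s, F⟩, hF⟩ := F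
    · cases T with
      | nil =>
        obtain ⟨t, B, t₁, B₁, h₁, h₂, h₃⟩ := hf.forest_step h
        obtain ⟨G, hG⟩ := G
        obtain ⟨G₁, hG₁⟩ := G₁
        obtain rfl : G = _ := h₁
        obtain rfl : G₁ = _ := h₂
        exact Step.of_lst rfl rfl (h₃ _ _ rfl rfl)
      | cons k T => exact .lst _ _ h
    · exact .lst _ _ h
  | unite F G u v k l =>
    obtain ⟨_ | ⟨s, F⟩, hF⟩ := F
    · obtain ⟨u', v', k', l', h₂, h₃⟩ := hf.append_unite u v k l
      cases u with
      | nil => exact Step.of_unite rfl rfl u' v' k' l' h₂ h₃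
      | cons a u => exact Step.of_unite rfl rfl u' v' k' l' h₂ h₃
    · exact .unite _ _ u v k l
  | cutLeft F G u v hu =>
    have h := hf.append u v hu
    have hne := hf.ne_nil u hu
    obtain ⟨k, u, rfl⟩ := List.exists_cons_of_ne_nil hu
    obtain ⟨_ | ⟨s, F⟩, hF⟩ := F
    · exact Step.of_cutLeft hne rfl h rfl
    · exact Step.of_cutLeft hu rfl rfl rfl
  | cutRight F G u v hv =>
    obtain ⟨_ | ⟨s, F⟩, hF⟩ := F
    · cases u with
      | nil =>
        have hne := hf.ne_nil v hv
        obtain ⟨k, v, rfl⟩ := List.exists_cons_of_ne_nil hv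
        exact Step.of_cutRight hne rfl rfl rfl
      | cons a u => exact Step.of_cutRight hv rfl (hf.append (a :: u) v (by simp)) rfl
    · exact Step.of_cutRight hv rfl rfl rfl

theorem fst_mid_eq_nil {τ : Triple} (h : τ.zone = .none ∨ τ.zone = .last) :
    τ.fst.trees = [] ∧ τ.mid = [] := by
  obtain ⟨⟨_ | ⟨t, F⟩, hF⟩, _ | ⟨k, T⟩, G⟩ := τ <;> simp_all [zone]

theorem forest_step_cons {F F₁ : ShortForest} (h : F.Step F₁) (t : ShortTree) (ht : t ≠ []) :
    ShortForest.Step ⟨t :: F.trees, cons_ne_nil ht F.ne_nil⟩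
      ⟨t :: F₁.trees, cons_ne_nil ht F₁.ne_nil⟩ := by
  cases h with
  | unite A B u v k l h h₁ =>
    exact .unite (t :: A) B u v k l (by simp [h]) (by simp [h₁])
  | separate A B u v h h₁ => exact .separate (t :: A) B u v (by simp [h]) (by simp [h₁])

/-- In the absence of a first forest and of a middle tree, a step is made in the last forest. -/
theorem Step.lst_of_zone {τ ρ : Triple} (h : Step τ ρ) (hz : τ.zone = .none ∨ τ.zone = .last) :
    τ.fst = ρ.fst ∧ τ.mid = ρ.mid ∧ τ.lst.Step ρ.lst := by
  obtain ⟨h₁, h₂⟩ := fst_mid_eq_nil hz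
  cases h with
  | fst T G h =>
    exfalso
    cases h with
    | unite A B u v k l h => simp [h] at h₁
    | separate A B u v h => simp [h] at h₁
  | lst F T h => exact ⟨rfl, rfl, h⟩
  | unite F G u v k l => simp at h₂
  | cutLeft F G u v hu => exact absurd (List.append_eq_nil_iff.1 h₂).1 hu
  | cutRight F G u v hv => exact absurd (List.append_eq_nil_iff.1 h₂).2 hv

/-- Adding a leaf on the left is compatible with steps. -/
theorem Step.prepend {τ ρ : Triple} (h : Step τ ρ) {e : Move} (he : e.Legal τ.zone) :
    Step (prepend e τ) (prepend e ρ) := by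
  cases e with
  | newFirst =>
    cases h with
    | fst T G h => exact Step.of_fst (forest_step_cons h [1] (by simp)) rfl rfl
    | lst F T h => exact .lst _ _ h
    | unite F G u v k l => exact .unite _ _ u v k l
    | cutLeft F G u v hu => exact Step.of_cutLeft hu rfl rfl rfl
    | cutRight F G u v hv => exact Step.of_cutRight hv rfl rfl rfl
  | newMid =>
    obtain ⟨h₁, -, h₃⟩ := h.lst_of_zone he
    exact Step.of_lst h₁ rfl h₃
  | newLast =>
    obtain ⟨h₁, h₂, h₃⟩ := h.lst_of_zone he
    exact Step.of_lst h₁ h₂ (forest_step_cons h₃ [1] (by simp))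
  | same => exact isGraft_inc.step_modify h
  | inner => exact isGraft_grow.step_modify h

/-- If a step moves the whole middle tree into the last forest, then, after adding a first branch to
the middle tree, this branch may be left behind. -/
theorem Step.prepend_inner_newMid {τ ρ : Triple} (h : Step τ ρ) (hτ : τ.zone = .mid)
    (hρ : ρ.zone = .last) : Step (Triple.prepend .inner τ) (Triple.prepend .newMid ρ) := by
  obtain ⟨h₁, h₂⟩ := fst_mid_eq_nil (Or.inr hρ)
  cases h with
  | fst T G h =>
    exfalso
    cases h with
    | unite A B u v k l h h' => simp [h'] at h₁
    | separate A B u v h h' => simp [h'] at h₁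
  | @lst G G₁ F T h =>
    exfalso
    obtain ⟨_ | ⟨s, F⟩, hF⟩ := F
    · obtain rfl : T = [] := h₂
      obtain ⟨_ | ⟨s, G⟩, hG⟩ := G <;> simp [Triple.zone] at hτ
    · simp at h₁
  | unite F G u v k l => simp at h₂
  | cutLeft F G u v hu => simp [ShortForest.concat, ShortForest.single] at h₁
  | cutRight F G u v hv =>
    obtain rfl : u = [] := h₂
    obtain ⟨k, v, rfl⟩ := List.exists_cons_of_ne_nil hv
    obtain ⟨_ | ⟨s, F⟩, hF⟩ := F
    · exact Step.of_cutRight hv rfl rfl rfl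
    · simp at h₁

/-- Shrinking the side of the first leaf. -/
theorem reflTransGen_prepend {ρ : Triple} {e e' : Move} (he : e.Legal ρ.zone)
    (he' : e'.Legal ρ.zone) (h : SideLE (e'.side ρ.zone) (e.side ρ.zone)) :
    Relation.ReflTransGen Step (prepend e ρ) (prepend e' ρ) := by
  by_cases hee : e = e'
  · rw [hee]
  refine Relation.ReflTransGen.single ?_
  have h₀ : ¬ (1 : ℝ) ≤ 2⁻¹ := by norm_num
  have h₁ : (2 : ℝ)⁻¹ ≤ 1 := by norm_num
  have h₂ : ¬ (2 : ℝ)⁻¹ ≤ 0 := by norm_num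
  have h₃ : ¬ (1 : ℝ) ≤ 0 := by norm_num
  have hinc : ∀ t : ShortTree, t ≠ [] → ∃ k l v, t.grow = [] ++ k :: l :: v ∧
      t.inc = [] ++ (k + l) :: v := by
    intro t ht
    obtain ⟨k, t, rfl⟩ := List.exists_cons_of_ne_nil ht
    exact ⟨1, k, t, rfl, by simp [ShortTree.inc, add_comm]⟩
  obtain ⟨⟨_ | ⟨t, F⟩, hF⟩, _ | ⟨k, T⟩, ⟨_ | ⟨s, G⟩, hG⟩⟩ := ρ
  all_goals
    cases e <;> cases e' <;>
      simp [zone, Move.Legal, Move.side, SideLE, h₀, h₁, h₂, h₃] at he he' h hee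
  all_goals
    first
    | exact Step.of_cutLeft (u := [1]) (by simp) rfl rfl rfl
    | exact Step.of_cutRight (v := [1]) (by simp) rfl rfl rfl
    | exact Step.of_fst (.separate [] F [1] t rfl rfl) rfl rfl
    | exact Step.of_lst rfl rfl (.separate [] G [1] s rfl rfl)
    | (obtain ⟨k', l', v', h, h'⟩ := hinc (k :: T) (by simp)
       exact Step.of_unite rfl rfl [] v' k' l' h h')
    | (obtain ⟨k', l', v', h, h'⟩ := hinc t (hF t (by simp))
       exact Step.of_fst (.unite [] F [] v' k' l' (congrArg (· :: F) h) (congrArg (· :: F) h'))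
        rfl rfl)
    | (obtain ⟨k', l', v', h, h'⟩ := hinc s (hG s (by simp))
       exact Step.of_lst rfl rfl
        (.unite [] G [] v' k' l' (congrArg (· :: G) h) (congrArg (· :: G) h')))

/-- A sequence of steps for the remaining leaves is lifted to all leaves while the side of the first
leaf shrinks from that of `e` to that of `e'`. -/
theorem reflTransGen_prepend_of {τ ρ : Triple} (h : Relation.ReflTransGen Step τ ρ) {e e' : Move}
    (he : e.Legal τ.zone) (he' : e'.Legal ρ.zone)
    (hs : SideLE (e'.side ρ.zone) (e.side τ.zone)) :
    Relation.ReflTransGen Step (prepend e τ) (prepend e' ρ) := by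
  induction h using Relation.ReflTransGen.head_induction_on generalizing e with
  | refl => exact reflTransGen_prepend he he' hs
  | @head τ τ₁ h hτ₁ ih =>
    obtain ⟨-, hn, hfirst, hlast⟩ := h.zone
    have he₁ : e.Legal τ₁.zone := by
      cases e with
      | newFirst => trivial
      | newMid => exact Or.inr (hlast (he.resolve_left h.zone.1))
      | newLast => exact Or.inr (hlast (he.resolve_left h.zone.1))
      | same => exact hn
      | inner => exact hn
    by_cases hs₁ : SideLE (e'.side ρ.zone) (e.side τ₁.zone)
    · exact .head (h.prepend he) (ih he₁ hs₁)
    · -- the side shrinks only if the first leaf moves from the middle tree to the last forest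
      have hρ : τ₁.zone = .last → ρ.zone = .last := fun hz => by
        clear ih hs hs₁ he₁ hlast hfirst hn he'
        induction hτ₁ with
        | refl => exact hz
        | tail _ h ih => exact h.zone.2.2.2 ih
      have key : e = .inner ∧ τ.zone = .mid ∧ τ₁.zone = .last := by
        have h₁ := h.zone.1
        generalize τ.zone = z at *
        generalize τ₁.zone = z₁ at *
        cases e <;> cases z <;> cases z₁ <;> simp_all [Move.side]
      obtain ⟨rfl, hz, hz₁⟩ := key
      refine .head (h.prepend_inner_newMid hz hz₁) (ih (Or.inr hz₁) ?_)
      rw [hρ hz₁] at hs hs₁ ⊢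
      rw [hz₁] at hs₁
      revert hs hs₁
      have h₂ : (2 : ℝ)⁻¹ ≤ 1 := by norm_num
      cases e' <;> simp [Move.side, SideLE, h₂]

theorem reflTransGen_of_closed_subset {τ ρ : Triple} (hl : τ.leaves = ρ.leaves)
    (h : ρ.box.closed ⊆ τ.box.closed) : Relation.ReflTransGen Step τ ρ := by
  induction τ using prepend_induction generalizing ρ with
  | zero τ h₀ => rw [eq_of_leaves_eq_zero h₀, eq_of_leaves_eq_zero (τ := ρ) (by omega)]
  | prepend e τ he ih =>
    rw [leaves_prepend he] at hl
    obtain ⟨e', ρ, he', rfl⟩ := exists_prepend (τ := ρ) (by omega)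
    rw [leaves_prepend he'] at hl
    rw [box_prepend he, box_prepend he'] at h
    have hside : (e'.side ρ.zone).1 ≤ (e'.side ρ.zone).2 :=
      (prepend e' ρ).proper_box _ (by rw [box_prepend he']; simp)
    obtain ⟨l₀, hl₀⟩ := ρ.box_closed_nonempty
    refine reflTransGen_prepend_of (ih (by omega) fun l hl => ?_) he he' ⟨?_, ?_⟩
    · exact ((Box.cons_mem_closed _ _ _ _).1
        (h ((Box.cons_mem_closed _ _ _ _).2 ⟨left_mem_Icc.2 hside, hl⟩))).2
    · exact ((Box.cons_mem_closed _ _ _ _).1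
        (h ((Box.cons_mem_closed _ _ _ _).2 ⟨left_mem_Icc.2 hside, hl₀⟩))).1.1
    · exact ((Box.cons_mem_closed _ _ _ _).1
        (h ((Box.cons_mem_closed _ _ _ _).2 ⟨right_mem_Icc.2 hside, hl₀⟩))).1.2

end Triple

/-! ### Coordinates on the cubes -/

theorem ShortTree.word_replicate_one {α : Type*} (s i o : α) (n : ℕ) :
    word s i o (List.replicate (n + 1) 1) = List.replicate n i ++ [o] := by
  induction n with
  | zero => simp
  | succ n ih =>
    change word s i o (grow (List.replicate (n + 1) 1)) = _
    rw [word_grow _ _ _ (by simp), ih, List.replicate_succ, List.cons_append]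

theorem ShortTree.leaves_replicate_one (n : ℕ) : leaves (List.replicate n 1) = n := by
  induction n with
  | zero => rfl
  | succ n ih =>
    rw [List.replicate_succ, leaves_cons, ih, PNat.one_coe, add_comm]

theorem Box.mem_closed_iff_getD {b : Box} {n : ℕ} (hb : b.length = n) (z : Fin n → ℝ) :
    List.ofFn z ∈ b.closed ↔
      ∀ i : Fin n, z i ∈ (b.map fun s => Icc s.1 s.2).getD i univ := by
  induction b generalizing n with
  | nil =>
    obtain rfl : 0 = n := hb
    simp
  | cons s b ih =>
    obtain rfl : b.length + 1 = n := hb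
    rw [List.ofFn_succ, cons_mem_closed, ih rfl, Fin.forall_fin_succ]
    simp

theorem length_cubeCoords (n : ℕ) (z : Fin (n - 1) → ℝ) : (cubeCoords n z).length = n := by
  cases n <;> simp [cubeCoords]

namespace ShortForest

theorem flatMap_treeSides (F : ShortForest) : F.trees.flatMap (treeSides {0} (Icc 0 1) {1}) =
    (forestBox 1 F.trees).map fun s => Icc s.1 s.2 := by
  simp only [forestBox, List.map_flatMap, ShortTree.map_word, Icc_self]
  exact congrArg (List.flatMap · F.trees) (funext (ShortTree.treeSides_eq_word _ _ _))

/-- The last leaf of a nonempty forest contributes the constant letter `1`. -/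
theorem exists_forestBox_eq {F : ShortForest} {n : ℕ} (h : F.leaves = n + 1) :
    ∃ b : Box, b.length = n ∧ forestBox 1 F.trees = b ++ [(1, 1)] := by
  have key : ∀ t : ShortTree, t ≠ [] →
      ∃ b : Box, ShortTree.word (0, 0) ((0 : ℝ), (1 : ℝ)) (1, 1) t = b ++ [(1, 1)] := by
    intro t ht
    obtain ⟨u, k, rfl⟩ := List.eq_nil_or_concat' t |>.resolve_left ht
    rw [ShortTree.word_append _ _ _ _ (by simp)]
    exact ⟨_, (List.append_assoc _ _ _).symm⟩
  obtain hF | ⟨A, t, hF⟩ := List.eq_nil_or_concat' F.trees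
  · simp [leaves, hF] at h
  · obtain ⟨b, hb⟩ := key t (F.ne_nil t (by simp [hF]))
    have hlen := length_forestBox 1 F.trees
    have heq : forestBox 1 F.trees = (forestBox 1 A ++ b) ++ [(1, 1)] := by
      rw [hF, forestBox_append, forestBox_cons, hb, forestBox_nil, List.append_nil,
        List.append_assoc]
    refine ⟨_, ?_, heq⟩
    rw [heq, List.length_append, List.length_singleton] at hlen
    exact Nat.succ.inj (hlen.trans h)

theorem mem_face_iff {n : ℕ} (F : ShortForest) (h : F.leaves = n) (z : Fin (n - 1) → ℝ) :
    z ∈ F.face n ↔ cubeCoords n z ∈ (forestBox 1 F.trees).closed := by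
  simp only [face, flatMap_treeSides, mem_ofPred_eq]
  cases n with
  | zero =>
    have : forestBox 1 F.trees = [] :=
      List.length_eq_zero_iff.1 ((length_forestBox _ _).trans h)
    rw [this, Box.closed_nil]
    exact ⟨fun _ => rfl, fun _ i => i.elim0⟩
  | succ n =>
    obtain ⟨b, hb, hF⟩ := exists_forestBox_eq h
    rw [hF]
    have : cubeCoords (n + 1) z ∈ Box.closed (b ++ [(1, 1)]) ↔ List.ofFn z ∈ b.closed := by
      rw [Box.mem_closed_concat]
      exact ⟨fun ⟨l, hl, h⟩ => List.append_cancel_right h ▸ hl, fun hl => ⟨_, hl, rfl⟩⟩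
    rw [this, Box.mem_closed_iff_getD (n := n + 1 - 1) hb]
    refine forall_congr' fun i => ?_
    rw [List.map_append, List.getD_append _ _ _ _ (by rw [List.length_map, hb]; exact i.2)]

theorem side_subset {F : List ShortTree} {s : ℝ × ℝ} (h : s ∈ forestBox 1 F) :
    Icc s.1 s.2 ⊆ Icc 0 1 := by
  obtain ⟨t, -, ht⟩ := List.mem_flatMap.1 h
  have key : ∀ t : ShortTree, s ∈ t.word ((0 : ℝ), (0 : ℝ)) (0, 1) (1, 1) →
      s = (0, 0) ∨ s = (0, 1) ∨ s = (1, 1) := by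
    intro t ht
    induction t with
    | nil => simp at ht
    | cons k t ih =>
      cases t with
      | nil =>
        simp only [ShortTree.word, List.mem_append, List.mem_replicate, List.mem_singleton] at ht
        tauto
      | cons l t =>
        rw [ShortTree.word, List.mem_append, List.mem_cons, List.mem_replicate] at ht
        tauto
  rcases key t ht with rfl | rfl | rfl <;> simp

theorem iUnion_face (n : ℕ) :
    (Icc 0 1 : Set (Fin (n - 1) → ℝ)) = ⋃ F : {F : ShortForest // F.leaves = n}, F.1.face n := by
  ext z
  rw [mem_iUnion]
  cases n with
  | zero =>
    exact ⟨fun _ => ⟨⟨⟨[], by simp⟩, rfl⟩, fun i => i.elim0⟩,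
      fun _ => ⟨fun i => i.elim0, fun i => i.elim0⟩⟩
  | succ n =>
    constructor
    · intro hz
      have hword := ShortTree.word_replicate_one ({0} : Set ℝ) (Icc 0 1) {1} n
      refine ⟨⟨single (List.replicate (n + 1) 1) (by simp), ?_⟩, fun i => ?_⟩
      · simp [single, leaves, ShortTree.leaves_replicate_one]
      · have hi : (i : ℕ) < n := i.2
        simp only [single, List.flatMap_singleton, ShortTree.treeSides_eq_word, hword]
        rw [List.getD_append _ _ _ _ (by simp), List.getD_replicate _ hi]
        exact ⟨hz.1 i, hz.2 i⟩
    · rintro ⟨F, hz⟩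
      have h : ∀ i, z i ∈ Icc 0 1 := fun i => by
        have hi := hz i
        have hlt : (i : ℕ) < (forestBox 1 F.1.trees).length := by
          rw [length_forestBox]
          exact (i.2.trans n.lt_succ_self).trans_eq F.2.symm
        rw [flatMap_treeSides, List.getD_eq_getElem _ _ (by simpa using hlt),
          List.getElem_map] at hi
        exact side_subset (List.getElem_mem hlt) hi
      exact ⟨fun i => (h i).1, fun i => (h i).2⟩

end ShortForest

theorem getD_cubeCoords (n : ℕ) (z : Fin (n - 1) → ℝ) (r : List ℝ) (i : Fin (n - 1)) :
    (cubeCoords n z ++ r).getD i 0 = z i := by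
  cases n with
  | zero => exact i.elim0
  | succ n =>
    rw [cubeCoords, List.append_assoc, List.getD_append _ _ _ _ (by simp),
      List.getD_eq_getElem _ _ (by simp), List.getElem_ofFn]

theorem exists_cubeCoords {n : ℕ} (x : cubeData.seq.obj (colM n) .m) :
    ∃ z, x.val = cubeCoords n z ++ [1] := by
  obtain ⟨F, w, hF, hw, hx⟩ := cubeData.exists_core x
  refine (?_ : ∃ z, w = cubeCoords n z).imp fun z hz => hx.trans (by rw [hz]; rfl)
  change w ∈ (forestBox 1 F.trees).closed at hw
  cases n with
  | zero =>
    refine ⟨0, List.length_eq_zero_iff.1 ?_⟩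
    rw [Box.length_eq_of_mem_closed hw, length_forestBox]
    exact hF
  | succ n =>
    obtain ⟨b, hb, h⟩ := ShortForest.exists_forestBox_eq hF
    rw [h] at hw
    obtain ⟨v, hv, rfl⟩ := Box.mem_closed_concat.1 hw
    obtain rfl : v.length = n := (Box.length_eq_of_mem_closed hv).trans hb
    exact ⟨v.get, by simp [cubeCoords]⟩

/-- The cell structure on the space of operations of profile `(aⁿ, m; m)` is that of the cube. -/
noncomputable def cubeModel (n : ℕ) : CellModel (cubeData.seq.obj (colM n) .m) (Icc 0 1)
    (fun F : {F : ShortForest // F.leaves = n} => F.1.face n) (fun F => F.1.dim) :=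
  cubeData.model (fun x i => x.val.getD i 0) (cubeCoords n)
    (continuous_pi fun i => (continuous_apply (i : ℕ)).comp
      (BoxFamily.isInducing_coords _).continuous)
    (fun x => by
      obtain ⟨z, hz⟩ := exists_cubeCoords x
      simp only [hz, getD_cubeCoords]
      rfl)
    (fun x z h => funext fun i => by rw [h, getD_cubeCoords])
    (fun F z => F.1.mem_face_iff F.2 z) (ShortForest.iUnion_face n)
    (fun F => F.1.dim_forestBox)

theorem cubeModel_val {n : ℕ} (x : cubeData.seq.obj (colM n) .m) :
    x.val = cubeCoords n ((cubeModel n).coord x) ++ [1] := by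
  obtain ⟨z, hz⟩ := exists_cubeCoords x
  have : (cubeModel n).coord x = z := funext fun i => by
    change x.val.getD i 0 = z i
    rw [hz, getD_cubeCoords]
  rw [this, hz]

theorem cubeCoords_of_rel {k q N : ℕ} {x : cubeData.seq.obj (colM k) .m}
    {y : cubeData.seq.obj (colM q) .m} {z : cubeData.seq.obj (colM N) .m}
    {as : List cubeData.seq.Op} (h : (wordMap cubeComp.wordClosed).Rel as x y z) :
    cubeCoords N ((cubeModel N).coord z) =
      dilate 0 (as.map Op.arity) (cubeCoords k ((cubeModel k).coord x)) ++
        cubeCoords q ((cubeModel q).coord y) := by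
  obtain ⟨h, he⟩ := h
  have hout : as.map Op.output = colA k := by
    have h' : (as ++ [op y]).map Op.output = colM k := h
    rw [List.map_append] at h'
    exact List.append_cancel_right h'
  have hlen : (as.map Op.arity).length = k := by
    simpa [colA] using congrArg List.length hout
  have has : ∀ a ∈ as, a.output = .a := fun a ha =>
    List.eq_of_mem_replicate (hout ▸ List.mem_map_of_mem (f := Op.output) ha)
  have hword : wordComp x.val ((as ++ [op y]).map opWord) = z.val := congrArg opWord he
  rw [List.map_append, (CellData.args_a has).2.2, List.map_singleton,
    show opWord (op y) = y.val from rfl, cubeModel_val x, cubeModel_val y, cubeModel_val z,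
    wordComp_block_append _ _ _ _ (by rw [hlen, length_cubeCoords])] at hword
  simp only [one_mul, List.map_id', ← List.append_assoc] at hword
  exact (List.append_cancel_right hword).symm

/-- The operad of cubes with its labels and coordinates. -/
noncomputable def cubeOperad : CubeOperad cubeCWOperad where
  strict := cubeData.isStrictAlgebra
  model := cubeModel
  comp_label _ _ _ _ _ _ _ hk has h := cubeComp.bijectiveOnProduct_openCell hk has h
  comp_coord _ _ _ _ _ _ _ h := cubeCoords_of_rel h

/-! ### Coordinates on the freehedra -/

namespace Triple

theorem face_subset_Icc {n : ℕ} {τ : Triple} (h : τ.leaves = n) : τ.face n ⊆ Icc 0 1 := by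
  induction τ using prepend_induction generalizing n with
  | zero τ h₀ =>
    obtain rfl : n = 0 := by omega
    exact fun x _ => ⟨fun i => i.elim0, fun i => i.elim0⟩
  | prepend e τ he ih =>
    rw [leaves_prepend he] at h
    subst h
    rw [face_prepend he]
    rintro x ⟨hx, ht⟩
    have hside : e.faceSide τ.zone ⊆ Icc 0 1 := by
      generalize τ.zone = z
      have h₁ : (0 : ℝ) ≤ 1 / 2 := by norm_num
      have h₂ : (1 : ℝ) / 2 ≤ 1 := by norm_num
      cases e <;> cases z <;> first
        | exact Icc_subset_Icc le_rfl le_rfl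
        | exact Icc_subset_Icc le_rfl h₂
        | exact Icc_subset_Icc h₁ le_rfl
        | exact singleton_subset_iff.2 ⟨by norm_num, by norm_num⟩
    have h := ih rfl hx
    exact ⟨fun i => Fin.lastCases (hside ht).1 (fun i => h.1 i) i,
      fun i => Fin.lastCases (hside ht).2 (fun i => h.2 i) i⟩

theorem iUnion_face (n : ℕ) :
    (Icc 0 1 : Set (Fin n → ℝ)) = ⋃ τ : {τ : Triple // τ.leaves = n}, τ.1.face n := by
  refine Subset.antisymm (fun x hx => mem_iUnion.2 ?_) (iUnion_subset fun τ => face_subset_Icc τ.2)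
  cases n with
  | zero => exact ⟨⟨⟨⟨[], by simp⟩, [], ⟨[], by simp⟩⟩, rfl⟩, fun i => i.elim0⟩
  | succ n =>
    refine ⟨⟨⟨⟨[], by simp⟩, List.replicate (n + 1) 1, ⟨[], by simp⟩⟩, ?_⟩, fun i => ?_⟩
    · simp [leaves, ShortForest.leaves, ShortTree.leaves_replicate_one]
    · have hsides : sides ⟨⟨[], by simp⟩, List.replicate (n + 1) 1, ⟨[], by simp⟩⟩ =
          List.replicate (n + 1) (Icc 0 1) := by
        simp only [sides, lastSides, ShortTree.treeSides_eq_word, ShortTree.word_replicate_one,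
          List.flatMap_nil, List.nil_append, List.append_nil, if_true]
        exact List.replicate_succ'.symm
      rw [hsides, List.getD_replicate _ i.2]
      exact ⟨hx.1 _, hx.2 _⟩

/-- The coordinates of a point of the freehedron, read off from its word (which may be followed by
further letters). -/
noncomputable def freehedronCoords (n : ℕ) (l : List ℝ) (i : Fin n) : ℝ :=
  (if (i : ℕ) = 0 then 2 else 1) * (1 - l.getD (n - 1 - i) 0)

theorem freehedronCoords_word (n : ℕ) (x : Fin n → ℝ) (r : List ℝ) :
    freehedronCoords n (freehedronWord n x ++ r) = x := by
  induction n with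
  | zero => exact funext fun i => i.elim0
  | succ n ih =>
    funext i
    cases n with
    | zero =>
      obtain rfl : i = 0 := Subsingleton.elim (α := Fin 1) _ _
      simp only [freehedronCoords, freehedronWord]
      simp
      ring
    | succ n =>
      induction i using Fin.lastCases with
      | last => simp [freehedronCoords, freehedronWord]
      | cast i =>
        rw [← congrFun (ih fun i => x i.castSucc) i]
        have : n + 1 + 1 - 1 - (i : ℕ) = (n + 1 - 1 - i) + 1 := by
          have := i.2
          omega
        simp only [freehedronCoords, freehedronWord, Fin.val_castSucc, this, List.cons_append,
          List.getD_cons_succ]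

end Triple

theorem exists_freehedronWord_eq_val {n : ℕ} (x : freehedronData.seq.obj (colM n) .m) :
    ∃ z, x.val = Triple.freehedronWord n z ++ [1 / 2] := by
  obtain ⟨τ, w, hτ, hw, hx⟩ := freehedronData.exists_core x
  obtain ⟨z, hz⟩ := Triple.exists_freehedronWord w
  obtain rfl : w.length = n := by
    rw [Box.length_eq_of_mem_closed hw]
    exact τ.length_box.trans hτ
  exact ⟨z, by rw [hz]; exact hx⟩

/-- The cell structure on the space of operations of profile `(aⁿ, m; m)` in the bimodule is that of
the freehedron. -/
noncomputable def freehedronModel (n : ℕ) :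
    CellModel (freehedronData.seq.obj (colM n) .m) (Icc 0 1)
      (fun τ : {τ : Triple // τ.leaves = n} => τ.1.face n) (fun τ => τ.1.dim) :=
  freehedronData.model (fun x => Triple.freehedronCoords n x.val) (Triple.freehedronWord n)
    (continuous_pi fun i => continuous_const.mul (continuous_const.sub
      ((continuous_apply (n - 1 - (i : ℕ))).comp (BoxFamily.isInducing_coords _).continuous)))
    (fun x => by
      obtain ⟨z, hz⟩ := exists_freehedronWord_eq_val x
      simp only [hz, Triple.freehedronCoords_word]
      rfl)
    (fun x z h => by rw [h, Triple.freehedronCoords_word])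
    (fun τ z => τ.1.mem_face_iff τ.2 z) (Triple.iUnion_face n) (fun τ => τ.1.dim_box)

/-- The bimodule of freehedra with its labels. -/
noncomputable def freehedralBimodule : FreehedralBimodule cubeOperad freehedronBimodule where
  strict := freehedronData.isStrictAlgebra
  model := freehedronModel
  left_label _ _ _ _ _ _ _ hk has h := leftComp.bijectiveOnProduct_openCell hk has h
  right_label _ _ _ _ _ _ _ hk has h := rightComp.bijectiveOnProduct_openCell hk has h

theorem mainTheorem4 :
    -- the triples label exactly the faces of the freehedra
    (∀ (n : ℕ) (σ : Set (Fin n → ℝ)),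
      IsFreehedronFace n σ ↔ ∃ τ : Triple, τ.leaves = n ∧ τ.face n = σ) ∧
    -- the subface relation is generated by the transformations of triples
    (∀ (n : ℕ) (τ ρ : Triple), τ.leaves = n → ρ.leaves = n →
      (ρ.face n ⊆ τ.face n ↔ Relation.ReflTransGen Triple.Step τ ρ)) ∧
    -- the freehedra form a bimodule over the operad of cubes
    ∃ (P : CWOperad Color) (κ : CubeOperad P) (M : CWBimodule P),
      Nonempty (FreehedralBimodule κ M) := by
  refine ⟨fun n σ => ⟨Triple.exists_face_eq, ?_⟩, fun n τ ρ hτ hρ => ?_,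
    ⟨cubeCWOperad, cubeOperad, freehedronBimodule, ⟨freehedralBimodule⟩⟩⟩
  · rintro ⟨τ, hτ, rfl⟩
    exact Triple.isFreehedronFace_face hτ
  · rw [Triple.face_subset_iff hτ hρ]
    exact ⟨Triple.reflTransGen_of_closed_subset (hτ.trans hρ.symm),
      Triple.closed_subset_of_reflTransGen⟩
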